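/- Let $p\ge 2$ be an integer, let $E$ be a locally compact separable metric space, and let $m$ be a Radon measure on $E$ with $\operatorname{supp} m=E$. Let $X^{(1)},\dots,X^{(p)}$ be independent $m$-symmetric Hunt processes on $E$, defined on a common probability space $(\Omega,\mathbb P)$, started at given points $x^{(1)}_0,\dots,x^{(p)}_0\in E$, with life times $\zeta^{(1)},\dots,\zeta^{(p)}$. Suppose each $X^{(i)}$ has a (jointly measurable) transition density $p^{(i)}_t(x,y)$: for all $s>0$ and $x\in E$, the transition probability satisfies $p^{(i)}_s(x,dy)=p^{(i)}_s(x,y)\,m(dy)$. Assume that for each $i$ $$\sup_{x\in E}\int_E R^{(i)}_1(x,y)^p\,m(dy)<\infty,\qquad\text{where } R^{(i)}_1(x,y)=\int_0^\infty e^{-s}p^{(i)}_s(x,y)\,ds .$$ Fix $t>0$. Then $\mathbb P(t<\zeta^{(1)}\wedge\dots\wedge\zeta^{(p)})>0$; write $\widetilde{\mathbb P}_t=\mathbb P(\,\cdot\mid t<\zeta^{(1)}\wedge\dots\wedge\zeta^{(p)})$. For $\varepsilon>0$ let $$\ell^{\mathrm{IS}}_{\varepsilon,t}(A)=\int_A\Big[\int_{[0,t]^p}\prod_{i=1}^p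 p^{(i)}_\varepsilon\big(X^{(i)}(s_i),x\big)\,ds_1\cdots ds_p\Big]\,m(dx),\qquad A\subset E\text{ Borel},$$ on the event $\{t<\zeta^{(1)}\wedge\dots\wedge\zeta^{(p)}\}$. For each $\varepsilon>0$ the measure $\ell^{\mathrm{IS}}_{\varepsilon,t}$ is $\widetilde{\mathbb P}_t$-almost surely finite. Let $\mathcal M_f(E)$ be the set of finite Borel measures on $E$ with the vague topology. There is a random measure $\ell^{\mathrm{IS}}_t\in\mathcal M_f(E)$, defined on $\Omega$, such that 1. $\ell^{\mathrm{IS}}_{\varepsilon,t}\to\ell^{\mathrm{IS}}_t$ in distribution in $\mathcal M_f(E)$ (vague topology) as $\varepsilon\downarrow0$, with respect to $\widetilde{\mathbb P}_t$; 2. for every nonnegative continuous compactly supported $f:E\to\mathbb R$ and every integer $k\ge1$, the random variables $\langle f,\ell^{\mathrm{IS}}_{\varepsilon,t}\rangle$ ($\varepsilon>0$) and $\langle f,\ell^{\mathrm{IS}}_t\rangle$ belong to $L^k(\widetilde{\mathbb P}_t)$, and $$\langle f,\ell^{\mathrm{IS}}_{\varepsilon,t}\rangle\to\langle f,\ell^{\mathrm{IS}}_t\rangle\quad\text{in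 }L^k(\widetilde{\mathbb P}_t)\quad\text{as }\varepsilon\downarrow0 .$$ -/

import Mathlib

open MeasureTheory ProbabilityTheory Filter Topology
open scoped ENNReal NNReal CompactlySupported

noncomputable section

/-! ### Finite measures with the vague topology -/

/-- The set `M_f(E)` of finite measures on `E`.  (A type of its own, because Mathlib's
`FiniteMeasure E` carries the weak topology, not the vague one.) -/
structure FinMeas (E : Type*) [MeasurableSpace E] where
  /-- the underlying measure -/
  toMeasure : Measure E
  isFinite : IsFiniteMeasure toMeasure

namespace FinMeas

variable {E : Type*} [MeasurableSpace E]

/-- The integral `⟨f, μ⟩` of a real function. -/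
def pairing (μ : FinMeas E) (f : E → ℝ) : ℝ := ∫ x, f x ∂μ.toMeasure

open Classical in
/-- A measure as an element of `M_f(E)`; a measure of infinite mass is sent to `0`. -/
def ofMeasure (μ : Measure E) : FinMeas E :=
  if h : IsFiniteMeasure μ then ⟨μ, h⟩ else ⟨0, inferInstance⟩

/-- The vague topology: the coarsest topology that makes `μ ↦ ⟨f, μ⟩` continuous for every
continuous compactly supported `f`. -/
instance instTopologicalSpace [TopologicalSpace E] : TopologicalSpace (FinMeas E) :=
  TopologicalSpace.induced (fun μ (f : C_c(E, ℝ)) => μ.pairing f) inferInstance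

/-- The Borel σ-algebra of the vague topology. -/
instance instMeasurableSpace [TopologicalSpace E] : MeasurableSpace (FinMeas E) :=
  borel (FinMeas E)

instance instBorelSpace [TopologicalSpace E] : BorelSpace (FinMeas E) := ⟨rfl⟩

end FinMeas

/-! ### Hunt processes -/

/-- The Borel σ-algebra of the one-point compactification `E ∪ {∞}`.  The point `∞` is the
cemetery; it is isolated when `E` is compact. -/
instance instMeasurableSpaceOnePoint {E : Type*} [TopologicalSpace E] :
    MeasurableSpace (OnePoint E) := borel (OnePoint E)

instance instBorelSpaceOnePoint {E : Type*} [TopologicalSpace E] :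
    BorelSpace (OnePoint E) := ⟨rfl⟩

/-- A Hunt process on `E` with cemetery `∞`, realised on the measurable space `Ω`: a normal,
right-continuous, quasi-left-continuous strong Markov process with left limits, absorbed in the
cemetery. -/
structure HuntProcess (E Ω : Type*) [TopologicalSpace E] [mΩ : MeasurableSpace Ω] where
  /-- the path `t ↦ X_t(ω)` -/
  X : ℝ≥0 → Ω → OnePoint E
  /-- the laws `P_x` -/
  P : Kernel (OnePoint E) Ω
  /-- the right-continuous admissible filtration -/
  𝓕 : Filtration ℝ≥0 mΩ
  isMarkovKernel : IsMarkovKernel P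
  isRightContinuous : 𝓕.IsRightContinuous
  adapted : ∀ t, Measurable[𝓕 t] (X t)
  /-- normality: `P_x(X_0 = x) = 1` -/
  normal : ∀ x, ∀ᵐ ω ∂(P x), X 0 ω = x
  /-- the cemetery is absorbing -/
  absorbing : ∀ (ω : Ω) (s t : ℝ≥0), s ≤ t → X s ω = OnePoint.infty → X t ω = OnePoint.infty
  right_continuous : ∀ (ω : Ω) (t : ℝ≥0), ContinuousWithinAt (fun s => X s ω) (Set.Ici t) t
  left_limits : ∀ (ω : Ω) (t : ℝ≥0), 0 < t → ∃ l, Tendsto (fun s => X s ω) (𝓝[<] t) (𝓝 l)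
  /-- the strong Markov property: `P_x(X_{τ+s} ∈ B | 𝓕_τ) = P_{X_τ}(X_s ∈ B)` on `{τ < ∞}` -/
  strong_markov : ∀ (τ : Ω → WithTop ℝ≥0) (hτ : IsStoppingTime 𝓕 τ) (x : OnePoint E) (s : ℝ≥0)
    (B : Set (OnePoint E)), MeasurableSet B →
    ∀ A : Set Ω, MeasurableSet[hτ.measurableSpace] A →
      P x {ω | ω ∈ A ∧ τ ω ≠ ⊤ ∧ X ((τ ω).untopD 0 + s) ω ∈ B} =
        ∫⁻ ω in {ω | ω ∈ A ∧ τ ω ≠ ⊤}, P (X ((τ ω).untopD 0) ω) {ω' | X s ω' ∈ B} ∂(P x)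
  /-- quasi-left-continuity: if stopping times `σ_n` increase to `τ` then `X_{σ_n} → X_τ` almost
  surely on `{τ < ∞}` -/
  quasi_left_continuous : ∀ (σ : ℕ → Ω → WithTop ℝ≥0) (τ : Ω → WithTop ℝ≥0),
    (∀ n, IsStoppingTime 𝓕 (σ n)) → (∀ ω, Monotone fun n => σ n ω) →
    (∀ ω, IsLUB (Set.range fun n => σ n ω) (τ ω)) →
    ∀ x, ∀ᵐ ω ∂(P x), τ ω ≠ ⊤ →
      Tendsto (fun n => X ((σ n ω).untopD 0) ω) atTop (𝓝 (X ((τ ω).untopD 0) ω))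

namespace HuntProcess

variable {E Ω : Type*} [TopologicalSpace E] [MeasurableSpace Ω]

/-- The life time `ζ(ω) = inf {t ≥ 0 : X_t(ω) = ∞}`. -/
def lifetime (H : HuntProcess E Ω) (ω : Ω) : ℝ≥0∞ :=
  ⨅ (t : ℝ≥0) (_ : H.X t ω = OnePoint.infty), (t : ℝ≥0∞)

variable [MeasurableSpace E]

/-- The transition probability `p_t(x, dy)`, a sub-probability measure on `E`:
`p_t(x, B) = P_x(X_t ∈ B)` for Borel `B ⊆ E`. -/
def transition (H : HuntProcess E Ω) (t : ℝ≥0) (x : E) : Measure E :=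
  ((H.P (x : OnePoint E)).map (H.X t)).comap ((↑) : E → OnePoint E)

/-- `m`-symmetry: `∫ f (P_t g) dm = ∫ (P_t f) g dm` for all nonnegative Borel functions. -/
def IsSymmetric (H : HuntProcess E Ω) (m : Measure E) : Prop :=
  ∀ (t : ℝ≥0) (f g : E → ℝ≥0∞), Measurable f → Measurable g →
    ∫⁻ x, f x * (∫⁻ y, g y ∂(H.transition t x)) ∂m =
      ∫⁻ x, (∫⁻ y, f y ∂(H.transition t x)) * g x ∂m

/-- `p` is a (jointly measurable) transition density of the process with respect to `m`:
`p_t(x, dy) = p_t(x, y) m(dy)` for all `t > 0` and all `x`. -/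
structure IsTransitionDensity (H : HuntProcess E Ω) (m : Measure E)
    (p : ℝ → E → E → ℝ≥0∞) : Prop where
  measurable : Measurable fun z : ℝ × E × E => p z.1 z.2.1 z.2.2
  eq_withDensity : ∀ t : ℝ, 0 < t → ∀ x, H.transition t.toNNReal x = m.withDensity (p t x)

end HuntProcess

/-- The 1-order Green function `R_1(x, y) = ∫_0^∞ e^{-t} p_t(x, y) dt`. -/
def green {E : Type*} (p : ℝ → E → E → ℝ≥0∞) (x y : E) : ℝ≥0∞ :=
  ∫⁻ t in Set.Ioi (0 : ℝ), ENNReal.ofReal (Real.exp (-t)) * p t x y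

/-! ### Approximated intersection measures -/

section Intersection

variable {n : ℕ} {E : Type*} {Ω' : Fin n → Type*} {Ω : Type*} [TopologicalSpace E] [∀ i, MeasurableSpace (Ω' i)]

/-- The approximated intersection measure up to time `t`, for the paths
`s ↦ X⁽ⁱ⁾_s = (H i).X s (Y i ω)`:
`ℓ_{ε,t}(A) = ∫_A [∫_{[0,t]^n} ∏ᵢ pⁱ_ε(X⁽ⁱ⁾(sᵢ), x) ds₁ ⋯ dsₙ] m(dx)`.
The density is extended by `p_ε(∞, x) = 0`; on the event that all processes are alive at time `t`
this value is never used. -/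
def approxIntersection [MeasurableSpace E] (H : ∀ i, HuntProcess E (Ω' i)) (Y : ∀ i, Ω → Ω' i) (m : Measure E)
    (p : Fin n → ℝ → E → E → ℝ≥0∞) (ε t : ℝ) (ω : Ω) : Measure E :=
  m.withDensity fun x =>
    ∫⁻ s in Set.univ.pi fun _ : Fin n => Set.Icc (0 : ℝ) t,
      ∏ i, ((H i).X (s i).toNNReal (Y i ω)).elim 0 fun z => p i ε z x

/-- The event `{t < ζ⁽¹⁾ ∧ ⋯ ∧ ζ⁽ⁿ⁾}` that all processes are alive at time `t`. -/
def aliveEvent (H : ∀ i, HuntProcess E (Ω' i)) (Y : ∀ i, Ω → Ω' i) (t : ℝ) : Set Ω :=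
  {ω | ∀ i, ENNReal.ofReal t < (H i).lifetime (Y i ω)}

/-- The normalised law `P̃_t = P( · | t < ζ⁽¹⁾ ∧ ⋯ ∧ ζ⁽ⁿ⁾)`. -/
def aliveLaw [MeasurableSpace Ω] (H : ∀ i, HuntProcess E (Ω' i)) (Y : ∀ i, Ω → Ω' i)
    (μ : Measure Ω) (t : ℝ) : Measure Ω :=
  ProbabilityTheory.cond μ (aliveEvent H Y t)

end Intersection

end

/-!
The event that all processes are alive at time `t` has positive probability: otherwise, for one of
the processes, some set of positive finite measure is not charged from itself at some positive time,
and by symmetry not at half that time, a quarter of it, and so on, against the strong continuity of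
the semigroup (`HuntProcess.P_alive_pos`).  The conditional law is then dominated by a multiple of
`μ`, so that all estimates may be made under `μ`.

For one process and `k` time points, the measure
`φ ↦ 𝔼 ∫_{[0,t]^k} φ(X_{s₁}, …, X_{s_k}) ds` on `E^k` has a density in `L^n(m^k)`.  This is proved by
induction on `k`: removing the latest time and applying the Markov property there costs one Green
function, which is bounded in `L^n` uniformly in its first variable
(`HuntProcess.exists_occupation_density`).  Replacing `k` occupation times by mollified ones at the
points `x₁, …, x_k` amounts to applying to this density the kernel `∏ⱼ p_{εⱼ}(zⱼ, xⱼ)`.  By symmetry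
this kernel is substochastic in both variables, hence a contraction of `L^n(m^k)`; by right continuity
of the paths it is an approximate identity
(`IsApproxIdentity.tendsto_lintegral_absDiff_smoothing`).  Since the `n` processes are independent,
the `k`-th moments of `⟨F, ℓ_ε⟩` are integrals of products of `n` such smoothed densities, and
Hölder's inequality bounds them uniformly in `ε` (`exists_moment_bound`).  For `k = 2` it also shows
that `𝔼 ⟨F, ℓ_ε⟩ ⟨F, ℓ_δ⟩` converges as `ε, δ ↓ 0`, so that `⟨F, ℓ_ε⟩` is Cauchy in `L²`, and by the
moment bounds in every `L^k` (`tendsto_lintegral_absDiff_approxIntersection`).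

Finally, countably many test functions determine vague convergence
(`FinMeas.exists_isDominatingFamily`).  Along a sequence `ε_i ↓ 0` the integrals of all of them
converge almost surely, the masses do not tend to infinity by Fatou's lemma, and the
Riesz–Markov–Kakutani theorem yields a finite random measure as almost sure vague limit
(`IsMomentCauchy.exists_ae_tendsto`).  It is the limit in `L^k` of the whole family, and the limit in
distribution because every sequence has a further subsequence that converges vaguely almost surely
to it.
-/

/-! ### The absolute difference of extended nonnegative numbers -/

/-- The absolute difference `|a - b|` of two extended nonnegative numbers, as a sum of two
truncated differences.  It takes the value `0` at `a = b = ∞`. -/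
noncomputable def absDiff (a b : ℝ≥0∞) : ℝ≥0∞ := (a - b) + (b - a)

lemma absDiff_comm (a b : ℝ≥0∞) : absDiff a b = absDiff b a := add_comm _ _

lemma absDiff_triangle (a b c : ℝ≥0∞) : absDiff a c ≤ absDiff a b + absDiff b c := by
  unfold absDiff
  calc (a - c) + (c - a) ≤ ((a - b) + (b - c)) + ((c - b) + (b - a)) := by
        gcongr <;> exact tsub_le_tsub_add_tsub
    _ = _ := by ring

lemma le_add_absDiff (a b : ℝ≥0∞) : a ≤ b + absDiff a b :=
  (tsub_le_iff_left.1 le_rfl).trans (by unfold absDiff; gcongr; exact le_self_add)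

lemma absDiff_le_max (a b : ℝ≥0∞) : absDiff a b ≤ max a b := by
  unfold absDiff
  rcases le_total a b with h | h
  · simp [tsub_eq_zero_of_le h]
  · simp [tsub_eq_zero_of_le h]

lemma absDiff_le_add (a b : ℝ≥0∞) : absDiff a b ≤ a + b :=
  add_le_add tsub_le_self tsub_le_self

@[fun_prop]
lemma Measurable.absDiff {α : Type*} [MeasurableSpace α] {f g : α → ℝ≥0∞} (hf : Measurable f)
    (hg : Measurable g) : Measurable fun x => absDiff (f x) (g x) :=
  (hf.sub hg).add (hg.sub hf)

lemma ENNReal.mul_tsub_mul_le (a a' b b' : ℝ≥0∞) :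
    a * b - a' * b' ≤ a' * (b - b') + (a - a') * b := by
  rw [tsub_le_iff_left]
  calc a * b ≤ (a' + (a - a')) * b := by gcongr; exact le_add_tsub
    _ = a' * b + (a - a') * b := by ring
    _ ≤ a' * (b' + (b - b')) + (a - a') * b := by gcongr; exact le_add_tsub
    _ = _ := by ring

lemma absDiff_mul_le (a a' b b' : ℝ≥0∞) :
    absDiff (a * b) (a' * b') ≤ (a + a') * absDiff b b' + absDiff a a' * max b b' := by
  have h1 := ENNReal.mul_tsub_mul_le a a' b b'
  have h2 := ENNReal.mul_tsub_mul_le a' a b' b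
  calc absDiff (a * b) (a' * b')
      ≤ (a' * (b - b') + (a - a') * b) + (a * (b' - b) + (a' - a) * b') := add_le_add h1 h2
    _ ≤ ((a + a') * (b - b') + (a - a') * max b b') +
        ((a + a') * (b' - b) + (a' - a) * max b b') := by
        gcongr
        · exact le_add_self
        · exact le_max_left _ _
        · exact le_self_add
        · exact le_max_right _ _
    _ = _ := by unfold absDiff; ring

lemma absDiff_mul_left_le (c a b : ℝ≥0∞) : absDiff (c * a) (c * b) ≤ c * absDiff a b := by
  unfold absDiff
  rw [mul_add]
  refine add_le_add ?_ ?_ <;>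
  · rw [tsub_le_iff_left, ← mul_add]
    gcongr
    exact le_add_tsub

/-- Telescoping bound for the difference of two finite products. -/
lemma absDiff_prod_le {ι : Type*} [DecidableEq ι] (s : Finset ι) (a b : ι → ℝ≥0∞) :
    absDiff (∏ i ∈ s, a i) (∏ i ∈ s, b i) ≤
      ∑ i ∈ s, absDiff (a i) (b i) * ∏ j ∈ s.erase i, (a j + b j) := by
  induction s using Finset.induction_on with
  | empty => simp [absDiff]
  | insert i s hi ih =>
    rw [Finset.prod_insert hi, Finset.prod_insert hi, Finset.sum_insert hi,
      Finset.erase_insert hi]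
    refine (absDiff_mul_le _ _ _ _).trans ?_
    rw [add_comm]
    refine add_le_add ?_ ?_
    · gcongr
      exact max_le (Finset.prod_le_prod' fun j _ => le_self_add)
        (Finset.prod_le_prod' fun j _ => le_add_self)
    · refine (mul_le_mul_right ih _).trans (le_of_eq ?_)
      rw [Finset.mul_sum]
      refine Finset.sum_congr rfl fun j hj => ?_
      have hij : j ≠ i := fun h => hi (h ▸ hj)
      rw [Finset.erase_insert_of_ne hij.symm, Finset.prod_insert
        (fun h => hi (Finset.mem_of_mem_erase h))]
      ring

lemma absDiff_sq_add {a b : ℝ≥0∞} (ha : a ≠ ∞) (hb : b ≠ ∞) :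
    absDiff a b ^ 2 + 2 * (a * b) = a ^ 2 + b ^ 2 := by
  wlog h : a ≤ b generalizing a b
  · rw [absDiff_comm, mul_comm a b, add_comm (a ^ 2)]
    exact this hb ha (le_of_not_ge h)
  obtain ⟨c, rfl⟩ := exists_add_of_le h
  have : absDiff a (a + c) = c := by
    rw [absDiff, tsub_eq_zero_of_le h, zero_add, ENNReal.add_sub_cancel_left ha]
  rw [this]; ring

lemma absDiff_eq_ofReal_abs {a b : ℝ≥0∞} (ha : a ≠ ∞) (hb : b ≠ ∞) :
    absDiff a b = ENNReal.ofReal |a.toReal - b.toReal| := by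
  wlog h : a ≤ b generalizing a b
  · rw [absDiff_comm, abs_sub_comm]
    exact this hb ha (le_of_not_ge h)
  rw [abs_sub_comm, abs_of_nonneg (sub_nonneg.2 (ENNReal.toReal_mono hb h)),
    ← ENNReal.toReal_sub_of_le h hb, ENNReal.ofReal_toReal (ENNReal.sub_ne_top hb)]
  simp [absDiff, tsub_eq_zero_of_le h]

lemma tendsto_of_absDiff_tendsto_zero {ι : Type*} {l : Filter ι} {a : ι → ℝ≥0∞} {b : ℝ≥0∞}
    (hb : b ≠ ∞) (h : Tendsto (fun i => absDiff (a i) b) l (𝓝 0)) : Tendsto a l (𝓝 b) := by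
  rw [ENNReal.tendsto_nhds hb]
  intro ε hε
  filter_upwards [h.eventually_le_const hε] with i hi
  constructor
  · rw [tsub_le_iff_right]
    calc b ≤ a i + absDiff b (a i) := le_add_absDiff _ _
      _ ≤ a i + ε := by rw [absDiff_comm]; gcongr
  · exact (le_add_absDiff _ _).trans (by gcongr)

lemma tendsto_absDiff_of_tendsto {ι : Type*} {l : Filter ι} {a : ι → ℝ≥0∞} {b c : ℝ≥0∞}
    (hb : b ≠ ∞) (h : Tendsto a l (𝓝 b)) :
    Tendsto (fun i => absDiff c (a i)) l (𝓝 (absDiff c b)) :=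
  (ENNReal.Tendsto.sub tendsto_const_nhds h (Or.inr hb)).add
    (ENNReal.Tendsto.sub h tendsto_const_nhds (Or.inl hb))

section Integrals

variable {α : Type*} [MeasurableSpace α] {μ : Measure α}

lemma absDiff_lintegral_le {f g : α → ℝ≥0∞} (hf : Measurable f) (hg : Measurable g) :
    absDiff (∫⁻ x, f x ∂μ) (∫⁻ x, g x ∂μ) ≤ ∫⁻ x, absDiff (f x) (g x) ∂μ := by
  unfold absDiff
  rw [lintegral_add_left (f := fun x => f x - g x) (hf.sub hg)]
  exact add_le_add (lintegral_sub_le _ _ hg) (lintegral_sub_le _ _ hf)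

lemma ENNReal.add_pow_le_two_pow_mul (a b : ℝ≥0∞) (n : ℕ) :
    (a + b) ^ n ≤ 2 ^ n * (a ^ n + b ^ n) := by
  have h : a + b ≤ 2 * max a b := by
    rw [two_mul]; exact add_le_add (le_max_left _ _) (le_max_right _ _)
  calc (a + b) ^ n ≤ (2 * max a b) ^ n := by gcongr
    _ = 2 ^ n * (max a b) ^ n := mul_pow _ _ _
    _ ≤ _ := by
      gcongr
      rcases le_total a b with h | h
      · rw [max_eq_right h]; exact le_add_self
      · rw [max_eq_left h]; exact le_self_add

lemma lintegral_add_pow_le {f g : α → ℝ≥0∞} (hf : Measurable f) (n : ℕ) :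
    ∫⁻ x, (f x + g x) ^ n ∂μ ≤ 2 ^ n * (∫⁻ x, f x ^ n ∂μ + ∫⁻ x, g x ^ n ∂μ) := by
  rw [← lintegral_add_left (hf.pow_const n), ← lintegral_const_mul' _ _ (by finiteness)]
  exact lintegral_mono fun x => ENNReal.add_pow_le_two_pow_mul _ _ _

/-- Jensen's inequality for a subprobability density. -/
lemma pow_lintegral_mul_le {q g : α → ℝ≥0∞} (hq : Measurable q) (hg : Measurable g)
    (h1 : ∫⁻ x, q x ∂μ ≤ 1) {n : ℕ} (hn : 2 ≤ n) :
    (∫⁻ x, q x * g x ∂μ) ^ n ≤ ∫⁻ x, q x * g x ^ n ∂μ := by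
  have hn1 : (1 : ℝ) < n := by exact_mod_cast hn
  have hc := Real.HolderConjugate.conjExponent hn1
  set ρ := μ.withDensity q
  have e1 : ∫⁻ x, q x * g x ∂μ = ∫⁻ x, g x ∂ρ :=
    (lintegral_withDensity_eq_lintegral_mul _ hq hg).symm
  have e2 : ∫⁻ x, q x * g x ^ n ∂μ = ∫⁻ x, g x ^ n ∂ρ :=
    (lintegral_withDensity_eq_lintegral_mul _ hq (hg.pow_const n)).symm
  have hρ : ρ Set.univ ≤ 1 := by simpa [ρ, withDensity_apply] using h1
  have key := ENNReal.lintegral_mul_le_Lp_mul_Lq ρ hc hg.aemeasurable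
    (measurable_const (a := (1 : ℝ≥0∞))).aemeasurable
  rw [e1, e2]
  have : ∫⁻ x, g x ∂ρ ≤ (∫⁻ x, g x ^ n ∂ρ) ^ (1 / (n : ℝ)) := by
    calc ∫⁻ x, g x ∂ρ = ∫⁻ x, ((g * fun _ => 1 : α → ℝ≥0∞)) x ∂ρ := by simp
      _ ≤ _ := key
      _ ≤ (∫⁻ x, g x ^ n ∂ρ) ^ (1 / (n : ℝ)) * 1 := by
        gcongr
        · simp
        · refine ENNReal.rpow_le_one (by simpa using hρ) ?_
          exact one_div_nonneg.2 hc.symm.nonneg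
      _ = _ := mul_one _
  calc (∫⁻ x, g x ∂ρ) ^ n ≤ ((∫⁻ x, g x ^ n ∂ρ) ^ (1 / (n : ℝ))) ^ n := by gcongr
    _ = _ := by
      rw [← ENNReal.rpow_natCast, ← ENNReal.rpow_mul, one_div_mul_cancel (by positivity),
        ENNReal.rpow_one]

end Integrals

/-! ### Smoothing by doubly substochastic kernels -/

section Smoothing

variable {Z : Type*} [MeasurableSpace Z] {ν : Measure Z}

/-- The function `x ↦ ∫ q(z, x) g(z) ν(dz)`: the density of the image of the measure `g ν` under
the kernel with density `q`. -/
noncomputable def smoothing (ν : Measure Z) (q : Z → Z → ℝ≥0∞) (g : Z → ℝ≥0∞) (x : Z) : ℝ≥0∞ :=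
  ∫⁻ z, q z x * g z ∂ν

/-- A kernel density on `Z` with respect to `ν` that is substochastic in both variables. -/
structure IsDoublySubstochastic (ν : Measure Z) (q : Z → Z → ℝ≥0∞) : Prop where
  measurable : Measurable fun w : Z × Z => q w.1 w.2
  lintegral_right_le : ∀ z, ∫⁻ x, q z x ∂ν ≤ 1
  lintegral_left_le : ∀ᵐ x ∂ν, ∫⁻ z, q z x ∂ν ≤ 1

namespace IsDoublySubstochastic

variable {q : Z → Z → ℝ≥0∞} (hq : IsDoublySubstochastic ν q)
include hq

lemma measurable_left (x : Z) : Measurable fun z => q z x :=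
  hq.measurable.comp (measurable_id.prodMk measurable_const)

lemma measurable_right (z : Z) : Measurable fun x => q z x :=
  hq.measurable.comp (measurable_const.prodMk measurable_id)

lemma measurable_smoothing [SFinite ν] {g : Z → ℝ≥0∞} (hg : Measurable g) :
    Measurable (smoothing ν q g) := by
  exact Measurable.lintegral_prod_right
    ((hq.measurable.comp measurable_swap).mul (hg.comp measurable_snd))

/-- Smoothing is a contraction of `L^n`. -/
lemma lintegral_smoothing_pow_le [SFinite ν] {g : Z → ℝ≥0∞} (hg : Measurable g) {n : ℕ}
    (hn : 2 ≤ n) : ∫⁻ x, smoothing ν q g x ^ n ∂ν ≤ ∫⁻ x, g x ^ n ∂ν := by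
  calc ∫⁻ x, smoothing ν q g x ^ n ∂ν ≤ ∫⁻ x, ∫⁻ z, q z x * g z ^ n ∂ν ∂ν := by
        refine lintegral_mono_ae ?_
        filter_upwards [hq.lintegral_left_le] with x hx
        exact pow_lintegral_mul_le (hq.measurable_left x) hg hx hn
    _ = ∫⁻ z, ∫⁻ x, q z x * g z ^ n ∂ν ∂ν := by
        rw [lintegral_lintegral_swap]
        exact ((hq.measurable.comp measurable_swap).mul
          ((hg.comp measurable_snd).pow_const n)).aemeasurable
    _ = ∫⁻ z, (∫⁻ x, q z x ∂ν) * g z ^ n ∂ν := by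
        refine lintegral_congr fun z => ?_
        rw [lintegral_mul_const _ (hq.measurable_right z)]
    _ ≤ ∫⁻ z, 1 * g z ^ n ∂ν := by
        gcongr with z
        exact hq.lintegral_right_le z
    _ = _ := by simp

lemma smoothing_le_const {h : Z → ℝ≥0∞} {C : ℝ≥0∞} (hC : ∀ z, h z ≤ C) :
    ∀ᵐ x ∂ν, smoothing ν q h x ≤ C := by
  filter_upwards [hq.lintegral_left_le] with x hx
  calc ∫⁻ z, q z x * h z ∂ν ≤ ∫⁻ z, q z x * C ∂ν := by gcongr with z; exact hC z
    _ = (∫⁻ z, q z x ∂ν) * C := lintegral_mul_const _ (hq.measurable_left x)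
    _ ≤ 1 * C := by gcongr
    _ = C := one_mul _

lemma absDiff_smoothing_le {g h : Z → ℝ≥0∞} (hg : Measurable g) (hh : Measurable h) (x : Z) :
    absDiff (smoothing ν q g x) (smoothing ν q h x) ≤
      smoothing ν q (fun z => absDiff (g z) (h z)) x :=
  (absDiff_lintegral_le ((hq.measurable_left x).mul hg) ((hq.measurable_left x).mul hh)).trans
    (lintegral_mono fun _ => absDiff_mul_left_le _ _ _)

lemma lintegral_smoothing_mul [SFinite ν] {h : Z → ℝ≥0∞} (hh : Measurable h) :
    ∫⁻ x, smoothing ν q h x * h x ∂ν = ∫⁻ z, h z * ∫⁻ x, q z x * h x ∂ν ∂ν := by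
  have m1 : Measurable fun w : Z × Z => q w.2 w.1 * h w.2 * h w.1 :=
    ((hq.measurable.comp measurable_swap).mul (hh.comp measurable_snd)).mul
      (hh.comp measurable_fst)
  calc ∫⁻ x, smoothing ν q h x * h x ∂ν = ∫⁻ x, ∫⁻ z, q z x * h z * h x ∂ν ∂ν := by
        refine lintegral_congr fun x => ?_
        rw [smoothing, lintegral_mul_const _ ((hq.measurable_left x).fun_mul hh)]
    _ = ∫⁻ z, ∫⁻ x, q z x * h z * h x ∂ν ∂ν := lintegral_lintegral_swap m1.aemeasurable
    _ = _ := by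
        refine lintegral_congr fun z => ?_
        rw [← lintegral_const_mul _ ((hq.measurable_right z).fun_mul hh)]
        exact lintegral_congr fun x => by ring

end IsDoublySubstochastic

variable [TopologicalSpace Z] [BorelSpace Z]

/-- A family of doubly substochastic kernels that concentrates at the starting point along the
filter `l`. -/
structure IsApproxIdentity {ι : Type*} (ν : Measure Z) (q : ι → Z → Z → ℝ≥0∞)
    (l : Filter ι) : Prop where
  doublySubstochastic : ∀ᶠ i in l, IsDoublySubstochastic ν (q i)
  tendsto_one : ∀ z, ∀ U : Set Z, IsOpen U → z ∈ U →
    Tendsto (fun i => ∫⁻ x in U, q i z x ∂ν) l (𝓝 1)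

namespace IsApproxIdentity

variable {ι : Type*} {l : Filter ι} {q : ι → Z → Z → ℝ≥0∞} (hq : IsApproxIdentity ν q l)
include hq

omit [BorelSpace Z] in
lemma comp {κ : Type*} {l' : Filter κ} {u : κ → ι} (hu : Tendsto u l' l) :
    IsApproxIdentity ν (fun a => q (u a)) l' where
  doublySubstochastic := hu.eventually hq.doublySubstochastic
  tendsto_one z U hU hz := (hq.tendsto_one z U hU hz).comp hu

lemma tendsto_lintegral {h : Z → ℝ≥0∞} (hh : Continuous h) {C : ℝ≥0∞} (hC : C ≠ ∞)
    (hhC : ∀ z, h z ≤ C) (z : Z) :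
    Tendsto (fun i => ∫⁻ x, q i z x * h x ∂ν) l (𝓝 (h z)) := by
  refine tendsto_order.2 ⟨fun a ha => ?_, fun b hb => ?_⟩
  · obtain ⟨a', haa', ha'⟩ := exists_between ha
    have hU : IsOpen {x | a' < h x} := isOpen_lt continuous_const hh
    have hlim : Tendsto (fun i => a' * ∫⁻ x in {x | a' < h x}, q i z x ∂ν) l (𝓝 (a' * 1)) :=
      ENNReal.Tendsto.const_mul (hq.tendsto_one z _ hU ha') (Or.inl one_ne_zero)
    rw [mul_one] at hlim
    filter_upwards [hlim.eventually_const_lt haa', hq.doublySubstochastic] with i hi hqi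
    refine hi.trans_le ?_
    rw [← lintegral_const_mul _ (hqi.measurable_right z)]
    refine (setLIntegral_mono' hU.measurableSet fun x hx => ?_).trans (setLIntegral_le_lintegral _ _)
    rw [mul_comm]
    gcongr
    exact le_of_lt hx
  · obtain ⟨b', hb', hbb'⟩ := exists_between hb
    have hU : IsOpen {x | h x < b'} := isOpen_lt hh continuous_const
    set U := {x | h x < b'}
    have hlim : Tendsto (fun i => b' + C * (1 - ∫⁻ x in U, q i z x ∂ν)) l
        (𝓝 (b' + C * (1 - 1))) := by
      refine tendsto_const_nhds.add (ENNReal.Tendsto.const_mul ?_ (Or.inr hC))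
      exact ENNReal.Tendsto.sub tendsto_const_nhds (hq.tendsto_one z _ hU hb') (Or.inl (by simp))
    simp only [tsub_self, mul_zero, add_zero] at hlim
    filter_upwards [hlim.eventually_lt_const hbb', hq.doublySubstochastic] with i hi hqi
    refine lt_of_le_of_lt ?_ hi
    have hsplit := lintegral_add_compl (μ := ν) (fun x => q i z x) hU.measurableSet
    have h1 := hqi.lintegral_right_le z
    have hUle : ∫⁻ x in U, q i z x ∂ν ≤ 1 := (setLIntegral_le_lintegral _ _).trans h1
    rw [← lintegral_add_compl _ hU.measurableSet]
    refine add_le_add ?_ ?_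
    · calc ∫⁻ x in U, q i z x * h x ∂ν ≤ ∫⁻ x in U, q i z x * b' ∂ν := by
            refine setLIntegral_mono' hU.measurableSet fun x hx => ?_
            gcongr
            exact le_of_lt hx
        _ = (∫⁻ x in U, q i z x ∂ν) * b' := lintegral_mul_const _ (hqi.measurable_right z)
        _ ≤ 1 * b' := by gcongr
        _ = b' := one_mul _
    · calc ∫⁻ x in Uᶜ, q i z x * h x ∂ν ≤ ∫⁻ x in Uᶜ, q i z x * C ∂ν := by
            gcongr with x
            exact hhC x
        _ = (∫⁻ x in Uᶜ, q i z x ∂ν) * C := lintegral_mul_const _ (hqi.measurable_right z)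
        _ ≤ (1 - ∫⁻ x in U, q i z x ∂ν) * C := by
            gcongr
            refine ENNReal.le_sub_of_add_le_left (hUle.trans_lt ENNReal.one_lt_top).ne ?_
            rw [hsplit]; exact h1
        _ = _ := mul_comm _ _

/-- `L^n`-convergence of the smoothings of a bounded continuous integrable function.  For `n = 2`
it follows from the contraction property by expanding the square, and for `n > 2` by
interpolation with the uniform bound. -/
lemma tendsto_lintegral_absDiff_of_continuous [SFinite ν] [l.IsCountablyGenerated]
    {h : Z → ℝ≥0∞} (hh : Continuous h) {C : ℝ≥0∞} (hC : C ≠ ∞) (hhC : ∀ z, h z ≤ C)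
    (hint : ∫⁻ z, h z ∂ν ≠ ∞) {n : ℕ} (hn : 2 ≤ n) :
    Tendsto (fun i => ∫⁻ x, absDiff (smoothing ν (q i) h x) (h x) ^ n ∂ν) l (𝓝 0) := by
  have hhm : Measurable h := hh.measurable
  have hfin : ∀ g : Z → ℝ≥0∞, (∀ z, g z ≤ C) → ∫⁻ z, h z * g z ∂ν ≠ ∞ := fun g hg => by
    refine ne_top_of_le_ne_top (ENNReal.mul_ne_top hint hC) ?_
    rw [← lintegral_mul_const _ hhm]
    gcongr with z
    exact hg z
  have hsq : ∫⁻ z, h z ^ 2 ∂ν ≠ ∞ := by simpa only [sq] using hfin h hhC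
  have hlim : Tendsto (fun i => ∫⁻ z, h z * ∫⁻ x, q i z x * h x ∂ν ∂ν) l
      (𝓝 (∫⁻ z, h z ^ 2 ∂ν)) := by
    simp only [sq]
    refine tendsto_lintegral_filter_of_dominated_convergence (fun z => h z * C) ?_ ?_
      (hfin _ fun _ => le_rfl) ?_
    · filter_upwards [hq.doublySubstochastic] with i hqi
      exact hhm.mul (Measurable.lintegral_prod_right
        (hqi.measurable.mul (hhm.comp measurable_snd)))
    · filter_upwards [hq.doublySubstochastic] with i hqi
      refine Eventually.of_forall fun z => ?_
      gcongr
      calc ∫⁻ x, q i z x * h x ∂ν ≤ ∫⁻ x, q i z x * C ∂ν := by gcongr with x; exact hhC x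
        _ = (∫⁻ x, q i z x ∂ν) * C := lintegral_mul_const _ (hqi.measurable_right z)
        _ ≤ 1 * C := by gcongr; exact hqi.lintegral_right_le z
        _ = C := one_mul _
    · refine Eventually.of_forall fun z => ?_
      refine ENNReal.Tendsto.const_mul (hq.tendsto_lintegral hh hC hhC z) (Or.inr ?_)
      exact ne_top_of_le_ne_top hC (hhC z)
  -- `∫ |Tᵢh - h|² ≤ 2 ∫ h² - 2 ∫ h Tᵢh`, as the smoothing `Tᵢ` is a contraction of `L²`
  have hlim2 : Tendsto (fun i => C ^ (n - 2) * (2 * ∫⁻ z, h z ^ 2 ∂ν -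
      2 * ∫⁻ z, h z * ∫⁻ x, q i z x * h x ∂ν ∂ν)) l (𝓝 0) := by
    have := ENNReal.Tendsto.const_mul (a := C ^ (n - 2)) (ENNReal.Tendsto.sub
      (tendsto_const_nhds (x := 2 * ∫⁻ z, h z ^ 2 ∂ν))
      (ENNReal.Tendsto.const_mul (a := 2) hlim (Or.inr (by simp)))
      (Or.inl (ENNReal.mul_ne_top (by simp) hsq))) (Or.inr (ENNReal.pow_ne_top hC))
    simpa using this
  refine tendsto_of_tendsto_of_tendsto_of_le_of_le' tendsto_const_nhds hlim2
    (Eventually.of_forall fun _ => zero_le) ?_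
  filter_upwards [hq.doublySubstochastic] with i hqi
  have hT := hqi.smoothing_le_const hhC
  have mT := hqi.measurable_smoothing hhm
  have hd2 : ∫⁻ x, absDiff (smoothing ν (q i) h x) (h x) ^ 2 ∂ν ≤
      2 * ∫⁻ z, h z ^ 2 ∂ν - 2 * ∫⁻ z, h z * ∫⁻ x, q i z x * h x ∂ν ∂ν := by
    rw [← hqi.lintegral_smoothing_mul hhm]
    refine ENNReal.le_sub_of_add_le_right ?_ ?_
    · refine ENNReal.mul_ne_top (by simp) (ne_top_of_le_ne_top (hfin (fun _ => C) fun _ => le_rfl) ?_)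
      refine lintegral_mono_ae ?_
      filter_upwards [hT] with x hx
      rw [mul_comm]
      gcongr
    · rw [← lintegral_const_mul _ (mT.fun_mul hhm),
        ← lintegral_add_left ((mT.absDiff hhm).pow_const 2)]
      calc ∫⁻ x, (absDiff (smoothing ν (q i) h x) (h x) ^ 2 +
              2 * (smoothing ν (q i) h x * h x)) ∂ν
          = ∫⁻ x, (smoothing ν (q i) h x ^ 2 + h x ^ 2) ∂ν := by
            refine lintegral_congr_ae ?_
            filter_upwards [hT] with x hx
            exact absDiff_sq_add (ne_top_of_le_ne_top hC hx) (ne_top_of_le_ne_top hC (hhC x))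
        _ = ∫⁻ x, smoothing ν (q i) h x ^ 2 ∂ν + ∫⁻ x, h x ^ 2 ∂ν :=
            lintegral_add_left (mT.pow_const 2) _
        _ ≤ ∫⁻ x, h x ^ 2 ∂ν + ∫⁻ x, h x ^ 2 ∂ν := by
            gcongr ?_ + _
            exact hqi.lintegral_smoothing_pow_le hhm le_rfl
        _ = _ := (two_mul _).symm
  calc ∫⁻ x, absDiff (smoothing ν (q i) h x) (h x) ^ n ∂ν
      ≤ ∫⁻ x, C ^ (n - 2) * absDiff (smoothing ν (q i) h x) (h x) ^ 2 ∂ν := by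
        refine lintegral_mono_ae ?_
        filter_upwards [hT] with x hx
        rw [← Nat.sub_add_cancel hn, pow_add, Nat.add_sub_cancel]
        gcongr
        exact (absDiff_le_max _ _).trans (max_le hx (hhC x))
    _ = C ^ (n - 2) * ∫⁻ x, absDiff (smoothing ν (q i) h x) (h x) ^ 2 ∂ν :=
        lintegral_const_mul' _ _ (ENNReal.pow_ne_top hC)
    _ ≤ _ := by gcongr

omit hq in
lemma exists_continuous_lintegral_absDiff_le [R1Space Z] [NormalSpace Z] [WeaklyLocallyCompactSpace Z]
    [ν.Regular] {g : Z → ℝ≥0∞} (hg : Measurable g) {n : ℕ} (hn : 2 ≤ n)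
    (hint : ∫⁻ z, g z ^ n ∂ν ≠ ∞) {δ : ℝ≥0∞} (hδ : δ ≠ 0) :
    ∃ h : Z → ℝ≥0∞, Continuous h ∧ (∃ C : ℝ≥0∞, C ≠ ∞ ∧ ∀ z, h z ≤ C) ∧
      ∫⁻ z, h z ∂ν ≠ ∞ ∧ ∫⁻ z, absDiff (g z) (h z) ^ n ∂ν ≤ δ := by
  have hn0 : n ≠ 0 := by omega
  have hnn : (n : ℝ≥0∞) ≠ 0 := by exact_mod_cast hn0
  have hgfin : ∀ᵐ z ∂ν, g z ≠ ∞ := by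
    filter_upwards [ae_lt_top (hg.pow_const n) hint] with z hz h
    simp [h, hn0] at hz
  have hmem : MemLp (fun z => (g z).toReal) n ν := by
    refine ⟨hg.ennreal_toReal.aestronglyMeasurable, ?_⟩
    rw [eLpNorm_lt_top_iff_lintegral_rpow_enorm_lt_top hnn (by simp)]
    refine lt_of_le_of_lt (lintegral_mono fun z => ?_) (lt_top_iff_ne_top.2 hint)
    simp only [ENNReal.toReal_natCast, ENNReal.rpow_natCast]
    gcongr
    rw [Real.enorm_of_nonneg ENNReal.toReal_nonneg]
    exact ENNReal.ofReal_toReal_le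
  have hδ' : δ ^ (1 / (n : ℝ)) ≠ 0 := by
    simp [hδ]
  obtain ⟨h0, hs, hle, hc, -⟩ := hmem.exists_hasCompactSupport_eLpNorm_sub_le (by simp) hδ'
  obtain ⟨B, hB⟩ := hc.bounded_above_of_compact_support hs
  refine ⟨fun z => ENNReal.ofReal (h0 z), ENNReal.continuous_ofReal.comp hc,
    ⟨ENNReal.ofReal B, by simp, fun z => ENNReal.ofReal_le_ofReal
      ((Real.le_norm_self _).trans (hB z))⟩, ?_, ?_⟩
  · have := (hc.integrable_of_hasCompactSupport hs (μ := ν)).lintegral_lt_top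
    exact this.ne
  · rw [eLpNorm_eq_lintegral_rpow_enorm_toReal hnn (by simp)] at hle
    simp only [ENNReal.toReal_natCast, ENNReal.rpow_natCast] at hle
    have hle' := (ENNReal.rpow_le_rpow_iff (by positivity)).1 hle
    refine le_trans (lintegral_mono_ae ?_) hle'
    filter_upwards [hgfin] with z hz
    gcongr
    rw [absDiff_eq_ofReal_abs hz (by simp), Pi.sub_apply, Real.enorm_eq_ofReal_abs]
    refine ENNReal.ofReal_le_ofReal ?_
    rw [ENNReal.toReal_ofReal']
    have h1 := abs_max_sub_max_le_abs (g z).toReal (h0 z) 0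
    rwa [max_eq_left ENNReal.toReal_nonneg] at h1

/-- The smoothings of a function in `L^n` converge to it in `L^n`. -/
theorem tendsto_lintegral_absDiff_smoothing [R1Space Z] [NormalSpace Z] [WeaklyLocallyCompactSpace Z]
    [ν.Regular] [SFinite ν] [l.IsCountablyGenerated] {g : Z → ℝ≥0∞} (hg : Measurable g)
    {n : ℕ} (hn : 2 ≤ n) (hint : ∫⁻ z, g z ^ n ∂ν ≠ ∞) :
    Tendsto (fun i => ∫⁻ x, absDiff (smoothing ν (q i) g x) (g x) ^ n ∂ν) l (𝓝 0) := by
  refine ENNReal.tendsto_nhds_zero.2 fun η hη => ?_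
  -- the constant arising from two uses of `(a + b)^n ≤ 2^n (a^n + b^n)` below
  set K : ℝ≥0∞ := 2 ^ n * (1 + 2 ^ n * (1 + 1))
  have hK : K ≠ ∞ := by finiteness
  have hδ : η / K ≠ 0 := by simp [ENNReal.div_eq_zero_iff, hη.ne', hK]
  obtain ⟨h, hc, ⟨C, hC, hhC⟩, hhint, hle⟩ :=
    exists_continuous_lintegral_absDiff_le hg hn hint hδ
  set δ := η / K
  have hh := hc.measurable
  filter_upwards [hq.doublySubstochastic, (hq.tendsto_lintegral_absDiff_of_continuous hc hC hhC
    hhint hn).eventually_le_const (pos_iff_ne_zero.2 hδ)] with i hqi hi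
  have mg := hqi.measurable_smoothing hg
  have mh := hqi.measurable_smoothing hh
  have md := hqi.measurable_smoothing (hg.absDiff hh)
  calc ∫⁻ x, absDiff (smoothing ν (q i) g x) (g x) ^ n ∂ν
      ≤ ∫⁻ x, (smoothing ν (q i) (fun z => absDiff (g z) (h z)) x +
          (absDiff (smoothing ν (q i) h x) (h x) + absDiff (g x) (h x))) ^ n ∂ν := by
        gcongr with x
        refine (absDiff_triangle _ (smoothing ν (q i) h x) _).trans ?_
        refine add_le_add (hqi.absDiff_smoothing_le hg hh x) ?_
        rw [absDiff_comm (g x)]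
        exact absDiff_triangle _ _ _
    _ ≤ 2 ^ n * (∫⁻ x, smoothing ν (q i) (fun z => absDiff (g z) (h z)) x ^ n ∂ν +
          2 ^ n * (∫⁻ x, absDiff (smoothing ν (q i) h x) (h x) ^ n ∂ν +
            ∫⁻ x, absDiff (g x) (h x) ^ n ∂ν)) := by
        refine (lintegral_add_pow_le md n).trans ?_
        gcongr
        exact lintegral_add_pow_le (mh.absDiff hh) n
    _ ≤ 2 ^ n * (δ + 2 ^ n * (δ + δ)) := by
        gcongr
        exact (hqi.lintegral_smoothing_pow_le (hg.absDiff hh) hn).trans hle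
    _ = K * δ := by ring
    _ ≤ η := ENNReal.mul_div_le

end IsApproxIdentity

end Smoothing

/-! ### Products over finitely many coordinates -/

section Products

lemma lintegral_pi_prod {k : ℕ} {α : Fin k → Type*} [∀ j, MeasurableSpace (α j)]
    (μ : ∀ j, Measure (α j)) [∀ j, SigmaFinite (μ j)] (f : ∀ j, α j → ℝ≥0∞)
    (hf : ∀ j, Measurable (f j)) :
    ∫⁻ x, ∏ j, f j (x j) ∂(Measure.pi μ) = ∏ j, ∫⁻ y, f j y ∂(μ j) := by
  induction k with
  | zero => simp
  | succ k ih =>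
    have hmp := (measurePreserving_piFinSuccAbove μ 0).symm
    rw [← hmp.lintegral_comp_emb (MeasurableEquiv.measurableEmbedding _),
      lintegral_prod _ (by
        refine Measurable.aemeasurable ?_
        refine Finset.measurable_fun_prod _ fun j _ => ?_
        exact (hf j).comp ((measurable_pi_apply j).comp (MeasurableEquiv.measurable _)))]
    have : ∀ (y : α 0) (z : ∀ j : Fin k, α (Fin.succAbove 0 j)),
        ∏ j, f j ((MeasurableEquiv.piFinSuccAbove α 0).symm (y, z) j) =
          f 0 y * ∏ j : Fin k, f (Fin.succ j) (z j) := by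
      intro y z
      rw [Fin.prod_univ_succ]
      rfl
    simp only [this]
    have ih' := ih (fun j => μ (Fin.succAbove 0 j)) (fun j => f (Fin.succAbove 0 j))
      fun j => hf _
    have hm : Measurable fun z : ∀ j : Fin k, α (Fin.succAbove 0 j) =>
        ∏ j : Fin k, f (Fin.succ j) (z j) :=
      Finset.measurable_fun_prod _ fun j _ => (hf _).comp (measurable_pi_apply j)
    simp only [lintegral_const_mul _ hm]
    rw [lintegral_mul_const _ (hf 0), Fin.prod_univ_succ]
    congr 1

/-- Splitting off the `j`-th coordinate in an integral over a product space. -/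
lemma lintegral_pi_insertNth {k : ℕ} {α : Type*} [MeasurableSpace α] (μ : Measure α)
    [SigmaFinite μ] (j : Fin (k + 1)) {f : (Fin (k + 1) → α) → ℝ≥0∞} (hf : Measurable f) :
    ∫⁻ w, f w ∂(Measure.pi fun _ => μ) =
      ∫⁻ z, ∫⁻ y, f (j.insertNth (α := fun _ => α) y z) ∂μ ∂(Measure.pi fun _ => μ) := by
  have hmp := (measurePreserving_piFinSuccAbove (fun _ : Fin (k + 1) => μ) j).symm
  rw [← hmp.lintegral_comp_emb (MeasurableEquiv.measurableEmbedding _),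
    lintegral_prod_symm (fun w => f ((MeasurableEquiv.piFinSuccAbove (fun _ => α) j).symm w))
      (hf.comp (MeasurableEquiv.measurable _)).aemeasurable]
  rfl

lemma measurable_insertNth {k : ℕ} {α : Type*} [MeasurableSpace α] (j : Fin (k + 1)) :
    Measurable fun w : α × (Fin k → α) => (j.insertNth (α := fun _ => α) w.1 w.2) :=
  (MeasurableEquiv.piFinSuccAbove (fun _ : Fin (k + 1) => α) j).symm.measurable

variable {k : ℕ} {E : Type*} [MeasurableSpace E] {m : Measure E} [SigmaFinite m]

/-- The tensor product `∏ⱼ qⱼ(zⱼ, xⱼ)` of kernel densities. -/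
noncomputable def piKernel (q : Fin k → E → E → ℝ≥0∞) (z x : Fin k → E) : ℝ≥0∞ := ∏ j, q j (z j) (x j)

lemma setLIntegral_piKernel {q : Fin k → E → E → ℝ≥0∞}
    (hq : ∀ j z, Measurable (q j z)) (z : Fin k → E) (V : Fin k → Set E) :
    ∫⁻ x in Set.univ.pi V, piKernel q z x ∂(Measure.pi fun _ => m) =
      ∏ j, ∫⁻ x in V j, q j (z j) x ∂m := by
  rw [Measure.restrict_pi_pi]
  exact lintegral_pi_prod _ (fun j => q j (z j)) fun j => hq j _

lemma isDoublySubstochastic_piKernel {q : Fin k → E → E → ℝ≥0∞}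
    (hq : ∀ j, IsDoublySubstochastic m (q j)) :
    IsDoublySubstochastic (Measure.pi fun _ : Fin k => m) (piKernel q) where
  measurable := by
    refine Finset.measurable_fun_prod _ fun j _ => ?_
    have h : Measurable fun w : (Fin k → E) × (Fin k → E) => (w.1 j, w.2 j) := by fun_prop
    exact (hq j).measurable.comp h
  lintegral_right_le z := by
    unfold piKernel
    rw [lintegral_pi_prod _ (fun j => q j (z j)) fun j => (hq j).measurable_right _]
    exact Finset.prod_le_one' fun j _ => (hq j).lintegral_right_le _
  lintegral_left_le := by
    have : ∀ᵐ x ∂(Measure.pi fun _ : Fin k => m), ∀ j, ∫⁻ z, q j z (x j) ∂m ≤ 1 := by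
      rw [ae_all_iff]
      intro j
      exact (Measure.tendsto_eval_ae_ae (μ := fun _ : Fin k => m)).eventually
        (hq j).lintegral_left_le
    filter_upwards [this] with x hx
    unfold piKernel
    rw [lintegral_pi_prod _ (fun j z => q j z (x j)) fun j => (hq j).measurable_left _]
    exact Finset.prod_le_one' fun j _ => hx j

lemma isApproxIdentity_piKernel [TopologicalSpace E] [SecondCountableTopology E] [BorelSpace E]
    {ι : Type*} {l : Filter ι} {q : ι → Fin k → E → E → ℝ≥0∞}
    (hq : ∀ j, IsApproxIdentity m (fun i => q i j) l) :
    IsApproxIdentity (Measure.pi fun _ : Fin k => m) (fun i => piKernel (q i)) l where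
  doublySubstochastic := by
    filter_upwards [eventually_all.2 fun j => (hq j).doublySubstochastic] with i hi
    exact isDoublySubstochastic_piKernel hi
  tendsto_one z U hU hz := by
    obtain ⟨V, hV, hVU⟩ := isOpen_pi_iff'.1 hU z hz
    have hlim : Tendsto (fun i => ∏ j, ∫⁻ x in V j, q i j (z j) x ∂m) l (𝓝 1) := by
      have := ENNReal.tendsto_finsetProd_of_ne_top Finset.univ (fun j _ =>
        (hq j).tendsto_one (z j) (V j) (hV j).1 (hV j).2) fun _ _ => ENNReal.one_ne_top
      simpa using this
    refine tendsto_of_tendsto_of_tendsto_of_le_of_le' hlim tendsto_const_nhds ?_ ?_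
    · filter_upwards [eventually_all.2 fun j => (hq j).doublySubstochastic] with i hi
      rw [← setLIntegral_piKernel fun j => (hi j).measurable_right]
      exact lintegral_mono_set hVU
    · filter_upwards [eventually_all.2 fun j => (hq j).doublySubstochastic] with i hi
      exact (setLIntegral_le_lintegral _ _).trans
        ((isDoublySubstochastic_piKernel hi).lintegral_right_le z)

end Products

/-! ### Measurability in the one-point compactification -/

section OnePointMeasurability

/-- A left inverse of the embedding of `E` in `E ∪ {∞}`; the value at `∞` is arbitrary. -/
noncomputable def onePointRetract {E : Type*} [Nonempty E] (z : OnePoint E) : E :=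
  z.elim (Classical.arbitrary E) id

@[simp]
lemma onePointRetract_coe {E : Type*} [Nonempty E] (z : E) :
    onePointRetract (z : OnePoint E) = z := rfl

lemma coe_onePointRetract {E : Type*} [Nonempty E] {z : OnePoint E} (hz : z ≠ OnePoint.infty) :
    ((onePointRetract z : E) : OnePoint E) = z := by
  induction z using OnePoint.rec with
  | infty => exact absurd rfl hz
  | coe z => rfl

open Classical in
lemma onePoint_elim_zero {E : Type*} [Nonempty E] (φ : E → ℝ≥0∞) (z : OnePoint E) :
    z.elim 0 φ = if z = OnePoint.infty then 0 else φ (onePointRetract z) := by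
  induction z using OnePoint.rec with
  | infty => simp
  | coe z => simp

variable {E : Type*} [TopologicalSpace E]

/-- The Borel σ-algebra of `E ∪ {∞}` is generated by the open subsets of `E`. -/
lemma measurable_onePoint {α : Type*} [MeasurableSpace α] {f : α → OnePoint E}
    (hf : ∀ V : Set E, IsOpen V → MeasurableSet (f ⁻¹' ((↑) '' V))) : Measurable f := by
  refine measurable_of_isOpen fun U hU => ?_
  by_cases hmem : OnePoint.infty ∈ U
  · have hK := (OnePoint.isOpen_def.1 hU).2
    have : U = (((↑) '' (Set.univ : Set E)) \ ((↑) '' ((↑) ⁻¹' U : Set E)))ᶜ := by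
      ext z
      induction z using OnePoint.rec with
      | infty => simp [hmem]
      | coe z => simp
    rw [this, Set.preimage_compl, Set.preimage_sdiff]
    exact ((hf _ isOpen_univ).diff (hf _ (OnePoint.isOpen_def.1 hU).2)).compl
  · have : U = (↑) '' ((↑) ⁻¹' U : Set E) := by
      ext z
      induction z using OnePoint.rec with
      | infty => simp [hmem]
      | coe z => simp
    rw [this]
    exact hf _ ((OnePoint.isOpen_iff_of_notMem hmem).1 hU)

lemma measurableSet_onePoint_infty : MeasurableSet ({OnePoint.infty} : Set (OnePoint E)) :=
  OnePoint.isClosed_infty.measurableSet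

variable [MeasurableSpace E] [BorelSpace E]

lemma measurableEmbedding_onePoint_coe : MeasurableEmbedding ((↑) : E → OnePoint E) :=
  OnePoint.isOpenEmbedding_coe.measurableEmbedding

lemma measurable_onePointRetract [Nonempty E] :
    Measurable (onePointRetract : OnePoint E → E) := by
  classical
  intro S hS
  have : (onePointRetract ⁻¹' S : Set (OnePoint E)) =
      (↑) '' S ∪ (if Classical.arbitrary E ∈ S then {OnePoint.infty} else ∅) := by
    ext z
    induction z using OnePoint.rec with
    | infty => by_cases h : Classical.arbitrary E ∈ S <;> simp [h, onePointRetract]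
    | coe z => by_cases h : Classical.arbitrary E ∈ S <;> simp [h]
  rw [this]
  refine (measurableEmbedding_onePoint_coe.measurableSet_image' hS).union ?_
  split_ifs
  · exact OnePoint.isClosed_infty.measurableSet
  · exact MeasurableSet.empty

lemma measurable_onePoint_elim {α : Type*} [MeasurableSpace α] [Nonempty E]
    {f : α → OnePoint E} (hf : Measurable f) {φ : α → E → ℝ≥0∞}
    (hφ : Measurable fun w : α × E => φ w.1 w.2) :
    Measurable fun a => (f a).elim 0 (φ a) := by
  classical
  simp only [onePoint_elim_zero]
  exact Measurable.ite (hf measurableSet_onePoint_infty) measurable_const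
    (hφ.comp (measurable_id.prodMk (measurable_onePointRetract.comp hf)))

end OnePointMeasurability

/-! ### Hunt processes: joint measurability and the Markov property -/

/-- A sequence of grid points decreasing to `s` from strictly above. -/
lemma tendsto_grid_nhdsWithin_Ici (s : ℝ≥0) :
    Tendsto (fun j : ℕ => ((⌊s * (j + 1)⌋₊ + 1 : ℕ) : ℝ≥0) / (j + 1)) atTop (𝓝[≥] s) := by
  refine tendsto_nhdsWithin_iff.2 ⟨?_, Eventually.of_forall fun j => ?_⟩
  · have h1 : Tendsto (fun j : ℕ => s + 1 / ((j : ℝ≥0) + 1)) atTop (𝓝 (s + 0)) :=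
      tendsto_const_nhds.add tendsto_one_div_add_atTop_nhds_zero_nat
    rw [add_zero] at h1
    refine tendsto_of_tendsto_of_tendsto_of_le_of_le tendsto_const_nhds h1 (fun j => ?_)
      (fun j => ?_)
    · rw [le_div_iff₀ (by positivity)]
      exact_mod_cast (Nat.lt_floor_add_one _).le
    · have hpos : (0 : ℝ≥0) < j + 1 := by positivity
      rw [div_le_iff₀ hpos, add_mul, one_div_mul_cancel hpos.ne']
      push_cast
      gcongr
      exact Nat.floor_le (by positivity)
  · rw [Set.mem_Ici, le_div_iff₀ (by positivity)]
    exact_mod_cast (Nat.lt_floor_add_one _).le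

namespace HuntProcess

section Basic

variable {E Ω : Type*} [TopologicalSpace E] [MeasurableSpace Ω] (H : HuntProcess E Ω)

lemma measurable_X (s : ℝ≥0) : Measurable (H.X s) := (H.adapted s).mono (H.𝓕.le s) le_rfl

/-- The law of `X_u` as a kernel on `E ∪ {∞}`. -/
noncomputable def lawAt (u : ℝ≥0) : Kernel (OnePoint E) (OnePoint E) := H.P.map (H.X u)

instance : IsMarkovKernel H.P := H.isMarkovKernel

instance (u : ℝ≥0) : IsMarkovKernel (H.lawAt u) :=
  Kernel.IsMarkovKernel.map _ (H.measurable_X u)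

lemma lawAt_apply (u : ℝ≥0) (z : OnePoint E) : H.lawAt u z = (H.P z).map (H.X u) :=
  Kernel.map_apply _ (H.measurable_X u) z

/-- The simple Markov property at a deterministic time. -/
lemma markov (M u : ℝ≥0) (x : OnePoint E) {A : Set Ω} (hA : MeasurableSet[H.𝓕 M] A)
    {B : Set (OnePoint E)} (hB : MeasurableSet B) :
    H.P x (A ∩ H.X (M + u) ⁻¹' B) = ∫⁻ ω in A, H.lawAt u (H.X M ω) B ∂(H.P x) := by
  have hτ := isStoppingTime_const H.𝓕 M
  have h := H.strong_markov (fun _ => (M : WithTop ℝ≥0)) hτ x u B hB A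
    (by rw [IsStoppingTime.measurableSpace_const]; exact hA)
  simp only [WithTop.coe_ne_top, ne_eq, not_false_eq_true, and_true, true_and,
    WithTop.untopD_coe] at h
  refine Eq.trans ?_ (h.trans ?_)
  · rfl
  · simp only [Set.ofPred_mem_eq]
    refine lintegral_congr fun ω => ?_
    rw [lawAt_apply, Measure.map_apply (H.measurable_X u) hB]
    rfl

/-- The Markov property for functions of the past and of one future position. -/
lemma lintegral_markov {S : Type*} [MeasurableSpace S] (M u : ℝ≥0) (x : OnePoint E)
    {V : Ω → S} (hV : Measurable[H.𝓕 M] V) {G : S × OnePoint E → ℝ≥0∞} (hG : Measurable G) :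
    ∫⁻ ω, G (V ω, H.X (M + u) ω) ∂(H.P x) =
      ∫⁻ ω, ∫⁻ y, G (V ω, y) ∂(H.lawAt u (H.X M ω)) ∂(H.P x) := by
  have hV' : Measurable V := hV.mono (H.𝓕.le M) le_rfl
  have hXM := H.measurable_X M
  set κ := (H.lawAt u).comap (H.X M) hXM with hκ
  have hpair : Measurable fun ω => (V ω, H.X (M + u) ω) := hV'.prodMk (H.measurable_X _)
  have hprod : Measurable (Prod.map V (id : OnePoint E → OnePoint E)) :=
    hV'.prodMap measurable_id
  have key : (H.P x).map (fun ω => (V ω, H.X (M + u) ω)) =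
      ((H.P x) ⊗ₘ κ).map (Prod.map V id) := by
    have : IsFiniteMeasure ((H.P x).map (fun ω => (V ω, H.X (M + u) ω))) := inferInstance
    refine Measure.ext_prod fun {A B} hA hB => ?_
    rw [Measure.map_apply hpair (hA.prod hB), Measure.map_apply hprod (hA.prod hB)]
    have e : Prod.map V (id : OnePoint E → OnePoint E) ⁻¹' (A ×ˢ B) = (V ⁻¹' A) ×ˢ B := by
      ext; simp
    rw [e, Measure.compProd_apply_prod (hV' hA) hB]
    exact H.markov M u x (hV hA) hB
  rw [← lintegral_map hG hpair, key, lintegral_map hG hprod,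
    Measure.lintegral_compProd (f := fun w => G (Prod.map V id w)) (hG.comp hprod)]
  rfl

lemma lawAt_infty (u : ℝ≥0) : ∀ᵐ y ∂(H.lawAt u OnePoint.infty), y = OnePoint.infty := by
  rw [lawAt_apply]
  refine (ae_map_iff (H.measurable_X u).aemeasurable
    OnePoint.isClosed_infty.measurableSet).2 ?_
  filter_upwards [H.normal OnePoint.infty] with ω hω
  exact H.absorbing ω 0 u zero_le hω

end Basic

section Joint

variable {E Ω : Type*} [TopologicalSpace E] [T2Space E] [LocallyCompactSpace E]
  [SecondCountableTopology E] [MeasurableSpace Ω] (H : HuntProcess E Ω)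

/-- A right-continuous process is jointly measurable. -/
lemma measurable_X_uncurry : Measurable fun w : ℝ≥0 × Ω => H.X w.1 w.2 := by
  refine measurable_onePoint fun V hV => ?_
  -- the grid `(i + 1) / (j + 1)`, known only through its values
  obtain ⟨c, hc⟩ : ∃ c : ℕ → ℕ → ℝ≥0, ∀ j i, c j i = ((i + 1 : ℕ) : ℝ≥0) / (j + 1) :=
    ⟨_, fun _ _ => rfl⟩
  let g : ℕ → ℝ≥0 → ℝ≥0 := fun j s => c j ⌊s * (j + 1)⌋₊
  have hg : ∀ s, Tendsto (fun j => g j s) atTop (𝓝[≥] s) := fun s => by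
    simpa only [g, hc] using tendsto_grid_nhdsWithin_Ici s
  have hXj : ∀ j, Measurable fun w : ℝ≥0 × Ω => H.X (g j w.1) w.2 := by
    intro j
    have hfl : Measurable fun w : ℝ≥0 × Ω => (w.2, ⌊w.1 * (j + 1)⌋₊) :=
      measurable_snd.prodMk (Nat.measurable_floor.comp (measurable_fst.mul_const _))
    have hgrid : ∀ c : ℕ → ℝ≥0, Measurable fun v : Ω × ℕ => H.X (c v.2) v.1 := fun c =>
      measurable_from_prod_countable_left fun i => H.measurable_X (c i)
    exact (hgrid (c j)).comp hfl
  set B := {b ∈ TopologicalSpace.countableBasis E | IsCompact (closure b) ∧ closure b ⊆ V}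
  have hB : B.Countable := (TopologicalSpace.countable_countableBasis E).mono fun _ h => h.1
  have heq : (fun w : ℝ≥0 × Ω => H.X w.1 w.2) ⁻¹' ((↑) '' V) =
      ⋃ b ∈ B, ⋃ N : ℕ, ⋂ j ∈ {j | N ≤ j},
        (fun w : ℝ≥0 × Ω => H.X (g j w.1) w.2) ⁻¹' ((↑) '' closure b) := by
    ext ⟨s, ω⟩
    have hlim : Tendsto (fun j => H.X (g j s) ω) atTop (𝓝 (H.X s ω)) :=
      (H.right_continuous ω s).tendsto.comp (hg s)
    simp only [Set.mem_preimage, Set.mem_iUnion, Set.mem_iInter, Set.mem_ofPred_eq, exists_prop]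
    constructor
    · rintro ⟨z, hzV, hz⟩
      obtain ⟨K, hK, hzK, hKV⟩ := exists_compact_subset hV hzV
      obtain ⟨b, hb, hzb, hbK⟩ := (TopologicalSpace.isBasis_countableBasis E).exists_subset_of_mem_open
        hzK isOpen_interior
      have hcl : closure b ⊆ K := closure_minimal (hbK.trans interior_subset) hK.isClosed
      refine ⟨b, ⟨hb, hK.of_isClosed_subset isClosed_closure hcl, hcl.trans hKV⟩, ?_⟩
      have hbo := (TopologicalSpace.isBasis_countableBasis E).isOpen hb
      have hev : ∀ᶠ j in atTop, H.X (g j s) ω ∈ ((↑) '' b : Set (OnePoint E)) := by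
        refine hlim.eventually_mem ((OnePoint.isOpen_image_coe.2 hbo).mem_nhds ?_)
        rw [← hz]
        exact ⟨z, hzb, rfl⟩
      obtain ⟨N, hN⟩ := eventually_atTop.1 hev
      exact ⟨N, fun j hj => Set.image_mono subset_closure (hN j hj)⟩
    · rintro ⟨b, ⟨-, hbc, hbV⟩, N, hN⟩
      have hc : IsClosed ((↑) '' closure b : Set (OnePoint E)) :=
        OnePoint.isClosed_image_coe.2 ⟨isClosed_closure, hbc⟩
      exact Set.image_mono hbV
        (hc.mem_of_tendsto hlim (eventually_atTop.2 ⟨N, fun j hj => hN j hj⟩))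
  rw [heq]
  refine MeasurableSet.biUnion hB fun b hb => MeasurableSet.iUnion fun N =>
    MeasurableSet.biInter (Set.to_countable _) fun j _ => hXj j ?_
  exact (OnePoint.isClosed_image_coe.2 ⟨isClosed_closure, hb.2.1⟩).measurableSet

end Joint

end HuntProcess

/-! ### Transition densities -/

namespace HuntProcess

variable {E Ω : Type*} [TopologicalSpace E] [MeasurableSpace E] [BorelSpace E]
  [MeasurableSpace Ω] {H : HuntProcess E Ω} {m : Measure E}

lemma transition_apply (u : ℝ≥0) (z : E) {B : Set E} (hB : MeasurableSet B) :
    H.transition u z B = H.P z (H.X u ⁻¹' ((↑) '' B)) := by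
  rw [transition, measurableEmbedding_onePoint_coe.comap_apply,
    Measure.map_apply (H.measurable_X u)
      (measurableEmbedding_onePoint_coe.measurableSet_image' hB)]

lemma transition_univ_le (u : ℝ≥0) (z : E) : H.transition u z Set.univ ≤ 1 := by
  rw [transition_apply u z MeasurableSet.univ]
  exact prob_le_one

lemma lintegral_transition [Nonempty E] (u : ℝ≥0) (z : E) {φ : E → ℝ≥0∞} (hφ : Measurable φ) :
    ∫⁻ y, φ y ∂(H.transition u z) = ∫⁻ y : OnePoint E, y.elim 0 φ ∂(H.lawAt u z) := by
  have hφ' : Measurable fun y : OnePoint E => y.elim 0 φ :=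
    measurable_onePoint_elim (φ := fun _ => φ) measurable_id (hφ.comp measurable_snd)
  have hr : MeasurableSet (Set.range ((↑) : E → OnePoint E)) :=
    measurableEmbedding_onePoint_coe.measurableSet_range
  have h1 : ∫⁻ y, φ y ∂(H.transition u z) =
      ∫⁻ y : OnePoint E, y.elim 0 φ ∂((H.transition u z).map (↑)) := by
    rw [measurableEmbedding_onePoint_coe.lintegral_map]
    rfl
  rw [h1, transition, measurableEmbedding_onePoint_coe.map_comap, ← lawAt_apply,
    ← lintegral_indicator hr]
  refine lintegral_congr fun y => ?_
  induction y using OnePoint.rec with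
  | infty => simp
  | coe y => simp

section Density

variable {p : ℝ → E → E → ℝ≥0∞} (hp : H.IsTransitionDensity m p)
include hp

omit [BorelSpace E] in
lemma IsTransitionDensity.measurable_slice (t : ℝ) :
    Measurable fun w : E × E => p t w.1 w.2 :=
  hp.measurable.comp (measurable_const.prodMk measurable_id)

omit [BorelSpace E] in
lemma IsTransitionDensity.measurable_right (t : ℝ) (x : E) : Measurable (p t x) :=
  (hp.measurable_slice t).comp (measurable_const.prodMk measurable_id)

omit [BorelSpace E] in
lemma IsTransitionDensity.lintegral_eq {t : ℝ} (ht : 0 < t) (x : E) {φ : E → ℝ≥0∞}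
    (hφ : Measurable φ) :
    ∫⁻ y, φ y ∂(H.transition t.toNNReal x) = ∫⁻ y, p t x y * φ y ∂m := by
  rw [hp.eq_withDensity t ht x,
    lintegral_withDensity_eq_lintegral_mul _ (hp.measurable_right t x) hφ]
  rfl

omit [BorelSpace E] in
lemma IsTransitionDensity.setLIntegral_eq {t : ℝ} (ht : 0 < t) (x : E) {B : Set E}
    (hB : MeasurableSet B) : ∫⁻ y in B, p t x y ∂m = H.transition t.toNNReal x B := by
  rw [hp.eq_withDensity t ht x, withDensity_apply _ hB]

/-- Symmetry makes a transition density substochastic in its first variable as well. -/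
lemma IsTransitionDensity.isDoublySubstochastic [SigmaFinite m] (hsymm : H.IsSymmetric m)
    {t : ℝ} (ht : 0 < t) : IsDoublySubstochastic m (p t) where
  measurable := hp.measurable_slice t
  lintegral_right_le x := by
    rw [← setLIntegral_univ, hp.setLIntegral_eq ht x MeasurableSet.univ]
    exact transition_univ_le _ _
  lintegral_left_le := by
    refine ae_le_of_forall_setLIntegral_le_of_sigmaFinite ?_ fun B hB _ => ?_
    · exact Measurable.lintegral_prod_right ((hp.measurable_slice t).comp measurable_swap)
    · have h := hsymm t.toNNReal (fun _ => 1) (B.indicator fun _ => 1) measurable_const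
        (measurable_const.indicator hB)
      simp only [lintegral_indicator_const hB, one_mul, lintegral_const] at h
      calc ∫⁻ y in B, ∫⁻ x, p t x y ∂m ∂m = ∫⁻ x, ∫⁻ y in B, p t x y ∂m ∂m :=
            lintegral_lintegral_swap ((hp.measurable_slice t).comp measurable_swap).aemeasurable
        _ = ∫⁻ x, H.transition t.toNNReal x B ∂m :=
            lintegral_congr fun x => hp.setLIntegral_eq ht x hB
        _ = ∫⁻ x, H.transition t.toNNReal x Set.univ * B.indicator (fun _ => 1) x ∂m := h
        _ ≤ ∫⁻ x, B.indicator (fun _ => 1) x ∂m := by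
            refine lintegral_mono fun x => ?_
            exact (mul_le_mul_left (transition_univ_le _ _) _).trans (one_mul _).le
        _ = ∫⁻ x in B, 1 ∂m := lintegral_indicator hB _

omit [BorelSpace E] in
lemma measurable_green : Measurable fun w : E × E => green p w.1 w.2 := by
  have h1 : Measurable fun v : (E × E) × ℝ => ENNReal.ofReal (Real.exp (-v.2)) := by fun_prop
  have h2 : Measurable fun v : (E × E) × ℝ => (v.2, v.1.1, v.1.2) := by fun_prop
  exact Measurable.lintegral_prod_right (h1.mul (hp.measurable.comp h2))

omit [BorelSpace E] in
/-- Up to time `t`, the occupation measure is dominated by `e^t` times the Green function. -/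
lemma lintegral_occupation_le [SFinite m] (t : ℝ) (z : E) {φ : E → ℝ≥0∞} (hφ : Measurable φ) :
    ∫⁻ u in Set.Icc 0 t, ∫⁻ y, φ y ∂(H.transition u.toNNReal z) ≤
      ENNReal.ofReal (Real.exp t) * ∫⁻ y, green p z y * φ y ∂m := by
  have hm : Measurable fun v : ℝ × E =>
      ENNReal.ofReal (Real.exp (-v.1)) * p v.1 z v.2 * φ v.2 := by
    have h1 : Measurable fun v : ℝ × E => ENNReal.ofReal (Real.exp (-v.1)) := by fun_prop
    have h2 : Measurable fun v : ℝ × E => (v.1, z, v.2) := by fun_prop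
    exact (h1.mul (hp.measurable.comp h2)).mul (hφ.comp measurable_snd)
  calc ∫⁻ u in Set.Icc 0 t, ∫⁻ y, φ y ∂(H.transition u.toNNReal z)
      = ∫⁻ u in Set.Ioc 0 t, ∫⁻ y, φ y ∂(H.transition u.toNNReal z) := by
        rw [restrict_Ioc_eq_restrict_Icc]
    _ ≤ ∫⁻ u in Set.Ioc 0 t, ENNReal.ofReal (Real.exp t) *
          ∫⁻ y, ENNReal.ofReal (Real.exp (-u)) * p u z y * φ y ∂m := by
        refine setLIntegral_mono' measurableSet_Ioc fun u hu => ?_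
        rw [hp.lintegral_eq hu.1 z hφ, ← lintegral_const_mul' _ _ ENNReal.ofReal_ne_top]
        refine lintegral_mono fun y => ?_
        simp only [← mul_assoc]
        gcongr
        rw [← ENNReal.ofReal_mul (Real.exp_pos t).le, ← Real.exp_add]
        refine (one_mul _).symm.le.trans (mul_le_mul_left ?_ _)
        rw [ENNReal.one_le_ofReal]
        exact Real.one_le_exp (by linarith [hu.2])
    _ ≤ ∫⁻ u in Set.Ioi 0, ENNReal.ofReal (Real.exp t) *
          ∫⁻ y, ENNReal.ofReal (Real.exp (-u)) * p u z y * φ y ∂m :=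
        lintegral_mono_set Set.Ioc_subset_Ioi_self
    _ = ENNReal.ofReal (Real.exp t) * ∫⁻ u in Set.Ioi 0,
          ∫⁻ y, ENNReal.ofReal (Real.exp (-u)) * p u z y * φ y ∂m :=
        lintegral_const_mul' _ _ ENNReal.ofReal_ne_top
    _ = _ := by
        rw [lintegral_lintegral_swap hm.aemeasurable]
        congr 1
        refine lintegral_congr fun y => ?_
        rw [green, lintegral_mul_const]
        have h1 : Measurable fun u : ℝ => (u, z, y) := by fun_prop
        exact (by fun_prop : Measurable fun u : ℝ => ENNReal.ofReal (Real.exp (-u))).mul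
          (hp.measurable.comp h1)

end Density

lemma tendsto_transition_one (z : E) {U : Set E} (hU : IsOpen U) (hz : z ∈ U) :
    Tendsto (fun ε : ℝ => H.transition ε.toNNReal z U) (𝓝[>] 0) (𝓝 1) := by
  have hm : ∀ s, MeasurableSet (H.X s ⁻¹' ((↑) '' U)) := fun s =>
    H.measurable_X s (OnePoint.isOpen_image_coe.2 hU).measurableSet
  have h1 : ∀ s, H.transition s z U =
      ∫⁻ ω, (H.X s ⁻¹' ((↑) '' U)).indicator 1 ω ∂(H.P z) := fun s => by
    rw [transition_apply s z hU.measurableSet, lintegral_indicator_one (hm s)]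
  have h2 : (1 : ℝ≥0∞) = ∫⁻ _, 1 ∂(H.P z) := by simp
  simp only [h1]
  rw [h2]
  refine tendsto_lintegral_filter_of_dominated_convergence (fun _ => 1)
    (Eventually.of_forall fun ε => measurable_one.indicator (hm _))
    (Eventually.of_forall fun ε => Eventually.of_forall fun ω => Set.indicator_le_self' (by simp) _)
    (by simp) ?_
  filter_upwards [H.normal z] with ω hω
  have hc : Tendsto (fun ε : ℝ => H.X ε.toNNReal ω) (𝓝[>] 0) (𝓝 (z : OnePoint E)) := by
    rw [← hω]
    refine (H.right_continuous ω 0).tendsto.comp (tendsto_nhdsWithin_iff.2 ⟨?_, by simp⟩)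
    have := (continuous_real_toNNReal.tendsto 0).mono_left (nhdsWithin_le_nhds (s := Set.Ioi 0))
    simpa using this
  refine tendsto_const_nhds.congr' ?_
  filter_upwards [hc.eventually_mem
    ((OnePoint.isOpen_image_coe.2 hU).mem_nhds ⟨z, hz, rfl⟩)] with ε hε
  simp [Set.indicator_of_mem (s := H.X ε.toNNReal ⁻¹' ((↑) '' U)) hε]

/-- A transition density of a symmetric Hunt process is an approximate identity in small time. -/
lemma IsTransitionDensity.isApproxIdentity [SigmaFinite m] {p : ℝ → E → E → ℝ≥0∞}
    (hp : H.IsTransitionDensity m p) (hsymm : H.IsSymmetric m) :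
    IsApproxIdentity m p (𝓝[>] 0) where
  doublySubstochastic := by
    filter_upwards [self_mem_nhdsWithin] with ε hε
    exact hp.isDoublySubstochastic hsymm hε
  tendsto_one z U hU hz := by
    refine (tendsto_transition_one (H := H) z hU hz).congr' ?_
    filter_upwards [self_mem_nhdsWithin] with ε hε
    exact (hp.setLIntegral_eq hε z hU.measurableSet).symm

end HuntProcess

/-! ### Occupation moments -/

section ExtendZero

variable {E : Type*} [Nonempty E] {k : ℕ}

open Classical in
/-- The extension by zero of a function on `E^k` to `(E ∪ {∞})^k`. -/
noncomputable def extendZero (φ : (Fin k → E) → ℝ≥0∞) (w : Fin k → OnePoint E) : ℝ≥0∞ :=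
  if ∀ j, w j ≠ OnePoint.infty then φ fun j => onePointRetract (w j) else 0

lemma extendZero_of_exists (φ : (Fin k → E) → ℝ≥0∞) {w : Fin k → OnePoint E} {j : Fin k}
    (h : w j = OnePoint.infty) : extendZero φ w = 0 :=
  if_neg fun hw => hw j h

lemma extendZero_insertNth_coe (φ : (Fin (k + 1) → E) → ℝ≥0∞) (j : Fin (k + 1)) (y : E)
    (v : Fin k → OnePoint E) :
    extendZero φ (j.insertNth (α := fun _ => OnePoint E) (y : OnePoint E) v) =
      extendZero (fun z => φ (j.insertNth (α := fun _ => E) y z)) v := by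
  have hiff : (∀ i, j.insertNth (α := fun _ => OnePoint E) (y : OnePoint E) v i ≠
      OnePoint.infty) ↔ ∀ i, v i ≠ OnePoint.infty := by
    simp [Fin.forall_iff_succAbove j]
  unfold extendZero
  by_cases hv : ∀ i, v i ≠ OnePoint.infty
  · rw [if_pos (hiff.2 hv), if_pos hv]
    congr 1
    rw [Fin.eq_insertNth_iff]
    refine ⟨by simp, ?_⟩
    ext l
    simp [Fin.removeNth]
  · rw [if_neg (hiff.not.2 hv), if_neg hv]

variable [TopologicalSpace E] [MeasurableSpace E] [BorelSpace E]

lemma measurable_extendZero {φ : (Fin k → E) → ℝ≥0∞} (hφ : Measurable φ) :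
    Measurable (extendZero φ) := by
  refine Measurable.ite ?_ ?_ measurable_const
  · have : {w : Fin k → OnePoint E | ∀ j, w j ≠ OnePoint.infty} =
        ⋂ j, (fun w : Fin k → OnePoint E => w j) ⁻¹' {OnePoint.infty}ᶜ := by
      ext w; simp
    rw [this]
    exact MeasurableSet.iInter fun j =>
      measurable_pi_apply j measurableSet_onePoint_infty.compl
  · exact hφ.comp (measurable_pi_lambda _ fun j =>
      measurable_onePointRetract.comp (measurable_pi_apply j))

end ExtendZero

/-- Lebesgue measure on the cube `[0, t]^k`. -/
noncomputable def cubeMeasure (t : ℝ) (k : ℕ) : Measure (Fin k → ℝ) :=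
  Measure.pi fun _ => volume.restrict (Set.Icc 0 t)

instance (t : ℝ) (k : ℕ) : IsFiniteMeasure (cubeMeasure t k) := by
  unfold cubeMeasure; infer_instance

lemma ENNReal.sum_pow_le_card_pow_mul_sum {ι : Type*} (s : Finset ι) (f : ι → ℝ≥0∞) {n : ℕ}
    (hn : 1 ≤ n) : (∑ i ∈ s, f i) ^ n ≤ (s.card : ℝ≥0∞) ^ n * ∑ i ∈ s, f i ^ n := by
  rcases s.eq_empty_or_nonempty with rfl | hs
  · simp [Nat.one_le_iff_ne_zero.1 hn]
  · obtain ⟨i, hi, hmax⟩ := s.exists_max_image f hs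
    calc (∑ i ∈ s, f i) ^ n ≤ ((s.card : ℝ≥0∞) * f i) ^ n := by
          gcongr
          simpa using s.sum_le_card_nsmul f (f i) hmax
      _ = (s.card : ℝ≥0∞) ^ n * f i ^ n := mul_pow _ _ _
      _ ≤ _ := by
          gcongr
          exact Finset.single_le_sum (f := fun i => f i ^ n) (fun _ _ => zero_le) hi

namespace HuntProcess

variable {E Ω : Type*} [TopologicalSpace E] [Nonempty E] [MeasurableSpace Ω]
  (H : HuntProcess E Ω)

/-- The `k`-th moment of the occupation measure up to time `t` of the process started at `x`,
`∫_{[0,t]^k} 𝔼_x[φ(X_{s₁}, …, X_{s_k}); all X_{s_j} ∈ E] ds`. -/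
noncomputable def occupationMoment (x : OnePoint E) (t : ℝ) {k : ℕ} (φ : (Fin k → E) → ℝ≥0∞) : ℝ≥0∞ :=
  ∫⁻ s, ∫⁻ ω, extendZero φ (fun j => H.X (s j).toNNReal ω) ∂(H.P x) ∂(cubeMeasure t k)

/-- The sum of the Green functions `R₁(x₀, y) + ∑ₗ R₁(zₗ, y)`. -/
noncomputable def greenSum (p : ℝ → E → E → ℝ≥0∞) (x₀ : E) {k : ℕ} (z : Fin k → E) (y : E) : ℝ≥0∞ :=
  ∑ l : Fin (k + 1), green p (Fin.cons (α := fun _ => E) x₀ z l) y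

variable [T2Space E] [LocallyCompactSpace E] [SecondCountableTopology E]
  [MeasurableSpace E] [BorelSpace E] {m : Measure E} [SigmaFinite m]
  {p : ℝ → E → E → ℝ≥0∞}

omit [Nonempty E] [MeasurableSpace E] [BorelSpace E] in
lemma measurable_X_tuple (k : ℕ) :
    Measurable fun w : (Fin k → ℝ) × Ω => fun j => H.X (w.1 j).toNNReal w.2 := by
  refine measurable_pi_lambda _ fun j => ?_
  have : Measurable fun w : (Fin k → ℝ) × Ω => ((w.1 j).toNNReal, w.2) := by fun_prop
  exact H.measurable_X_uncurry.comp this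

lemma measurable_extendZero_X {k : ℕ} {φ : (Fin k → E) → ℝ≥0∞} (hφ : Measurable φ) :
    Measurable fun w : (Fin k → ℝ) × Ω => extendZero φ fun j => H.X (w.1 j).toNNReal w.2 :=
  (measurable_extendZero hφ).comp (H.measurable_X_tuple k)

variable {H}

omit [Nonempty E] [T2Space E] [LocallyCompactSpace E] [SecondCountableTopology E] [BorelSpace E]
  [SigmaFinite m] in
lemma measurable_greenSum (hp : H.IsTransitionDensity m p) (x₀ : E) (k : ℕ) :
    Measurable fun w : (Fin k → E) × E => greenSum p x₀ w.1 w.2 := by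
  refine Finset.measurable_fun_sum _ fun l _ => ?_
  have hc : Measurable fun w : (Fin k → E) × E => (Fin.cons (α := fun _ => E) x₀ w.1 l) := by
    refine Fin.cases ?_ (fun i => ?_) l
    · exact measurable_const
    · exact (measurable_pi_apply i).comp measurable_fst
  exact (measurable_green hp).comp (hc.prodMk measurable_snd)

omit [Nonempty E] [T2Space E] [LocallyCompactSpace E] [SecondCountableTopology E] in
/-- From a given position, the expected integral of a function of a future position over a time
interval of length `t` is bounded through the Green function. -/
lemma lintegral_lawAt_le [Nonempty E] (hp : H.IsTransitionDensity m p) (t : ℝ) (z : OnePoint E)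
    {ψ : OnePoint E → ℝ≥0∞} (hψ : Measurable ψ) (hψ0 : ψ OnePoint.infty = 0) :
    ∫⁻ u in Set.Icc 0 t, ∫⁻ y, ψ y ∂(H.lawAt u.toNNReal z) ≤
      z.elim 0 fun z => ENNReal.ofReal (Real.exp t) * ∫⁻ y, green p z y * ψ (y : E) ∂m := by
  induction z using OnePoint.rec with
  | infty =>
    simp only [OnePoint.elim_infty, nonpos_iff_eq_zero]
    rw [← lintegral_zero (μ := volume.restrict (Set.Icc 0 t))]
    refine lintegral_congr fun u => ?_
    rw [← lintegral_zero (μ := H.lawAt u.toNNReal OnePoint.infty)]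
    refine lintegral_congr_ae ?_
    filter_upwards [H.lawAt_infty u.toNNReal] with y hy
    rw [hy, hψ0]
  | coe z =>
    have hψ' : Measurable fun y : E => ψ (y : OnePoint E) :=
      hψ.comp measurableEmbedding_onePoint_coe.measurable
    refine le_trans (le_of_eq ?_) (lintegral_occupation_le hp t z hψ')
    refine lintegral_congr fun u => ?_
    rw [lintegral_transition _ _ hψ']
    refine lintegral_congr fun y => ?_
    induction y using OnePoint.rec with
    | infty => simpa using hψ0
    | coe y => rfl

omit [SecondCountableTopology E] [T2Space E] [LocallyCompactSpace E] [Nonempty E]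
  [TopologicalSpace E] [MeasurableSpace E] [BorelSpace E] [MeasurableSpace Ω] in
/-- Integrals over the times in `[0, t]` after `M` are integrals over the elapsed time. -/
lemma _root_.setLIntegral_Icc_shift_le (t : ℝ) (M : ℝ≥0) (h : ℝ → ℝ≥0∞) :
    ∫⁻ s in Set.Icc 0 t, (Set.Ici (M : ℝ)).indicator h s ≤
      ∫⁻ u in Set.Icc 0 t, h (M + u) := by
  rw [← lintegral_indicator measurableSet_Icc, ← lintegral_indicator measurableSet_Icc,
    ← lintegral_add_left_eq_self _ (M : ℝ)]
  refine lintegral_mono fun u => ?_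
  by_cases h1 : (M : ℝ) + u ∈ Set.Icc 0 t
  · by_cases h2 : (M : ℝ) + u ∈ Set.Ici (M : ℝ)
    · have h3 : u ∈ Set.Icc 0 t := by
        simp only [Set.mem_Ici, Set.mem_Icc] at h1 h2 ⊢
        constructor <;> linarith [M.coe_nonneg]
      simp [h1, h2, h3]
    · rw [Set.indicator_of_mem h1, Set.indicator_of_notMem h2]
      exact zero_le
  · simp [Set.indicator_of_notMem h1]

/-- The recursion for fixed earlier times `r`: integrating over a further time that
is later than all of them costs at most a Green function started from one of the earlier
positions. -/
lemma lintegral_last_time_le (hp : H.IsTransitionDensity m p) (x₀ : E) (t : ℝ) {k : ℕ}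
    (j : Fin (k + 1)) (r : Fin k → ℝ) {φ : (Fin (k + 1) → E) → ℝ≥0∞} (hφ : Measurable φ) :
    ∫⁻ s in Set.Icc 0 t, {s | ∀ l, r l ≤ s}.indicator (fun s => ∫⁻ ω, extendZero φ
        (fun i => H.X ((j.insertNth (α := fun _ => ℝ) s r) i).toNNReal ω) ∂(H.P x₀)) s ≤
      ENNReal.ofReal (Real.exp t) * ∫⁻ ω, extendZero (fun z => ∫⁻ y,
        greenSum p x₀ z y * φ (j.insertNth (α := fun _ => E) y z) ∂m)
          (fun l => H.X (r l).toNNReal ω) ∂(H.P x₀) := by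
  -- the Markov property is applied at the latest `M` of the earlier times; the position `X_M` is
  -- then one of the earlier positions, or `x₀` if there are none
  set M : ℝ≥0 := Finset.univ.sup fun l => (r l).toNNReal with hM
  set V : Ω → Fin k → OnePoint E := fun ω l => H.X (r l).toNNReal ω with hV
  set G : (Fin k → OnePoint E) × OnePoint E → ℝ≥0∞ := fun w =>
    extendZero φ (j.insertNth (α := fun _ => OnePoint E) w.2 w.1) with hG
  have hGm : Measurable G :=
    (measurable_extendZero hφ).comp ((measurable_insertNth j).comp measurable_swap)
  have hVM : Measurable[H.𝓕 M] V := by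
    refine @measurable_pi_lambda _ _ _ (H.𝓕 M) _ _ fun l => ?_
    exact (H.adapted _).mono (H.𝓕.mono (Finset.le_sup (f := fun l => (r l).toNNReal)
      (Finset.mem_univ l))) le_rfl
  have hVm : Measurable V := hVM.mono (H.𝓕.le M) le_rfl
  have hGinf : ∀ v, G (v, OnePoint.infty) = 0 := fun v =>
    extendZero_of_exists φ (j := j) (by simp)
  have hpath : ∀ (s : ℝ) ω, (fun i => H.X ((j.insertNth (α := fun _ => ℝ) s r) i).toNNReal ω) =
      j.insertNth (α := fun _ => OnePoint E) (H.X s.toNNReal ω) (V ω) := by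
    intro s ω
    rw [Fin.eq_insertNth_iff]
    refine ⟨by simp, ?_⟩
    ext l
    simp [Fin.removeNth, hV]
  simp only [hpath]
  set h : ℝ → ℝ≥0∞ := fun s => ∫⁻ ω, G (V ω, H.X s.toNNReal ω) ∂(H.P x₀) with hh
  have hjoint : Measurable fun w : ℝ × Ω =>
      ∫⁻ y, G (V w.2, y) ∂(H.lawAt w.1.toNNReal (H.X M w.2)) := by
    have e : ∀ w : ℝ × Ω, ∫⁻ y, G (V w.2, y) ∂(H.lawAt w.1.toNNReal (H.X M w.2)) =
        ∫⁻ ω', G (V w.2, H.X w.1.toNNReal ω') ∂(H.P (H.X M w.2)) := fun w => by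
      rw [lawAt_apply, lintegral_map (f := fun y => G (V w.2, y))
        (hGm.comp (measurable_const.prodMk measurable_id)) (H.measurable_X _)]
    simp only [e]
    have hXM : Measurable fun w : ℝ × Ω => H.X M w.2 := (H.measurable_X M).comp measurable_snd
    have := Measurable.lintegral_kernel_prod_right' (κ := H.P.comap _ hXM)
      (f := fun w : (ℝ × Ω) × Ω => G (V w.1.2, H.X w.1.1.toNNReal w.2)) ?_
    · simpa only [Kernel.comap_apply] using this
    · refine hGm.comp ((hVm.comp (measurable_snd.comp measurable_fst)).prodMk ?_)
      have h2 : Measurable fun w : (ℝ × Ω) × Ω => (w.1.1.toNNReal, w.2) := by fun_prop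
      exact H.measurable_X_uncurry.comp h2
  calc ∫⁻ s in Set.Icc 0 t, {s | ∀ l, r l ≤ s}.indicator h s
      ≤ ∫⁻ s in Set.Icc 0 t, (Set.Ici (M : ℝ)).indicator h s := by
        refine setLIntegral_mono' measurableSet_Icc fun s hs => ?_
        by_cases hr : s ∈ {s | ∀ l, r l ≤ s}
        · have hMs : (M : ℝ) ≤ s := (Real.le_toNNReal_iff_coe_le hs.1).1
            (Finset.sup_le fun l _ => Real.toNNReal_mono (hr l))
          rw [Set.indicator_of_mem hr, Set.indicator_of_mem (Set.mem_Ici.2 hMs)]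
        · rw [Set.indicator_of_notMem hr]
          exact zero_le
    _ ≤ ∫⁻ u in Set.Icc 0 t, h (M + u) := setLIntegral_Icc_shift_le t M h
    _ = ∫⁻ u in Set.Icc 0 t, ∫⁻ ω, ∫⁻ y, G (V ω, y) ∂(H.lawAt u.toNNReal (H.X M ω))
          ∂(H.P x₀) := by
        refine setLIntegral_congr_fun measurableSet_Icc fun u hu => ?_
        simp only [hh]
        rw [Real.toNNReal_add M.coe_nonneg hu.1, Real.toNNReal_coe]
        exact H.lintegral_markov M _ x₀ hVM hGm
    _ = ∫⁻ ω, (∫⁻ u in Set.Icc 0 t, ∫⁻ y, G (V ω, y) ∂(H.lawAt u.toNNReal (H.X M ω)))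
          ∂(H.P x₀) := lintegral_lintegral_swap hjoint.aemeasurable
    _ ≤ ∫⁻ ω, ENNReal.ofReal (Real.exp t) * extendZero (fun z => ∫⁻ y,
          greenSum p x₀ z y * φ (j.insertNth (α := fun _ => E) y z) ∂m) (V ω) ∂(H.P x₀) := by
        refine lintegral_mono_ae ?_
        filter_upwards [H.normal x₀] with ω hω
        refine (lintegral_lawAt_le hp t (H.X M ω) (ψ := fun y => G (V ω, y))
          (hGm.comp (measurable_const.prodMk measurable_id)) (hGinf _)).trans ?_
        by_cases hv : ∀ l, V ω l ≠ OnePoint.infty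
        · obtain ⟨l, hl⟩ : ∃ l : Fin (k + 1), H.X M ω =
              (Fin.cons (α := fun _ => E) x₀ (fun i => onePointRetract (V ω i)) l : E) := by
            rcases (Finset.univ : Finset (Fin k)).eq_empty_or_nonempty with he | hne
            · refine ⟨0, ?_⟩
              rw [hM, he]
              exact hω
            · obtain ⟨i, -, hi⟩ := Finset.exists_mem_eq_sup _ hne fun l => (r l).toNNReal
              refine ⟨i.succ, ?_⟩
              rw [Fin.cons_succ, coe_onePointRetract (hv i), hM, hi]
          rw [hl, OnePoint.elim_some, extendZero, if_pos hv]
          gcongr with y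
          · exact Finset.single_le_sum (f := fun l => green p
              (Fin.cons (α := fun _ => E) x₀ (fun i => onePointRetract (V ω i)) l) y)
              (fun _ _ => zero_le) (Finset.mem_univ l)
          · refine ((extendZero_insertNth_coe φ j y (V ω)).trans ?_).le
            rw [extendZero, if_pos hv]
        · push Not at hv
          obtain ⟨l, hl⟩ := hv
          have h0 : ∀ y : E, G (V ω, y) = 0 := fun y => by
            exact (extendZero_insertNth_coe φ j y (V ω)).trans (extendZero_of_exists _ hl)
          simp only [h0, mul_zero, lintegral_zero]
          generalize H.X M ω = z
          induction z using OnePoint.rec <;> simp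
    _ = _ := lintegral_const_mul' _ _ ENNReal.ofReal_ne_top

/-- The recursion for the occupation moments: the latest of `k + 1` times is split off. -/
lemma occupationMoment_succ_le (hp : H.IsTransitionDensity m p) (x₀ : E) (t : ℝ) {k : ℕ}
    {φ : (Fin (k + 1) → E) → ℝ≥0∞} (hφ : Measurable φ) :
    H.occupationMoment x₀ t φ ≤ ∑ j : Fin (k + 1), ENNReal.ofReal (Real.exp t) *
      H.occupationMoment x₀ t (fun z : Fin k → E => ∫⁻ y,
        greenSum p x₀ z y * φ (j.insertNth (α := fun _ => E) y z) ∂m) := by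
  set h : (Fin (k + 1) → ℝ) → ℝ≥0∞ := fun s =>
    ∫⁻ ω, extendZero φ (fun i => H.X (s i).toNNReal ω) ∂(H.P x₀) with hh
  have hm : Measurable h := Measurable.lintegral_prod_right (H.measurable_extendZero_X hφ)
  -- `A j` is the set of times whose latest one is the `j`-th
  set A : Fin (k + 1) → Set (Fin (k + 1) → ℝ) := fun j =>
    {s | ∀ l, s (j.succAbove l) ≤ s j} with hA
  have hAm : ∀ j, MeasurableSet (A j) := fun j => by
    have : A j = ⋂ l, {s | s (j.succAbove l) ≤ s j} := by ext; simp [hA]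
    rw [this]
    exact MeasurableSet.iInter fun l =>
      measurableSet_le (measurable_pi_apply _) (measurable_pi_apply _)
  have hcover : ∀ s, h s ≤ ∑ j, (A j).indicator h s := fun s => by
    obtain ⟨j, -, hj⟩ := Finset.univ.exists_max_image s Finset.univ_nonempty
    have hs : s ∈ A j := fun l => hj _ (Finset.mem_univ _)
    calc h s = (A j).indicator h s := (Set.indicator_of_mem hs h).symm
      _ ≤ _ := Finset.single_le_sum (f := fun j => (A j).indicator h s) (fun _ _ => zero_le)
        (Finset.mem_univ j)
  calc H.occupationMoment x₀ t φ = ∫⁻ s, h s ∂(cubeMeasure t (k + 1)) := rfl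
    _ ≤ ∫⁻ s, ∑ j, (A j).indicator h s ∂(cubeMeasure t (k + 1)) := lintegral_mono hcover
    _ = ∑ j, ∫⁻ s, (A j).indicator h s ∂(cubeMeasure t (k + 1)) :=
        lintegral_finsetSum _ fun j _ => hm.indicator (hAm j)
    _ ≤ _ := by
        refine Finset.sum_le_sum fun j _ => ?_
        rw [cubeMeasure, lintegral_pi_insertNth _ j (hm.indicator (hAm j)), occupationMoment,
          ← lintegral_const_mul' _ _ ENNReal.ofReal_ne_top]
        refine lintegral_mono fun r => le_trans (le_of_eq ?_)
          (lintegral_last_time_le hp x₀ t j r hφ)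
        refine lintegral_congr fun s => ?_
        have hiff : (j.insertNth (α := fun _ => ℝ) s r) ∈ A j ↔ s ∈ {s | ∀ l, r l ≤ s} := by
          simp [hA]
        by_cases hs : s ∈ {s | ∀ l, r l ≤ s}
        · rw [Set.indicator_of_mem hs, Set.indicator_of_mem (hiff.2 hs)]
        · rw [Set.indicator_of_notMem hs, Set.indicator_of_notMem (hiff.not.2 hs)]

omit [Nonempty E] [T2Space E] [LocallyCompactSpace E] [SecondCountableTopology E] [BorelSpace E]
  [SigmaFinite m] in
lemma lintegral_greenSum_pow_le (hp : H.IsTransitionDensity m p) {n : ℕ} (hn : 1 ≤ n)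
    {C : ℝ≥0∞} (hC : ∀ x, ∫⁻ y, green p x y ^ n ∂m ≤ C) (x₀ : E) {k : ℕ} (z : Fin k → E) :
    ∫⁻ y, greenSum p x₀ z y ^ n ∂m ≤ ((k + 1 : ℕ) : ℝ≥0∞) ^ n * ((k + 1 : ℕ) * C) := by
  have hgm : ∀ x, Measurable (green p x) := fun x =>
    (measurable_green hp).comp (measurable_const.prodMk measurable_id)
  calc ∫⁻ y, greenSum p x₀ z y ^ n ∂m
      ≤ ∫⁻ y, ((k + 1 : ℕ) : ℝ≥0∞) ^ n * ∑ l : Fin (k + 1),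
          green p (Fin.cons (α := fun _ => E) x₀ z l) y ^ n ∂m := by
        refine lintegral_mono fun y => ?_
        have := ENNReal.sum_pow_le_card_pow_mul_sum Finset.univ
          (fun l : Fin (k + 1) => green p (Fin.cons (α := fun _ => E) x₀ z l) y) hn
        rwa [Finset.card_univ, Fintype.card_fin] at this
    _ = ((k + 1 : ℕ) : ℝ≥0∞) ^ n * ∑ l : Fin (k + 1), ∫⁻ y,
          green p (Fin.cons (α := fun _ => E) x₀ z l) y ^ n ∂m := by
        rw [lintegral_const_mul' _ _ (by finiteness),
          lintegral_finsetSum _ fun l _ => (hgm _).pow_const n]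
    _ ≤ _ := by
        gcongr
        refine (Finset.sum_le_card_nsmul _ _ C fun l _ => hC _).trans ?_
        simp

/-- The occupation moments up to time `t` are dominated by densities in `L^n`: the recursion
bounds them by products of Green functions, whose `n`-th powers are integrated successively. -/
lemma exists_occupationMoment_le (hp : H.IsTransitionDensity m p) {n : ℕ} (hn : 1 ≤ n)
    (hgreen : (⨆ x : E, ∫⁻ y, green p x y ^ n ∂m) < ∞) (x₀ : E) (t : ℝ) (k : ℕ) :
    ∃ Γ : (Fin k → E) → ℝ≥0∞, Measurable Γ ∧
      ∫⁻ z, Γ z ^ n ∂(Measure.pi fun _ => m) ≠ ∞ ∧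
      ∀ φ : (Fin k → E) → ℝ≥0∞, Measurable φ →
        H.occupationMoment x₀ t φ ≤ ∫⁻ z, Γ z * φ z ∂(Measure.pi fun _ => m) := by
  induction k with
  | zero =>
    refine ⟨fun _ => 1, measurable_const, by simp, fun φ hφ => ?_⟩
    have hφc : ∀ z, φ z = φ default := fun z => by rw [Subsingleton.elim z default]
    have hc : ∀ w : Fin 0 → OnePoint E, extendZero φ w = φ default := fun w => by
      rw [extendZero, if_pos (fun j => j.elim0), hφc]
    simp only [occupationMoment, hc, cubeMeasure]
    simp [hφc]
  | succ k ih =>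
    obtain ⟨Γ, hΓm, hΓ, hle⟩ := ih
    set e := ENNReal.ofReal (Real.exp t)
    set Φ : Fin (k + 1) → (Fin (k + 1) → E) → ℝ≥0∞ := fun j w =>
      Γ (j.removeNth w) * greenSum p x₀ (j.removeNth w) (w j) with hΦ
    have hrm : ∀ j : Fin (k + 1), Measurable fun w : Fin (k + 1) → E =>
        (j.removeNth w : Fin k → E) := fun j =>
      measurable_pi_lambda _ fun l => measurable_pi_apply _
    have hΦm : ∀ j, Measurable (Φ j) := fun j =>
      (hΓm.comp (hrm j)).mul ((measurable_greenSum hp x₀ k).comp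
        ((hrm j).prodMk (measurable_pi_apply j)))
    have hins : ∀ (j : Fin (k + 1)) (y : E) (z : Fin k → E),
        Φ j (j.insertNth (α := fun _ => E) y z) = Γ z * greenSum p x₀ z y := fun j y z => by
      simp [hΦ]
    have hgz : ∀ z : Fin k → E, Measurable (greenSum p x₀ z) := fun z =>
      (measurable_greenSum hp x₀ k).comp (measurable_const.prodMk measurable_id)
    -- the dominating density for `k + 1` times, summed over the index `j` of the latest one
    refine ⟨fun w => ∑ j, e * Φ j w, ?_, ?_, fun φ hφ => ?_⟩
    · exact Finset.measurable_fun_sum _ fun j _ => (hΦm j).const_mul _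
    · have hΦint : ∀ j, ∫⁻ w, Φ j w ^ n ∂(Measure.pi fun _ => m) ≠ ∞ := fun j => by
        rw [lintegral_pi_insertNth _ j ((hΦm j).pow_const n)]
        set K : ℝ≥0∞ := ((k + 1 : ℕ) : ℝ≥0∞) ^ n *
          ((k + 1 : ℕ) * ⨆ x : E, ∫⁻ y, green p x y ^ n ∂m)
        have hK : K ≠ ∞ := by finiteness
        refine ne_top_of_le_ne_top (ENNReal.mul_ne_top hΓ hK) ?_
        rw [← lintegral_mul_const _ (hΓm.pow_const n)]
        refine lintegral_mono fun z => ?_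
        simp only [hins, mul_pow]
        rw [lintegral_const_mul _ ((hgz z).pow_const n)]
        gcongr
        exact lintegral_greenSum_pow_le hp hn
          (fun x => le_iSup (fun x => ∫⁻ y, green p x y ^ n ∂m) x) x₀ z
      refine ne_top_of_le_ne_top (b := ((k + 1 : ℕ) : ℝ≥0∞) ^ n * ∑ j, e ^ n *
        ∫⁻ w, Φ j w ^ n ∂(Measure.pi fun _ => m)) ?_ ?_
      · refine ENNReal.mul_ne_top (by finiteness) (ENNReal.sum_ne_top.2 fun j _ => ?_)
        exact ENNReal.mul_ne_top (ENNReal.pow_ne_top ENNReal.ofReal_ne_top) (hΦint j)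
      · simp only [← lintegral_const_mul _ ((hΦm _).pow_const n)]
        rw [← lintegral_finsetSum _ fun j _ => ((hΦm j).pow_const n).const_mul _,
          ← lintegral_const_mul' _ _ (by finiteness)]
        refine lintegral_mono fun w => ?_
        have := ENNReal.sum_pow_le_card_pow_mul_sum Finset.univ (fun j => e * Φ j w) hn
        simpa only [Finset.card_univ, Fintype.card_fin, mul_pow] using this
    · refine (occupationMoment_succ_le hp x₀ t hφ).trans ?_
      simp only [Finset.sum_mul]
      rw [lintegral_finsetSum _ fun j _ => ((hΦm j).const_mul _).fun_mul hφ]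
      refine Finset.sum_le_sum fun j _ => ?_
      have hφj : Measurable fun w : E × (Fin k → E) =>
        φ (j.insertNth (α := fun _ => E) w.1 w.2) := hφ.comp (measurable_insertNth j)
      have hψm : Measurable fun z : Fin k → E => ∫⁻ y,
          greenSum p x₀ z y * φ (j.insertNth (α := fun _ => E) y z) ∂m :=
        Measurable.lintegral_prod_right ((measurable_greenSum hp x₀ k).mul
          (hφj.comp measurable_swap))
      simp only [mul_assoc]
      rw [lintegral_const_mul _ ((hΦm j).fun_mul hφ),
        lintegral_pi_insertNth _ j ((hΦm j).fun_mul hφ)]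
      gcongr
      refine (hle _ hψm).trans (le_of_eq ?_)
      refine lintegral_congr fun z => ?_
      have hφz : Measurable fun y : E => φ (j.insertNth (α := fun _ => E) y z) :=
        hφj.comp (measurable_id.prodMk measurable_const)
      rw [← lintegral_const_mul _ ((hgz z).fun_mul hφz)]
      refine lintegral_congr fun y => ?_
      rw [hins, mul_assoc]

/-- The occupation moments up to time `t` have densities in `L^n`. -/
theorem exists_occupation_density (hp : H.IsTransitionDensity m p) {n : ℕ} (hn : 1 ≤ n)
    (hgreen : (⨆ x : E, ∫⁻ y, green p x y ^ n ∂m) < ∞) (x₀ : E) (t : ℝ) (k : ℕ) :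
    ∃ g : (Fin k → E) → ℝ≥0∞, Measurable g ∧
      ∫⁻ z, g z ^ n ∂(Measure.pi fun _ => m) ≠ ∞ ∧
      ∀ φ : (Fin k → E) → ℝ≥0∞, Measurable φ →
        H.occupationMoment x₀ t φ = ∫⁻ z, g z * φ z ∂(Measure.pi fun _ => m) := by
  obtain ⟨Γ, hΓm, hΓ, hle⟩ := exists_occupationMoment_le hp hn hgreen x₀ t k
  set Q := (cubeMeasure t k).prod (H.P x₀)
  set N : Set ((Fin k → ℝ) × Ω) :=
    {w | ∀ j, H.X (w.1 j).toNNReal w.2 ≠ OnePoint.infty}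
  have hN : MeasurableSet N := by
    have : N = ⋂ j, (fun w : (Fin k → ℝ) × Ω => H.X (w.1 j).toNNReal w.2) ⁻¹'
        {OnePoint.infty}ᶜ := by
      ext w; simp [N]
    rw [this]
    exact MeasurableSet.iInter fun j =>
      ((measurable_pi_apply j).comp (H.measurable_X_tuple k)) measurableSet_onePoint_infty.compl
  have hR : Measurable fun w : (Fin k → ℝ) × Ω => fun j =>
      onePointRetract (H.X (w.1 j).toNNReal w.2) :=
    measurable_pi_lambda _ fun j => measurable_onePointRetract.comp
      ((measurable_pi_apply j).comp (H.measurable_X_tuple k))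
  -- the occupation measure on `E^k`: the image of `ds ⊗ P_{x₀}` on the set where all `k` positions
  -- lie in `E`
  set Λ := (Q.restrict N).map fun w : (Fin k → ℝ) × Ω => fun j =>
      onePointRetract (H.X (w.1 j).toNNReal w.2)
  have hΛ : ∀ φ : (Fin k → E) → ℝ≥0∞, Measurable φ →
      ∫⁻ z, φ z ∂Λ = H.occupationMoment x₀ t φ := fun φ hφ => by
    rw [lintegral_map hφ hR, ← lintegral_indicator hN, occupationMoment,
      lintegral_lintegral (H.measurable_extendZero_X hφ).aemeasurable]
    refine lintegral_congr fun w => ?_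
    by_cases hw : w ∈ N
    · rw [Set.indicator_of_mem hw]
      exact (if_pos hw).symm
    · rw [Set.indicator_of_notMem hw]
      exact (if_neg hw).symm
  have hΛle : Λ ≤ (Measure.pi fun _ => m).withDensity Γ := by
    refine Measure.le_iff.2 fun B hB => ?_
    rw [← lintegral_indicator_one hB, hΛ _ (measurable_one.indicator hB)]
    refine (hle _ (measurable_one.indicator hB)).trans (le_of_eq ?_)
    rw [withDensity_apply _ hB, ← lintegral_indicator hB]
    refine lintegral_congr fun z => ?_
    by_cases hz : z ∈ B <;> simp [hz]
  have hac : Λ ≪ Measure.pi fun _ => m :=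
    (Measure.absolutelyContinuous_of_le hΛle).trans (withDensity_absolutelyContinuous _ _)
  have hd := Measure.withDensity_rnDeriv_eq Λ (Measure.pi fun _ => m) hac
  have hgm := Measure.measurable_rnDeriv Λ (Measure.pi fun _ => m)
  refine ⟨Λ.rnDeriv (Measure.pi fun _ => m), hgm, ?_, fun φ hφ => ?_⟩
  · have hae : Λ.rnDeriv (Measure.pi fun _ => m) ≤ᵐ[Measure.pi fun _ => m] Γ := by
      refine ae_le_of_forall_setLIntegral_le_of_sigmaFinite hgm fun s hs _ => ?_
      rw [← withDensity_apply _ hs, hd, ← withDensity_apply _ hs]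
      exact hΛle s
    refine ne_top_of_le_ne_top hΓ (lintegral_mono_ae ?_)
    filter_upwards [hae] with z hz
    gcongr
  · rw [← hΛ φ hφ]
    conv_lhs => rw [← hd]
    exact lintegral_withDensity_eq_lintegral_mul _ hgm hφ

end HuntProcess

/-! ### Survival with positive probability -/

namespace HuntProcess

variable {E Ω : Type*} [TopologicalSpace E] [MeasurableSpace Ω] {H : HuntProcess E Ω}

lemma lt_lifetime_iff {t : ℝ} (ω : Ω) :
    ENNReal.ofReal t < H.lifetime ω ↔ H.X t.toNNReal ω ≠ OnePoint.infty := by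
  constructor
  · intro h hX
    exact absurd (iInf₂_le (f := fun (s : ℝ≥0) (_ : H.X s ω = OnePoint.infty) => (s : ℝ≥0∞))
      t.toNNReal hX) (not_le.2 h)
  · intro hX
    have hopen : {OnePoint.infty}ᶜ ∈ 𝓝 (H.X t.toNNReal ω) :=
      OnePoint.isClosed_infty.isOpen_compl.mem_nhds hX
    have hev := (H.right_continuous ω t.toNNReal).eventually_mem hopen
    obtain ⟨b, hb, hsub⟩ := mem_nhdsGE_iff_exists_Ico_subset.1 hev
    refine lt_of_lt_of_le (b := (b : ℝ≥0∞)) (ENNReal.coe_lt_coe.2 hb) (le_iInf₂ fun s hs => ?_)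
    by_contra hlt
    have hsb : s < b := by exact_mod_cast not_le.1 hlt
    rcases le_or_gt t.toNNReal s with h | h
    · exact hsub ⟨h, hsb⟩ hs
    · exact hX (H.absorbing ω s _ h.le hs)

lemma measurableSet_alive (t : ℝ) :
    MeasurableSet {ω | ENNReal.ofReal t < H.lifetime ω} := by
  simp only [lt_lifetime_iff]
  exact (H.measurable_X _ measurableSet_onePoint_infty).compl

variable [MeasurableSpace E] [BorelSpace E]

lemma P_alive_eq (x : E) (t : ℝ) :
    H.P x {ω | ENNReal.ofReal t < H.lifetime ω} = H.transition t.toNNReal x Set.univ := by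
  rw [transition_apply _ _ MeasurableSet.univ]
  congr 1
  ext ω
  rw [Set.mem_ofPred_eq, lt_lifetime_iff, Set.image_univ, Set.mem_preimage,
    ← OnePoint.compl_infty]
  rfl

/-- The Chapman–Kolmogorov equation. -/
lemma chapman_kolmogorov [Nonempty E] (s r : ℝ≥0) (x : E) {φ : E → ℝ≥0∞} (hφ : Measurable φ)
    (hm : Measurable fun z => ∫⁻ y, φ y ∂(H.transition r z)) :
    ∫⁻ y, φ y ∂(H.transition (s + r) x) =
      ∫⁻ z, ∫⁻ y, φ y ∂(H.transition r z) ∂(H.transition s x) := by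
  have hφ' : Measurable fun y : OnePoint E => y.elim 0 φ :=
    measurable_onePoint_elim (φ := fun _ => φ) measurable_id (hφ.comp measurable_snd)
  rw [lintegral_transition _ _ hφ, lintegral_transition _ _ hm, lawAt_apply,
    lintegral_map hφ' (H.measurable_X _)]
  have h := H.lintegral_markov s r x (V := fun _ => ()) measurable_const
    (G := fun w => w.2.elim 0 φ) (hφ'.comp measurable_snd)
  refine h.trans ?_
  have hm' : Measurable fun z : OnePoint E => z.elim 0 fun z => ∫⁻ y, φ y ∂(H.transition r z) :=
    measurable_onePoint_elim (φ := fun _ z => ∫⁻ y, φ y ∂(H.transition r z)) measurable_id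
      (hm.comp measurable_snd)
  rw [lawAt_apply, lintegral_map hm' (H.measurable_X _)]
  refine lintegral_congr fun ω => ?_
  induction H.X s ω using OnePoint.rec with
  | infty =>
    rw [OnePoint.elim_infty]
    refine (lintegral_congr_ae ?_).trans (lintegral_zero (μ := H.lawAt r OnePoint.infty))
    filter_upwards [H.lawAt_infty r] with y hy
    rw [hy]; rfl
  | coe z => exact (lintegral_transition r z hφ).symm

variable {m : Measure E} [SigmaFinite m] {p : ℝ → E → E → ℝ≥0∞}

omit [BorelSpace E] in
lemma IsTransitionDensity.measurable_transition (hp : H.IsTransitionDensity m p) {t : ℝ}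
    (ht : 0 < t) {B : Set E} (hB : MeasurableSet B) :
    Measurable fun x => H.transition t.toNNReal x B := by
  simp only [← hp.setLIntegral_eq ht _ hB]
  exact Measurable.lintegral_prod_right (hp.measurable_slice t)

/-- If a set `B` is not charged from `B` at time `2u`, it is not charged from `B` at time `u`,
since `∫_B P_{2u} 1_B dm = ∫ (P_u 1_B)² dm` by symmetry. -/
lemma lintegral_transition_half_eq_zero [Nonempty E] (hp : H.IsTransitionDensity m p)
    (hsymm : H.IsSymmetric m) {u : ℝ} (hu : 0 < u) {B : Set E} (hB : MeasurableSet B)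
    (h : ∫⁻ z in B, H.transition (u + u).toNNReal z B ∂m = 0) :
    ∫⁻ z in B, H.transition u.toNNReal z B ∂m = 0 := by
  have hm := hp.measurable_transition hu hB
  have hind : ∀ z, ∫⁻ y, B.indicator 1 y ∂(H.transition u.toNNReal z) =
      H.transition u.toNNReal z B := fun z => lintegral_indicator_one hB
  have hs := hsymm u.toNNReal (B.indicator 1) (fun z => H.transition u.toNNReal z B)
    (measurable_one.indicator hB) hm
  simp only [hind] at hs
  have hck : ∀ x, ∫⁻ y, H.transition u.toNNReal y B ∂(H.transition u.toNNReal x) =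
      H.transition (u + u).toNNReal x B := fun x => by
    rw [Real.toNNReal_add hu.le hu.le, ← lintegral_indicator_one hB,
      chapman_kolmogorov _ _ x (measurable_one.indicator hB) (by simpa only [hind] using hm)]
    simp only [hind]
  have h0 : ∫⁻ x, H.transition u.toNNReal x B * H.transition u.toNNReal x B ∂m = 0 := by
    rw [← hs, ← h, ← lintegral_indicator hB]
    refine lintegral_congr fun x => ?_
    rw [hck]
    by_cases hx : x ∈ B <;> simp [hx]
  rw [lintegral_eq_zero_iff (hm.fun_mul hm)] at h0
  refine le_antisymm ((setLIntegral_le_lintegral _ _).trans (le_of_eq ?_)) zero_le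
  rw [lintegral_eq_zero_iff hm]
  filter_upwards [h0] with x hx
  exact mul_self_eq_zero.1 hx

/-- A symmetric Hunt process with transition densities survives up to any given time with
positive probability.  Otherwise some set `B` of positive finite measure is not charged from `B`
at some positive time, hence by iterated halving at arbitrarily small times, against the strong
continuity of the semigroup. -/
theorem P_alive_pos [T2Space E] [LocallyCompactSpace E] [SecondCountableTopology E] [m.Regular]
    (hp : H.IsTransitionDensity m p) (hsymm : H.IsSymmetric m) (x : E) {t : ℝ} (ht : 0 < t) :
    0 < H.P x {ω | ENNReal.ofReal t < H.lifetime ω} := by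
  have : Nonempty E := ⟨x⟩
  rw [P_alive_eq, pos_iff_ne_zero]
  intro h0
  obtain ⟨s, hs1, hs0, hst⟩ : ∃ s : ℝ, H.transition s.toNNReal x Set.univ ≠ 0 ∧ 0 < s ∧ s < t := by
    have h1 := (tendsto_transition_one (H := H) x isOpen_univ (Set.mem_univ x)).eventually_ne
      one_ne_zero
    have h2 : ∀ᶠ s : ℝ in 𝓝[>] 0, 0 < s ∧ s < t := Ioo_mem_nhdsGT ht
    exact (h1.and h2).exists
  -- almost surely under `p_s(x, ·)` the remaining time `r` is not survived, so the set `A` of points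
  -- from which it is not survived is not negligible
  set r := t - s with hr
  have hr0 : 0 < r := sub_pos.2 hst
  have hh := hp.measurable_transition hr0 MeasurableSet.univ
  have hck : ∫⁻ z, p s x z * H.transition r.toNNReal z Set.univ ∂m = 0 := by
    rw [← hp.lintegral_eq hs0 x hh, ← h0, show t = s + r by ring,
      Real.toNNReal_add hs0.le hr0.le, ← lintegral_one,
      chapman_kolmogorov _ _ x measurable_const (by simpa only [lintegral_one] using hh)]
    simp
  rw [lintegral_eq_zero_iff ((hp.measurable_right s x).fun_mul hh)] at hck
  set A := {z | H.transition r.toNNReal z Set.univ = 0} with hA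
  have hAm : MeasurableSet A := hh (measurableSet_singleton 0)
  have hmA : 0 < m A := by
    rw [pos_iff_ne_zero]
    intro hmA
    apply hs1
    rw [← hp.setLIntegral_eq hs0 x MeasurableSet.univ, setLIntegral_univ,
      lintegral_eq_zero_iff (hp.measurable_right s x)]
    have hAc : ∀ᵐ z ∂m, z ∉ A := measure_eq_zero_iff_ae_notMem.1 hmA
    filter_upwards [hck, hAc] with z hz hzA
    exact (mul_eq_zero.1 hz).resolve_right hzA
  obtain ⟨B, hBm, hBA, hB0, hBfin⟩ := Measure.exists_subset_measure_lt_top hAm hmA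
  have hzero : ∀ k : ℕ, ∫⁻ z in B, H.transition (r / 2 ^ k).toNNReal z B ∂m = 0 := by
    intro k
    induction k with
    | zero =>
      rw [← lintegral_zero (μ := m.restrict B)]
      refine setLIntegral_congr_fun hBm fun z hz => ?_
      simp only [pow_zero, div_one]
      exact measure_mono_null (Set.subset_univ _) (hBA hz)
    | succ k ih =>
      refine lintegral_transition_half_eq_zero hp hsymm (by positivity) hBm ?_
      rwa [show r / 2 ^ (k + 1) + r / 2 ^ (k + 1) = r / 2 ^ k by field_simp; ring]
  have hlim := (hp.isApproxIdentity hsymm).tendsto_lintegral_absDiff_smoothing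
    (g := B.indicator 1) (measurable_one.indicator hBm) le_rfl (by
      have : ∀ z, (B.indicator 1 z : ℝ≥0∞) ^ 2 = B.indicator 1 z := fun z => by
        by_cases hz : z ∈ B <;> simp [hz]
      simp only [this]
      rw [lintegral_indicator_one hBm]
      exact hBfin.ne)
  have hseq : Tendsto (fun k : ℕ => r / 2 ^ k) atTop (𝓝[>] 0) := by
    refine tendsto_nhdsWithin_iff.2 ⟨?_, Eventually.of_forall fun k => by
      rw [Set.mem_Ioi]; positivity⟩
    simpa using tendsto_const_nhds.div_atTop (tendsto_pow_atTop_atTop_of_one_lt one_lt_two)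
  have hle := ge_of_tendsto' (hlim.comp hseq) (b := m B) fun k => by
    have hε : 0 < r / 2 ^ k := by positivity
    have hds := hp.isDoublySubstochastic hsymm hε
    have hsm := hds.measurable_smoothing (g := B.indicator 1) (measurable_one.indicator hBm)
    have h1 : ∫⁻ y in B, smoothing m (p (r / 2 ^ k)) (B.indicator 1) y ∂m = 0 := by
      rw [← hzero k]
      simp only [smoothing]
      have e : ∀ y, ∫⁻ z, p (r / 2 ^ k) z y * B.indicator 1 z ∂m =
          ∫⁻ z in B, p (r / 2 ^ k) z y ∂m := fun y => by
        rw [← lintegral_indicator hBm]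
        refine lintegral_congr fun z => ?_
        by_cases hz : z ∈ B <;> simp [hz]
      simp only [e]
      refine (lintegral_lintegral_swap (f := fun y z => p (r / 2 ^ k) z y)
        (hds.measurable.comp measurable_swap).aemeasurable).trans ?_
      exact lintegral_congr fun z => hp.setLIntegral_eq hε z hBm
    rw [lintegral_eq_zero_iff hsm] at h1
    calc m B = ∫⁻ y in B, 1 ∂m := by simp
      _ ≤ ∫⁻ y in B, absDiff (smoothing m (p (r / 2 ^ k)) (B.indicator 1) y)
            (B.indicator 1 y) ^ 2 ∂m := by
          refine lintegral_mono_ae ?_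
          filter_upwards [h1, ae_restrict_mem hBm] with y hy hyB
          rw [hy]
          simp [absDiff, hyB]
      _ ≤ _ := setLIntegral_le_lintegral _ _
  exact absurd hle (not_le.2 hB0)

end HuntProcess

/-! ### Hölder's inequality for finite products -/

section Holder

variable {Z : Type*} [MeasurableSpace Z] {ν : Measure Z}

lemma lintegral_prod_le_prod_lintegral_pow {n : ℕ} (hn : 1 ≤ n) {f : Fin n → Z → ℝ≥0∞}
    (hf : ∀ i, Measurable (f i)) :
    ∫⁻ z, ∏ i, f i z ∂ν ≤ ∏ i, (∫⁻ z, f i z ^ n ∂ν) ^ (1 / (n : ℝ)) := by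
  have hn0 : (n : ℝ) ≠ 0 := by positivity
  have h := ENNReal.lintegral_prod_norm_pow_le (μ := ν) Finset.univ
    (f := fun i z => f i z ^ n) (fun i _ => ((hf i).pow_const n).aemeasurable)
    (p := fun _ => 1 / (n : ℝ)) (by simp [hn0]) (fun _ _ => by positivity)
  refine le_trans (le_of_eq ?_) h
  refine lintegral_congr fun z => Finset.prod_congr rfl fun i _ => ?_
  rw [← ENNReal.rpow_natCast, ← ENNReal.rpow_mul, mul_one_div_cancel hn0, ENNReal.rpow_one]

/-- If `n` sequences of functions converge in `L^n`, without increase of the norms, then their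
products converge in `L^1`, also against a bounded weight. -/
lemma tendsto_lintegral_mul_prod {ι : Type*} {l : Filter ι} {n : ℕ} (hn : 1 ≤ n)
    {S : ι → Fin n → Z → ℝ≥0∞} {g : Fin n → Z → ℝ≥0∞} {Φ : Z → ℝ≥0∞} {B : ℝ≥0∞}
    (hS : ∀ᶠ a in l, ∀ i, Measurable (S a i)) (hg : ∀ i, Measurable (g i)) (hΦ : Measurable Φ)
    (hB : B ≠ ∞) (hΦB : ∀ z, Φ z ≤ B) (hint : ∀ i, ∫⁻ z, g i z ^ n ∂ν ≠ ∞)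
    (hle : ∀ᶠ a in l, ∀ i, ∫⁻ z, S a i z ^ n ∂ν ≤ ∫⁻ z, g i z ^ n ∂ν)
    (hlim : ∀ i, Tendsto (fun a => ∫⁻ z, absDiff (S a i z) (g i z) ^ n ∂ν) l (𝓝 0)) :
    Tendsto (fun a => ∫⁻ z, Φ z * ∏ i, S a i z ∂ν) l (𝓝 (∫⁻ z, Φ z * ∏ i, g i z ∂ν)) := by
  have hn0 : (n : ℝ) ≠ 0 := by positivity
  have hinv : (0 : ℝ) < 1 / (n : ℝ) := by positivity
  -- `K i` bounds the `L^n`-norm of `S a i + g i`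
  set K : Fin n → ℝ≥0∞ := fun i => (2 ^ n * (∫⁻ z, g i z ^ n ∂ν + ∫⁻ z, g i z ^ n ∂ν)) ^
    (1 / (n : ℝ)) with hK
  have hKfin : ∀ i, K i ≠ ∞ := fun i => ENNReal.rpow_ne_top_of_nonneg hinv.le
    (ENNReal.mul_ne_top (by finiteness) (ENNReal.add_ne_top.2 ⟨hint i, hint i⟩))
  have hfin : ∫⁻ z, Φ z * ∏ i, g i z ∂ν ≠ ∞ := by
    refine ne_top_of_le_ne_top (b := B * ∏ i, (∫⁻ z, g i z ^ n ∂ν) ^ (1 / (n : ℝ))) ?_ ?_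
    · exact ENNReal.mul_ne_top hB (ENNReal.prod_ne_top fun i _ =>
        ENNReal.rpow_ne_top_of_nonneg hinv.le (hint i))
    · calc ∫⁻ z, Φ z * ∏ i, g i z ∂ν ≤ ∫⁻ z, B * ∏ i, g i z ∂ν := by
            gcongr with z
            exact hΦB z
        _ = B * ∫⁻ z, ∏ i, g i z ∂ν := lintegral_const_mul' _ _ hB
        _ ≤ _ := by
            gcongr
            exact lintegral_prod_le_prod_lintegral_pow hn hg
  refine tendsto_of_absDiff_tendsto_zero hfin ?_
  have hbound : Tendsto (fun a => B * ∑ i, (∫⁻ z, absDiff (S a i z) (g i z) ^ n ∂ν) ^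
      (1 / (n : ℝ)) * ∏ j ∈ Finset.univ.erase i, K j) l (𝓝 0) := by
    have h1 : ∀ i, Tendsto (fun a => (∫⁻ z, absDiff (S a i z) (g i z) ^ n ∂ν) ^
        (1 / (n : ℝ)) * ∏ j ∈ Finset.univ.erase i, K j) l (𝓝 0) := fun i => by
      have h2 := (ENNReal.continuous_rpow_const (y := 1 / (n : ℝ))).tendsto 0 |>.comp (hlim i)
      rw [ENNReal.zero_rpow_of_pos hinv] at h2
      have h3 := ENNReal.Tendsto.mul_const (b := ∏ j ∈ Finset.univ.erase i, K j) h2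
        (Or.inr (ENNReal.prod_ne_top fun j _ => hKfin j))
      rwa [zero_mul] at h3
    have h4 := ENNReal.Tendsto.const_mul (a := B)
      (tendsto_finsetSum Finset.univ fun i _ => h1 i) (Or.inr hB)
    simpa using h4
  refine tendsto_of_tendsto_of_tendsto_of_le_of_le' tendsto_const_nhds hbound
    (Eventually.of_forall fun _ => zero_le) ?_
  filter_upwards [hS, hle] with a hSa hlea
  have hpm : Measurable fun z => ∏ i, S a i z := Finset.measurable_fun_prod _ fun i _ => hSa i
  have hgm : Measurable fun z => ∏ i, g i z := Finset.measurable_fun_prod _ fun i _ => hg i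
  calc absDiff (∫⁻ z, Φ z * ∏ i, S a i z ∂ν) (∫⁻ z, Φ z * ∏ i, g i z ∂ν)
      ≤ ∫⁻ z, absDiff (Φ z * ∏ i, S a i z) (Φ z * ∏ i, g i z) ∂ν :=
        absDiff_lintegral_le (hΦ.mul hpm) (hΦ.mul hgm)
    _ ≤ ∫⁻ z, B * ∑ i, absDiff (S a i z) (g i z) *
          ∏ j ∈ Finset.univ.erase i, (S a j z + g j z) ∂ν := by
        refine lintegral_mono fun z => (absDiff_mul_left_le _ _ _).trans ?_
        gcongr
        · exact hΦB z
        · exact absDiff_prod_le _ _ _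
    _ = B * ∑ i, ∫⁻ z, absDiff (S a i z) (g i z) *
          ∏ j ∈ Finset.univ.erase i, (S a j z + g j z) ∂ν := by
        rw [lintegral_const_mul' _ _ hB, lintegral_finsetSum]
        intro i _
        exact ((hSa i).absDiff (hg i)).mul
          (Finset.measurable_fun_prod _ fun j _ => (hSa j).add (hg j))
    _ ≤ _ := by
        gcongr with i
        have h := lintegral_prod_le_prod_lintegral_pow (ν := ν) hn
          (f := fun j z => if j = i then absDiff (S a i z) (g i z) else S a j z + g j z)
          (fun j => by
            by_cases hj : j = i
            · simp only [hj, if_true]; exact (hSa i).absDiff (hg i)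
            · simp only [hj, if_false]; exact (hSa j).add (hg j))
        have hsplit : ∀ c : Fin n → ℝ≥0∞, ∏ j, c j = c i * ∏ j ∈ Finset.univ.erase i, c j :=
          fun c => (Finset.mul_prod_erase _ _ (Finset.mem_univ i)).symm
        simp only [hsplit, if_true] at h
        refine le_trans (le_of_eq (lintegral_congr fun z => ?_)) (h.trans ?_)
        · congr 1
          exact Finset.prod_congr rfl fun j hj => by rw [if_neg (Finset.ne_of_mem_erase hj)]
        · refine mul_le_mul_right (Finset.prod_le_prod' fun j hj => ?_) _
          simp only [if_neg (Finset.ne_of_mem_erase hj)]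
          refine ENNReal.rpow_le_rpow ((lintegral_add_pow_le (hSa j) n).trans ?_) hinv.le
          gcongr _ * (?_ + _)
          exact hlea j

/-- The Cauchy–Schwarz inequality, bounding the `k`-th moment through the second one. -/
lemma lintegral_pow_le_sqrt_mul_sqrt {f : Z → ℝ≥0∞} (hf : Measurable f) {k : ℕ} (hk : 1 ≤ k) :
    ∫⁻ z, f z ^ k ∂ν ≤
      (∫⁻ z, f z ^ 2 ∂ν) ^ (1 / (2 : ℝ)) * (∫⁻ z, f z ^ (2 * (k - 1)) ∂ν) ^ (1 / (2 : ℝ)) := by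
  have h := lintegral_prod_le_prod_lintegral_pow (ν := ν) one_le_two
    (f := ![f, fun z => f z ^ (k - 1)]) (fun i => by
      fin_cases i
      · exact hf
      · exact hf.pow_const _)
  simp only [Fin.prod_univ_two, Matrix.cons_val_zero, Matrix.cons_val_one, ← pow_mul,
    Nat.cast_ofNat] at h
  refine le_trans (le_of_eq (lintegral_congr fun z => ?_)) (h.trans (le_of_eq ?_))
  · rw [← pow_succ', Nat.sub_add_cancel hk]
  · simp only [mul_comm]

end Holder

/-! ### Moments of the approximated intersection measures -/

section LocalDensity

variable {E Ω : Type*} [TopologicalSpace E] [MeasurableSpace Ω]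

/-- The mollified local time `∫₀ᵗ p_ε(X_s, x) ds`. -/
noncomputable def HuntProcess.localDensity (H : HuntProcess E Ω) (p : ℝ → E → E → ℝ≥0∞) (t ε : ℝ) (ω : Ω)
    (x : E) : ℝ≥0∞ :=
  ∫⁻ s in Set.Icc 0 t, (H.X s.toNNReal ω).elim 0 fun z => p ε z x

variable [Nonempty E] [T2Space E] [LocallyCompactSpace E] [SecondCountableTopology E]
  [MeasurableSpace E] [BorelSpace E] {H : HuntProcess E Ω} {m : Measure E}
  {p : ℝ → E → E → ℝ≥0∞}

lemma measurable_kernel_along_path (hp : H.IsTransitionDensity m p) (ε : ℝ) :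
    Measurable fun w : (Ω × E) × ℝ => (H.X w.2.toNNReal w.1.1).elim 0 fun z => p ε z w.1.2 := by
  have h1 : Measurable fun w : (Ω × E) × ℝ => (w.2.toNNReal, w.1.1) := by fun_prop
  have h2 : Measurable fun v : ((Ω × E) × ℝ) × E => (v.2, v.1.1.2) := by fun_prop
  exact measurable_onePoint_elim (φ := fun (w : (Ω × E) × ℝ) z => p ε z w.1.2)
    (H.measurable_X_uncurry.comp h1) ((hp.measurable_slice ε).comp h2)

lemma measurable_localDensity (hp : H.IsTransitionDensity m p) (t ε : ℝ) :
    Measurable fun w : Ω × E => H.localDensity p t ε w.1 w.2 :=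
  Measurable.lintegral_prod_right (measurable_kernel_along_path hp ε)

/-- The joint moments of the mollified local times are smoothings of the occupation density. -/
lemma lintegral_prod_localDensity [SigmaFinite m] (hp : H.IsTransitionDensity m p) (x₀ : E)
    (t : ℝ) {k : ℕ} {g : (Fin k → E) → ℝ≥0∞}
    (hg : ∀ φ : (Fin k → E) → ℝ≥0∞, Measurable φ →
        H.occupationMoment x₀ t φ = ∫⁻ z, g z * φ z ∂(Measure.pi fun _ => m))
    (ε : Fin k → ℝ) (x : Fin k → E) :
    ∫⁻ ω, ∏ j, H.localDensity p t (ε j) ω (x j) ∂(H.P x₀) =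
      smoothing (Measure.pi fun _ => m) (piKernel fun j => p (ε j)) g x := by
  have hφ : Measurable fun z : Fin k → E => piKernel (fun j => p (ε j)) z x := by
    refine Finset.measurable_fun_prod _ fun j _ => ?_
    have h1 : Measurable fun z : Fin k → E => (z j, x j) := by fun_prop
    exact (hp.measurable_slice (ε j)).comp h1
  have hprod : ∀ w : Fin k → OnePoint E, ∏ j, (w j).elim 0 (fun z => p (ε j) z (x j)) =
      extendZero (fun z => piKernel (fun j => p (ε j)) z x) w := fun w => by
    by_cases hw : ∀ j, w j ≠ OnePoint.infty
    · rw [extendZero, if_pos hw]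
      refine Finset.prod_congr rfl fun j _ => ?_
      rw [onePoint_elim_zero, if_neg (hw j)]
    · push Not at hw
      obtain ⟨j, hj⟩ := hw
      rw [extendZero_of_exists _ hj]
      exact Finset.prod_eq_zero (Finset.mem_univ j) (by rw [hj]; rfl)
  calc ∫⁻ ω, ∏ j, H.localDensity p t (ε j) ω (x j) ∂(H.P x₀)
      = ∫⁻ ω, ∫⁻ s, extendZero (fun z => piKernel (fun j => p (ε j)) z x)
          (fun j => H.X (s j).toNNReal ω) ∂(cubeMeasure t k) ∂(H.P x₀) := by
        refine lintegral_congr fun ω => ?_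
        simp only [← hprod]
        rw [cubeMeasure]
        refine (lintegral_pi_prod _ (fun j (s : ℝ) => (H.X s.toNNReal ω).elim 0
          fun z => p (ε j) z (x j)) fun j => ?_).symm
        exact (measurable_kernel_along_path hp (ε j)).comp
          (measurable_const (a := (ω, x j)) |>.prodMk measurable_id)
    _ = H.occupationMoment x₀ t (fun z => piKernel (fun j => p (ε j)) z x) :=
        lintegral_lintegral_swap ((H.measurable_extendZero_X hφ).comp
          measurable_swap).aemeasurable
    _ = _ := by
        rw [hg _ hφ]
        exact lintegral_congr fun z => mul_comm _ _

end LocalDensity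

section Moments

variable {E : Type*} [TopologicalSpace E] [T2Space E] [LocallyCompactSpace E]
  [SecondCountableTopology E] [MeasurableSpace E] [BorelSpace E] [Nonempty E]
  {m : Measure E} [SigmaFinite m] {n : ℕ}
  {Ω' : Fin n → Type*} [∀ i, MeasurableSpace (Ω' i)] {H : ∀ i, HuntProcess E (Ω' i)}
  {p : Fin n → ℝ → E → E → ℝ≥0∞} {Ω : Type*} [MeasurableSpace Ω] {Y : ∀ i, Ω → Ω' i}

omit [SigmaFinite m] [MeasurableSpace Ω] in
lemma lintegral_approxIntersection (hp : ∀ i, (H i).IsTransitionDensity m (p i)) (t ε : ℝ)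
    (ω : Ω) {F : E → ℝ≥0∞} (hF : Measurable F) :
    ∫⁻ x, F x ∂(approxIntersection H Y m p ε t ω) =
      ∫⁻ x, F x * ∏ i, (H i).localDensity (p i) t ε (Y i ω) x ∂m := by
  have hd : ∀ x, ∫⁻ s in Set.univ.pi fun _ : Fin n => Set.Icc (0 : ℝ) t,
      ∏ i, ((H i).X (s i).toNNReal (Y i ω)).elim 0 (fun z => p i ε z x) =
      ∏ i, (H i).localDensity (p i) t ε (Y i ω) x := fun x => by
    rw [volume_pi, Measure.restrict_pi_pi]
    exact lintegral_pi_prod _ (fun i (s : ℝ) => ((H i).X s.toNNReal (Y i ω)).elim 0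
      fun z => p i ε z x) fun i => (measurable_kernel_along_path (hp i) ε).comp
        (measurable_const (a := (Y i ω, x)) |>.prodMk measurable_id)
  have hm : Measurable fun x => ∏ i, (H i).localDensity (p i) t ε (Y i ω) x :=
    Finset.measurable_fun_prod _ fun i _ => (measurable_localDensity (hp i) t ε).comp
      (measurable_const.prodMk measurable_id)
  simp only [approxIntersection, hd]
  rw [lintegral_withDensity_eq_lintegral_mul _ hm hF]
  exact lintegral_congr fun x => mul_comm _ _

omit [SigmaFinite m] in
lemma measurable_prod_localDensity (hp : ∀ i, (H i).IsTransitionDensity m (p i))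
    (hY : ∀ i, Measurable (Y i)) (t ε : ℝ) :
    Measurable fun w : Ω × E => ∏ i, (H i).localDensity (p i) t ε (Y i w.1) w.2 :=
  Finset.measurable_fun_prod _ fun i _ => (measurable_localDensity (hp i) t ε).comp
    (((hY i).comp measurable_fst).prodMk measurable_snd)

lemma measurable_lintegral_approxIntersection (hp : ∀ i, (H i).IsTransitionDensity m (p i))
    (hY : ∀ i, Measurable (Y i)) (t ε : ℝ) {F : E → ℝ≥0∞} (hF : Measurable F) :
    Measurable fun ω => ∫⁻ x, F x ∂(approxIntersection H Y m p ε t ω) := by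
  simp only [lintegral_approxIntersection hp t ε _ hF]
  exact Measurable.lintegral_prod_right
    ((hF.comp measurable_snd).mul (measurable_prod_localDensity hp hY t ε))

variable {μ : Measure Ω} [IsProbabilityMeasure μ] {x₀ : Fin n → E}

/-- The joint moments of the approximated intersection measures: by independence they are
integrals of products over the processes of smoothed occupation densities. -/
lemma lintegral_prod_approxIntersection (hp : ∀ i, (H i).IsTransitionDensity m (p i))
    (hY : ∀ i, MeasurePreserving (Y i) μ ((H i).P (x₀ i : OnePoint E)))
    (hindep : iIndepFun Y μ) (t : ℝ) {k : ℕ} {g : Fin n → (Fin k → E) → ℝ≥0∞}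
    (hg : ∀ i, ∀ φ : (Fin k → E) → ℝ≥0∞, Measurable φ →
        (H i).occupationMoment (x₀ i) t φ = ∫⁻ z, g i z * φ z ∂(Measure.pi fun _ => m))
    {F : E → ℝ≥0∞} (hF : Measurable F) (ε : Fin k → ℝ) :
    ∫⁻ ω, ∏ j, ∫⁻ x, F x ∂(approxIntersection H Y m p (ε j) t ω) ∂μ =
      ∫⁻ x : Fin k → E, (∏ j, F (x j)) * ∏ i, smoothing (Measure.pi fun _ => m)
        (piKernel fun j => p i (ε j)) (g i) x ∂(Measure.pi fun _ => m) := by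
  have hYm : ∀ i, Measurable (Y i) := fun i => (hY i).measurable
  have hL : ∀ j, Measurable fun w : Ω × E =>
      F w.2 * ∏ i, (H i).localDensity (p i) t (ε j) (Y i w.1) w.2 := fun j =>
    (hF.comp measurable_snd).mul (measurable_prod_localDensity hp hYm t (ε j))
  have hW : ∀ (i : Fin n) (x : Fin k → E), Measurable fun ω' : Ω' i =>
      ∏ j, (H i).localDensity (p i) t (ε j) ω' (x j) := fun i x =>
    Finset.measurable_fun_prod _ fun j _ => (measurable_localDensity (hp i) t (ε j)).comp
      (measurable_id.prodMk measurable_const)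
  calc ∫⁻ ω, ∏ j, ∫⁻ x, F x ∂(approxIntersection H Y m p (ε j) t ω) ∂μ
      = ∫⁻ ω, (∫⁻ x : Fin k → E, ∏ j, (F (x j) *
          ∏ i, (H i).localDensity (p i) t (ε j) (Y i ω) (x j)) ∂(Measure.pi fun _ => m)) ∂μ := by
        refine lintegral_congr fun ω => ?_
        simp only [lintegral_approxIntersection hp t _ ω hF]
        exact (lintegral_pi_prod _ (fun j x => F x *
          ∏ i, (H i).localDensity (p i) t (ε j) (Y i ω) x) fun j =>
            (hL j).comp (measurable_const.prodMk measurable_id)).symm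
    _ = ∫⁻ x : Fin k → E, (∫⁻ ω, ∏ j, (F (x j) *
          ∏ i, (H i).localDensity (p i) t (ε j) (Y i ω) (x j)) ∂μ) ∂(Measure.pi fun _ => m) := by
        refine lintegral_lintegral_swap (Measurable.aemeasurable ?_)
        refine Finset.measurable_fun_prod _ fun j _ => ?_
        have h1 : Measurable fun w : Ω × (Fin k → E) => (w.1, w.2 j) := by fun_prop
        exact (hL j).comp h1
    _ = _ := by
        refine lintegral_congr fun x => ?_
        have e : ∀ ω, ∏ j, (F (x j) * ∏ i, (H i).localDensity (p i) t (ε j) (Y i ω) (x j)) =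
            (∏ j, F (x j)) * ∏ i, ∏ j, (H i).localDensity (p i) t (ε j) (Y i ω) (x j) :=
          fun ω => by rw [Finset.prod_mul_distrib, Finset.prod_comm]
        simp only [e]
        have hWY : ∀ i, Measurable fun ω =>
            ∏ j, (H i).localDensity (p i) t (ε j) (Y i ω) (x j) := fun i => (hW i x).comp (hYm i)
        rw [lintegral_const_mul _ (Finset.measurable_fun_prod _ fun i _ => hWY i)]
        congr 1
        rw [lintegral_prod_eq_prod_lintegral_of_indepFun Finset.univ
          (fun i ω => ∏ j, (H i).localDensity (p i) t (ε j) (Y i ω) (x j))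
          (hindep.comp _ fun i => hW i x) hWY]
        refine Finset.prod_congr rfl fun i _ => ?_
        rw [(hY i).lintegral_comp (hW i x)]
        exact lintegral_prod_localDensity (hp i) (x₀ i) t (hg i) ε x

variable (hn : 2 ≤ n) (hsymm : ∀ i, (H i).IsSymmetric m)
  (hp : ∀ i, (H i).IsTransitionDensity m (p i))
  (hY : ∀ i, MeasurePreserving (Y i) μ ((H i).P (x₀ i : OnePoint E)))
  (hindep : iIndepFun Y μ)
  (hgreen : ∀ i, (⨆ x : E, ∫⁻ y, green (p i) x y ^ n ∂m) < ∞) (t : ℝ)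
include hn hsymm hp hY hindep hgreen

/-- All moments of the approximated intersection measures are bounded uniformly in `ε > 0`. -/
lemma exists_moment_bound {F : E → ℝ≥0∞} (hF : Measurable F) {B : ℝ≥0∞} (hB : B ≠ ∞)
    (hFB : ∀ x, F x ≤ B) (k : ℕ) : ∃ K : ℝ≥0∞, K ≠ ∞ ∧ ∀ ε : ℝ, 0 < ε →
      ∫⁻ ω, (∫⁻ x, F x ∂(approxIntersection H Y m p ε t ω)) ^ k ∂μ ≤ K := by
  have hn1 : 1 ≤ n := by omega
  choose g hgm hgint hg using fun i =>
    HuntProcess.exists_occupation_density (hp i) hn1 (hgreen i) (x₀ i) t k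
  refine ⟨B ^ k * ∏ i, (∫⁻ z, g i z ^ n ∂(Measure.pi fun _ => m)) ^ (1 / (n : ℝ)), ?_,
    fun ε hε => ?_⟩
  · exact ENNReal.mul_ne_top (ENNReal.pow_ne_top hB) (ENNReal.prod_ne_top fun i _ =>
      ENNReal.rpow_ne_top_of_nonneg (by positivity) (hgint i))
  have hds : ∀ i, IsDoublySubstochastic (Measure.pi fun _ : Fin k => m)
      (piKernel fun _ => p i ε) := fun i =>
    isDoublySubstochastic_piKernel fun _ => (hp i).isDoublySubstochastic (hsymm i) hε
  have h := lintegral_prod_approxIntersection hp hY hindep t hg hF (fun _ => ε)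
  simp only [Finset.prod_const, Finset.card_univ, Fintype.card_fin] at h
  rw [h]
  calc _ ≤ ∫⁻ x : Fin k → E, B ^ k * ∏ i, smoothing (Measure.pi fun _ => m)
        (piKernel fun _ => p i ε) (g i) x ∂(Measure.pi fun _ => m) := by
        gcongr with x
        refine (Finset.prod_le_prod' fun j _ => hFB (x j)).trans ?_
        simp
    _ = B ^ k * ∫⁻ x : Fin k → E, ∏ i, smoothing (Measure.pi fun _ => m)
        (piKernel fun _ => p i ε) (g i) x ∂(Measure.pi fun _ => m) :=
        lintegral_const_mul' _ _ (ENNReal.pow_ne_top hB)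
    _ ≤ _ := by
        gcongr
        refine (lintegral_prod_le_prod_lintegral_pow hn1 fun i =>
          (hds i).measurable_smoothing (hgm i)).trans ?_
        refine Finset.prod_le_prod' fun i _ => ENNReal.rpow_le_rpow ?_ (by positivity)
        exact (hds i).lintegral_smoothing_pow_le (hgm i) hn

/-- The joint second moments converge as both mollification parameters tend to `0`, because the
smoothed occupation densities converge in `L^n`. -/
lemma exists_tendsto_second_moment
    [(Measure.pi fun _ : Fin 2 => m).Regular] {F : E → ℝ≥0∞} (hF : Measurable F) {B : ℝ≥0∞}
    (hB : B ≠ ∞) (hFB : ∀ x, F x ≤ B) : ∃ c : ℝ≥0∞, ∀ {ι : Type} {l : Filter ι}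
      [l.IsCountablyGenerated] {a b : ι → ℝ}, Tendsto a l (𝓝[>] 0) → Tendsto b l (𝓝[>] 0) →
      Tendsto (fun i => ∫⁻ ω, (∫⁻ x, F x ∂(approxIntersection H Y m p (a i) t ω)) *
        ∫⁻ x, F x ∂(approxIntersection H Y m p (b i) t ω) ∂μ) l (𝓝 c) := by
  have hn1 : 1 ≤ n := by omega
  choose g hgm hgint hg using fun i =>
    HuntProcess.exists_occupation_density (hp i) hn1 (hgreen i) (x₀ i) t 2
  refine ⟨∫⁻ x : Fin 2 → E, (∏ j, F (x j)) * ∏ i, g i x ∂(Measure.pi fun _ => m),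
    fun {ι l _ a b} ha hb => ?_⟩
  have hab : ∀ j : Fin 2, Tendsto (fun i => (![a i, b i] : Fin 2 → ℝ) j) l (𝓝[>] 0) := fun j => by
    fin_cases j
    · exact ha
    · exact hb
  have hai : ∀ i, IsApproxIdentity (Measure.pi fun _ : Fin 2 => m)
      (fun c : ι => piKernel fun j => p i ((![a c, b c] : Fin 2 → ℝ) j)) l := fun i =>
    isApproxIdentity_piKernel fun j => ((hp i).isApproxIdentity (hsymm i)).comp (hab j)
  have h := fun c => lintegral_prod_approxIntersection hp hY hindep t hg hF (![a c, b c])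
  simp only [Fin.prod_univ_two (f := fun j : Fin 2 => ∫⁻ x, F x ∂(approxIntersection H Y m p
    ((![a _, b _] : Fin 2 → ℝ) j) t _)), Matrix.cons_val_zero, Matrix.cons_val_one] at h
  simp only [h]
  refine tendsto_lintegral_mul_prod hn1 (B := B ^ 2) ?_ hgm ?_ (ENNReal.pow_ne_top hB) ?_
    hgint ?_ ?_
  · filter_upwards [eventually_all.2 fun i => (hai i).doublySubstochastic] with c hc i
    exact (hc i).measurable_smoothing (hgm i)
  · exact Finset.measurable_fun_prod _ fun j _ => hF.comp (measurable_pi_apply j)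
  · intro x
    refine (Finset.prod_le_prod' fun j _ => hFB (x j)).trans ?_
    simp
  · filter_upwards [eventually_all.2 fun i => (hai i).doublySubstochastic] with c hc i
    exact (hc i).lintegral_smoothing_pow_le (hgm i) hn
  · exact fun i => (hai i).tendsto_lintegral_absDiff_smoothing (hgm i) hn (hgint i)

/-- The approximated intersection measures, tested against a bounded function, are Cauchy in
every `L^k` as `ε ↓ 0`: for `k = 2` by convergence of the joint second moments, and in general by
the Cauchy–Schwarz inequality and boundedness of all moments. -/
theorem tendsto_lintegral_absDiff_approxIntersection
    [(Measure.pi fun _ : Fin 2 => m).Regular] {F : E → ℝ≥0∞} (hF : Measurable F) {B : ℝ≥0∞}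
    (hB : B ≠ ∞) (hFB : ∀ x, F x ≤ B) {k : ℕ} (hk : 1 ≤ k) :
    Tendsto (fun e : ℝ × ℝ => ∫⁻ ω, absDiff
        (∫⁻ x, F x ∂(approxIntersection H Y m p e.1 t ω))
        (∫⁻ x, F x ∂(approxIntersection H Y m p e.2 t ω)) ^ k ∂μ)
      (𝓝[>] 0 ×ˢ 𝓝[>] 0) (𝓝 0) := by
  set Z : ℝ → Ω → ℝ≥0∞ := fun ε ω => ∫⁻ x, F x ∂(approxIntersection H Y m p ε t ω) with hZ
  have hZm : ∀ ε, Measurable (Z ε) := fun ε =>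
    measurable_lintegral_approxIntersection hp (fun i => (hY i).measurable) t ε hF
  obtain ⟨c, hc⟩ := exists_tendsto_second_moment hn hsymm hp hY hindep hgreen t hF hB hFB
  have hbd := exists_moment_bound hn hsymm hp hY hindep hgreen t hF hB hFB
  have hpos : ∀ᶠ e : ℝ × ℝ in 𝓝[>] 0 ×ˢ 𝓝[>] 0, 0 < e.1 ∧ 0 < e.2 :=
    (eventually_mem_nhdsWithin (s := Set.Ioi (0 : ℝ))).prod_mk
      (eventually_mem_nhdsWithin (s := Set.Ioi (0 : ℝ)))
  obtain ⟨K2, hK2, hle2⟩ := hbd 2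
  have hcfin : c ≠ ∞ := by
    refine ne_top_of_le_ne_top hK2 (le_of_tendsto (hc tendsto_id tendsto_id) ?_)
    filter_upwards [self_mem_nhdsWithin] with ε hε
    refine (le_of_eq ?_).trans (hle2 ε hε)
    simp only [sq, id]
  -- `𝔼 |Z_ε - Z_δ|² = 𝔼 Z_ε² + 𝔼 Z_δ² - 2 𝔼 Z_ε Z_δ`, and all three moments tend to `c`
  have h2 : Tendsto (fun e : ℝ × ℝ => ∫⁻ ω, absDiff (Z e.1 ω) (Z e.2 ω) ^ 2 ∂μ)
      (𝓝[>] 0 ×ˢ 𝓝[>] 0) (𝓝 0) := by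
    have l11 := hc (l := 𝓝[>] (0 : ℝ) ×ˢ 𝓝[>] (0 : ℝ)) tendsto_fst tendsto_fst
    have l22 := hc (l := 𝓝[>] (0 : ℝ) ×ˢ 𝓝[>] (0 : ℝ)) tendsto_snd tendsto_snd
    have l12 := hc (l := 𝓝[>] (0 : ℝ) ×ˢ 𝓝[>] (0 : ℝ)) tendsto_fst tendsto_snd
    have hlim := ENNReal.Tendsto.sub (l11.add l22)
      (ENNReal.Tendsto.const_mul (a := 2) l12 (Or.inr (by simp)))
      (Or.inl (ENNReal.add_ne_top.2 ⟨hcfin, hcfin⟩))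
    rw [two_mul, tsub_self] at hlim
    refine tendsto_of_tendsto_of_tendsto_of_le_of_le' tendsto_const_nhds hlim
      (Eventually.of_forall fun _ => zero_le) ?_
    filter_upwards [hpos] with e he
    have hf1 : ∫⁻ ω, Z e.1 ω ^ 2 ∂μ ≠ ∞ := ne_top_of_le_ne_top hK2 (hle2 _ he.1)
    have hf2 : ∫⁻ ω, Z e.2 ω ^ 2 ∂μ ≠ ∞ := ne_top_of_le_ne_top hK2 (hle2 _ he.2)
    have ha : ∀ {ε : ℝ}, ∫⁻ ω, Z ε ω ^ 2 ∂μ ≠ ∞ → ∀ᵐ ω ∂μ, Z ε ω ≠ ∞ := fun {ε} h => by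
      filter_upwards [ae_lt_top ((hZm ε).pow_const 2) h] with ω hω h'
      simp [h'] at hω
    have heq : ∫⁻ ω, absDiff (Z e.1 ω) (Z e.2 ω) ^ 2 ∂μ + 2 * ∫⁻ ω, Z e.1 ω * Z e.2 ω ∂μ =
        ∫⁻ ω, Z e.1 ω * Z e.1 ω ∂μ + ∫⁻ ω, Z e.2 ω * Z e.2 ω ∂μ := by
      rw [← lintegral_const_mul _ ((hZm _).fun_mul (hZm _)),
        ← lintegral_add_left (((hZm e.1).absDiff (hZm e.2)).pow_const 2),
        ← lintegral_add_left ((hZm _).fun_mul (hZm _))]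
      refine lintegral_congr_ae ?_
      filter_upwards [ha hf1, ha hf2] with ω h1 h2
      rw [absDiff_sq_add h1 h2, sq, sq]
    refine ENNReal.le_sub_of_add_le_right ?_ heq.le
    refine ne_top_of_le_ne_top ?_ (heq ▸ le_add_self)
    simp only [← sq]
    exact ENNReal.add_ne_top.2 ⟨hf1, hf2⟩
  obtain ⟨K, hK, hle⟩ := hbd (2 * (k - 1))
  set D : ℝ≥0∞ := (2 ^ (2 * (k - 1)) * (K + K)) ^ (1 / (2 : ℝ))
  have hD : D ≠ ∞ := ENNReal.rpow_ne_top_of_nonneg (by positivity)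
    (ENNReal.mul_ne_top (by finiteness) (ENNReal.add_ne_top.2 ⟨hK, hK⟩))
  have hlim : Tendsto (fun e : ℝ × ℝ =>
      (∫⁻ ω, absDiff (Z e.1 ω) (Z e.2 ω) ^ 2 ∂μ) ^ (1 / (2 : ℝ)) * D)
      (𝓝[>] 0 ×ˢ 𝓝[>] 0) (𝓝 0) := by
    have h3 := (ENNReal.continuous_rpow_const (y := 1 / (2 : ℝ))).tendsto 0 |>.comp h2
    rw [ENNReal.zero_rpow_of_pos (by positivity)] at h3
    have h4 := ENNReal.Tendsto.mul_const (b := D) h3 (Or.inr hD)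
    rwa [zero_mul] at h4
  refine tendsto_of_tendsto_of_tendsto_of_le_of_le' tendsto_const_nhds hlim
    (Eventually.of_forall fun _ => zero_le) ?_
  filter_upwards [hpos] with e he
  refine (lintegral_pow_le_sqrt_mul_sqrt ((hZm e.1).absDiff (hZm e.2)) hk).trans ?_
  refine mul_le_mul_right (ENNReal.rpow_le_rpow ?_ (by positivity)) _
  calc ∫⁻ ω, absDiff (Z e.1 ω) (Z e.2 ω) ^ (2 * (k - 1)) ∂μ
      ≤ ∫⁻ ω, (Z e.1 ω + Z e.2 ω) ^ (2 * (k - 1)) ∂μ := by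
        gcongr with ω
        exact absDiff_le_add _ _
    _ ≤ 2 ^ (2 * (k - 1)) * (∫⁻ ω, Z e.1 ω ^ (2 * (k - 1)) ∂μ +
          ∫⁻ ω, Z e.2 ω ^ (2 * (k - 1)) ∂μ) := lintegral_add_pow_le (hZm _) _
    _ ≤ _ := by
        gcongr
        · exact hle _ he.1
        · exact hle _ he.2

end Moments

/-! ### The vague topology -/

namespace FinMeas

section Vague

variable {E : Type*} [TopologicalSpace E]

/-- A sequence of nonnegative compactly supported functions that approximates every nonnegative
compactly supported function uniformly, with an error dominated by a member of the sequence.  Such a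
sequence determines vague convergence. -/
structure IsDominatingFamily (f : ℕ → C_c(E, ℝ)) : Prop where
  nonneg : ∀ j x, 0 ≤ f j x
  approx : ∀ h : C_c(E, ℝ), (∀ x, 0 ≤ h x) →
    ∃ b, ∀ δ > 0, ∃ j, ∀ x, |h x - f j x| ≤ δ * f b x

theorem exists_isDominatingFamily [T2Space E] [LocallyCompactSpace E]
    [SecondCountableTopology E] : ∃ f : ℕ → C_c(E, ℝ), IsDominatingFamily f := by
  have K : CompactExhaustion E := default
  have hχ : ∀ k, ∃ χ : C(E, ℝ), Set.EqOn χ 1 (K k) ∧ HasCompactSupport χ ∧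
      ∀ x, χ x ∈ Set.Icc (0 : ℝ) 1 := fun k => by
    obtain ⟨χ, h1, -, h2, h3⟩ := exists_continuous_one_zero_of_isCompact (K.isCompact k)
      isClosed_empty (Set.disjoint_empty _)
    exact ⟨χ, h1, h2, h3⟩
  choose χ hχ1 hχc hχI using hχ
  -- the cut-off functions `χ k`, and the positive parts of a dense sequence times cut-offs
  let g : ℕ × Option ℕ → C_c(E, ℝ) := fun q => match q.2 with
    | none => ⟨χ q.1, hχc q.1⟩
    | some i => ⟨((TopologicalSpace.denseSeq C(E, ℝ) i) ⊔ 0) * χ q.1, (hχc q.1).mul_left⟩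
  have hg0 : ∀ k x, g (k, none) x = χ k x := fun _ _ => rfl
  have hg1 : ∀ k i x, g (k, some i) x = max (TopologicalSpace.denseSeq C(E, ℝ) i x) 0 * χ k x := fun _ _ _ => rfl
  obtain ⟨e, he⟩ := exists_surjective_nat (ℕ × Option ℕ)
  refine ⟨g ∘ e, ⟨fun j x => ?_, fun h hh => ?_⟩⟩
  · rcases hj : e j with ⟨k, _ | i⟩
    · simp only [Function.comp, hj, hg0]
      exact (hχI k x).1
    · simp only [Function.comp, hj, hg1]
      exact mul_nonneg (le_max_right _ _) (hχI k x).1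
  obtain ⟨k, hk⟩ := K.exists_superset_of_isCompact h.hasCompactSupport
  -- `h` is cut off by `χ k` without change, so that `|h - d⁺ χ k| ≤ |h - d| χ k`
  have hmul : ∀ x, h x = h x * χ k x := fun x => by
    by_cases hx : x ∈ tsupport h
    · rw [hχ1 k (hk hx)]
      simp
    · rw [image_eq_zero_of_notMem_tsupport hx, zero_mul]
  obtain ⟨b, hb⟩ := he (k, none)
  refine ⟨b, fun δ hδ => ?_⟩
  have hopen : IsOpen {d : C(E, ℝ) | Set.MapsTo (d - (h : C(E, ℝ))) (tsupport (χ k))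
      (Metric.ball 0 δ)} :=
    (ContinuousMap.isOpen_setOfPred_mapsTo (hχc k) Metric.isOpen_ball).preimage
      (continuous_id.sub continuous_const)
  obtain ⟨d, hd, i, rfl⟩ := (TopologicalSpace.denseRange_denseSeq C(E, ℝ)).inter_open_nonempty _
    hopen ⟨(h : C(E, ℝ)), fun x _ => by simpa using hδ⟩
  obtain ⟨j, hj⟩ := he (k, some i)
  refine ⟨j, fun x => ?_⟩
  simp only [Function.comp, hj, hb, hg0, hg1]
  rw [hmul x, ← sub_mul, abs_mul, abs_of_nonneg (hχI k x).1]
  by_cases hx : x ∈ tsupport (χ k)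
  · refine mul_le_mul_of_nonneg_right ?_ (hχI k x).1
    have h1 : |TopologicalSpace.denseSeq C(E, ℝ) i x - h x| < δ := by
      simpa [Real.dist_eq] using hd hx
    calc |h x - max (TopologicalSpace.denseSeq C(E, ℝ) i x) 0|
        = |max (h x) 0 - max (TopologicalSpace.denseSeq C(E, ℝ) i x) 0| := by
          rw [max_eq_left (hh x)]
      _ ≤ |h x - TopologicalSpace.denseSeq C(E, ℝ) i x| := abs_max_sub_max_le_abs _ _ _
      _ ≤ δ := by rw [abs_sub_comm]; exact h1.le
  · rw [image_eq_zero_of_notMem_tsupport hx, mul_zero, mul_zero]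

variable [MeasurableSpace E] [BorelSpace E]

lemma integrable_pairing (μ : FinMeas E) (f : C_c(E, ℝ)) : Integrable f μ.toMeasure :=
  have := μ.isFinite
  f.continuous.integrable_of_hasCompactSupport f.hasCompactSupport

lemma pairing_add (μ : FinMeas E) (f g : C_c(E, ℝ)) :
    μ.pairing (f + g : C_c(E, ℝ)) = μ.pairing f + μ.pairing g :=
  integral_add (μ.integrable_pairing f) (μ.integrable_pairing g)

lemma pairing_sub (μ : FinMeas E) (f g : C_c(E, ℝ)) :
    μ.pairing (f - g : C_c(E, ℝ)) = μ.pairing f - μ.pairing g :=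
  integral_sub (μ.integrable_pairing f) (μ.integrable_pairing g)

omit [BorelSpace E] in
lemma pairing_smul (μ : FinMeas E) (c : ℝ) (f : C_c(E, ℝ)) :
    μ.pairing (c • f : C_c(E, ℝ)) = c * μ.pairing f :=
  integral_const_mul c f

omit [BorelSpace E] in
lemma pairing_nonneg (μ : FinMeas E) {f : C_c(E, ℝ)} (hf : ∀ x, 0 ≤ f x) : 0 ≤ μ.pairing f :=
  integral_nonneg hf

lemma abs_pairing_sub_le (μ : FinMeas E) {h g b : C_c(E, ℝ)} {δ : ℝ}
    (H : ∀ x, |h x - g x| ≤ δ * b x) : |μ.pairing h - μ.pairing g| ≤ δ * μ.pairing b := by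
  rw [← pairing_sub, ← pairing_smul]
  refine (abs_integral_le_integral_abs).trans ?_
  exact integral_mono (μ.integrable_pairing (h - g)).abs (μ.integrable_pairing (δ • b)) H

omit [BorelSpace E] in
lemma continuous_pairing (f : C_c(E, ℝ)) : Continuous fun μ : FinMeas E => μ.pairing f :=
  continuous_pi_iff.1 (continuous_induced_dom :
    Continuous fun (μ : FinMeas E) (f : C_c(E, ℝ)) => μ.pairing f) f

omit [BorelSpace E] in
lemma tendsto_iff {ι : Type*} {l : Filter ι} {u : ι → FinMeas E} {ν : FinMeas E} :
    Tendsto u l (𝓝 ν) ↔ ∀ f : C_c(E, ℝ), Tendsto (fun i => (u i).pairing f) l (𝓝 (ν.pairing f)) := by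
  rw [nhds_induced, tendsto_comap_iff, tendsto_pi_nhds]
  rfl

variable {f : ℕ → C_c(E, ℝ)} {ι : Type*} {l : Filter ι}

lemma IsDominatingFamily.tendsto_pairing_sub_of_nonneg (hf : IsDominatingFamily f)
    {u v : ι → FinMeas E} {c : ℕ → ℝ} (hu : ∀ j, Tendsto (fun i => (u i).pairing (f j)) l (𝓝 (c j)))
    (hv : ∀ j, Tendsto (fun i => (v i).pairing (f j)) l (𝓝 (c j))) {h : C_c(E, ℝ)}
    (hh : ∀ x, 0 ≤ h x) :
    Tendsto (fun i => (u i).pairing h - (v i).pairing h) l (𝓝 0) := by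
  obtain ⟨b, hb⟩ := hf.approx h hh
  rw [Metric.tendsto_nhds]
  intro δ hδ
  have hM : 0 < |c b| + 1 := by positivity
  obtain ⟨j, hj⟩ := hb (δ / (4 * (|c b| + 1))) (by positivity)
  have h1 := ((hu j).sub (hv j)).abs
  rw [sub_self, abs_zero] at h1
  have hc : c b < |c b| + 1 := (le_abs_self _).trans_lt (lt_add_one _)
  filter_upwards [h1.eventually_lt_const (half_pos hδ), (hu b).eventually_lt_const hc,
    (hv b).eventually_lt_const hc] with i hi1 hi2 hi3
  have hη : 0 < δ / (4 * (|c b| + 1)) := by positivity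
  have e1 := abs_le.1 ((abs_pairing_sub_le (u i) hj).trans
    (mul_le_mul_of_nonneg_left hi2.le hη.le))
  have e2 := abs_le.1 ((abs_pairing_sub_le (v i) hj).trans
    (mul_le_mul_of_nonneg_left hi3.le hη.le))
  have e3 : δ / (4 * (|c b| + 1)) * (|c b| + 1) = δ / 4 := by field_simp
  rw [e3] at e1 e2
  have e4 := abs_lt.1 hi1
  rw [Real.dist_eq, sub_zero, abs_lt]
  constructor <;> linarith [e1.1, e1.2, e2.1, e2.2, e4.1, e4.2]

lemma IsDominatingFamily.tendsto_pairing_sub (hf : IsDominatingFamily f)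
    {u v : ι → FinMeas E} {c : ℕ → ℝ} (hu : ∀ j, Tendsto (fun i => (u i).pairing (f j)) l (𝓝 (c j)))
    (hv : ∀ j, Tendsto (fun i => (v i).pairing (f j)) l (𝓝 (c j))) (h : C_c(E, ℝ)) :
    Tendsto (fun i => (u i).pairing h - (v i).pairing h) l (𝓝 0) := by
  have hdec : h = h ⊔ 0 - (-h) ⊔ 0 := by
    ext x
    simp only [CompactlySupportedContinuousMap.sub_apply, CompactlySupportedContinuousMap.sup_apply,
      CompactlySupportedContinuousMap.neg_apply, CompactlySupportedContinuousMap.zero_apply]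
    rcases le_total (h x) 0 with h0 | h0 <;> simp [h0]
  have h1 := hf.tendsto_pairing_sub_of_nonneg hu hv (h := h ⊔ 0) fun x => le_max_right _ _
  have h2 := hf.tendsto_pairing_sub_of_nonneg hu hv (h := (-h) ⊔ 0) fun x => le_max_right _ _
  have h3 := h1.sub h2
  rw [sub_zero] at h3
  refine h3.congr fun i => ?_
  conv_rhs => rw [hdec, pairing_sub, pairing_sub]
  ring

/-- Vague convergence may be tested on a dominating family. -/
theorem IsDominatingFamily.tendsto_of_forall (hf : IsDominatingFamily f) {u : ι → FinMeas E}
    {ν : FinMeas E} (hu : ∀ j, Tendsto (fun i => (u i).pairing (f j)) l (𝓝 (ν.pairing (f j)))) :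
    Tendsto u l (𝓝 ν) := by
  rw [tendsto_iff]
  intro h
  have h1 := hf.tendsto_pairing_sub hu (v := fun _ => ν) (fun j => tendsto_const_nhds) h
  simpa using h1.add_const (ν.pairing h)

lemma IsDominatingFamily.isInducing (hf : IsDominatingFamily f) :
    IsInducing fun (μ : FinMeas E) (j : ℕ) => μ.pairing (f j) := by
  rw [isInducing_iff_nhds]
  intro ν
  refine le_antisymm ?_ ?_
  · exact ((continuous_pi fun j => continuous_pairing (f j)).tendsto ν).le_comap
  · refine tendsto_id'.1 (hf.tendsto_of_forall fun j => ?_)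
    exact ((continuous_apply (A := fun _ : ℕ => ℝ) j).tendsto _).comp tendsto_comap

/-- The Borel σ-algebra of the vague topology is generated by the integrals of a dominating
family. -/
theorem IsDominatingFamily.measurable_iff (hf : IsDominatingFamily f) {Ω : Type*}
    [MeasurableSpace Ω] {g : Ω → FinMeas E} :
    Measurable g ↔ ∀ j, Measurable fun ω => (g ω).pairing (f j) := by
  refine ⟨fun hg j => (continuous_pairing (f j)).measurable.comp hg, fun hg => ?_⟩
  have h1 : (instMeasurableSpace : MeasurableSpace (FinMeas E)) =
      MeasurableSpace.comap (fun (μ : FinMeas E) (j : ℕ) => μ.pairing (f j)) inferInstance := by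
    rw [BorelSpace.measurable_eq (α := ℕ → ℝ), ← borel_comap]
    exact congrArg (@borel (FinMeas E)) hf.isInducing.eq_induced
  rw [h1, measurable_comap_iff]
  exact measurable_pi_lambda _ hg

/-- Vague compactness: a sequence of finite measures whose integrals against a dominating family
converge, and whose masses do not tend to infinity, converges vaguely to a finite measure. -/
theorem IsDominatingFamily.exists_tendsto [T2Space E] [LocallyCompactSpace E]
    [SecondCountableTopology E] (hf : IsDominatingFamily f) {u : ℕ → FinMeas E}
    (hu : ∀ j, ∃ c, Tendsto (fun i => (u i).pairing (f j)) atTop (𝓝 c))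
    (hmass : liminf (fun i => (u i).toMeasure Set.univ) atTop ≠ ∞) :
    ∃ ν : FinMeas E, Tendsto u atTop (𝓝 ν) := by
  choose c hc using hu
  have hlim : ∀ h : C_c(E, ℝ), ∃ a, Tendsto (fun i => (u i).pairing h) atTop (𝓝 a) := fun h => by
    refine cauchySeq_tendsto_of_complete ?_
    rw [cauchySeq_iff_tendsto, tendsto_uniformity_iff_dist_tendsto_zero]
    have h1 := hf.tendsto_pairing_sub (l := (atTop : Filter (ℕ × ℕ)))
      (u := fun q => u q.1) (v := fun q => u q.2)
      (fun j => (hc j).comp (by rw [← prod_atTop_atTop_eq]; exact tendsto_fst))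
      (fun j => (hc j).comp (by rw [← prod_atTop_atTop_eq]; exact tendsto_snd)) h
    simpa [Real.dist_eq] using h1.abs
  choose a ha using hlim
  let Λ : C_c(E, ℝ) →ₚ[ℝ] ℝ := PositiveLinearMap.mk₀
    { toFun := a
      map_add' := fun g h => tendsto_nhds_unique (ha (g + h)) (by
        simpa only [pairing_add] using (ha g).add (ha h))
      map_smul' := fun r h => tendsto_nhds_unique (ha (r • h)) (by
        simp only [pairing_smul]
        exact (ha h).const_mul r) }
    fun h hh => ge_of_tendsto' (ha h) fun i => (u i).pairing_nonneg hh
  have hΛ : ∀ h, Λ h = a h := fun _ => rfl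
  -- the limit functional is represented by a measure, whose mass on compact sets is bounded by any
  -- bound of the masses along a subsequence
  obtain ⟨M, hM1, hM2⟩ := exists_between hmass.lt_top
  have hfreq := frequently_lt_of_liminf_lt (by isBoundedDefault) hM1
  have hK : ∀ K : Set E, IsCompact K → RealRMK.rieszMeasure Λ K ≤ M := fun K hK => by
    obtain ⟨χ, h1, -, h2, h3⟩ := exists_continuous_one_zero_of_isCompact hK
      isClosed_empty (Set.disjoint_empty _)
    refine (RealRMK.rieszMeasure_le_of_eq_one Λ (f := ⟨χ, h2⟩) (fun x => (h3 x).1) hK h1).trans ?_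
    refine ENNReal.ofReal_le_of_le_toReal ?_
    rw [hΛ]
    refine le_of_tendsto_of_frequently (ha _) (hfreq.mono fun i hi => ?_)
    have := (u i).isFinite
    calc (u i).pairing χ ≤ ∫ _, (1 : ℝ) ∂(u i).toMeasure :=
          integral_mono ((u i).integrable_pairing ⟨χ, h2⟩) (integrable_const _) fun x => (h3 x).2
      _ = ((u i).toMeasure Set.univ).toReal := by simp [Measure.real]
      _ ≤ M.toReal := ENNReal.toReal_mono hM2.ne hi.le
  have K : CompactExhaustion E := default
  have huniv : RealRMK.rieszMeasure Λ Set.univ ≤ M := by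
    rw [← K.iUnion_eq, Monotone.measure_iUnion fun _ _ h => K.subset h]
    exact iSup_le fun i => hK _ (K.isCompact i)
  refine ⟨⟨RealRMK.rieszMeasure Λ, ⟨huniv.trans_lt hM2⟩⟩, ?_⟩
  rw [tendsto_iff]
  intro h
  convert ha h using 2
  exact RealRMK.integral_rieszMeasure Λ h

end Vague

end FinMeas

/-! ### Convergence of moment-Cauchy families of random measures -/

section RandomMeasures

variable {E Ω : Type*} [MeasurableSpace E] [MeasurableSpace Ω]

/-- A family of random measures whose integrals of bounded functions have all moments bounded and
are Cauchy in every `L^k` as the parameter tends to `0` from the right. -/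
structure IsMomentCauchy (L : ℝ → Ω → Measure E) (P : Measure Ω) : Prop where
  measurable : ∀ ε (F : E → ℝ≥0∞), Measurable F → Measurable fun ω => ∫⁻ x, F x ∂(L ε ω)
  moment : ∀ (F : E → ℝ≥0∞) (B : ℝ≥0∞), Measurable F → B ≠ ∞ → (∀ x, F x ≤ B) → ∀ k : ℕ,
    ∃ K : ℝ≥0∞, K ≠ ∞ ∧ ∀ ε : ℝ, 0 < ε → ∫⁻ ω, (∫⁻ x, F x ∂(L ε ω)) ^ k ∂P ≤ K
  cauchy : ∀ (F : E → ℝ≥0∞) (B : ℝ≥0∞), Measurable F → B ≠ ∞ → (∀ x, F x ≤ B) → ∀ k : ℕ, 1 ≤ k →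
    Tendsto (fun e : ℝ × ℝ => ∫⁻ ω, absDiff (∫⁻ x, F x ∂(L e.1 ω)) (∫⁻ x, F x ∂(L e.2 ω)) ^ k ∂P)
      (𝓝[>] 0 ×ˢ 𝓝[>] 0) (𝓝 0)

/-- Passage to a measure dominated by a multiple of the original one. -/
lemma IsMomentCauchy.of_le_smul {L : ℝ → Ω → Measure E} {P Q : Measure Ω}
    (hL : IsMomentCauchy L P) {c : ℝ≥0∞} (hc : c ≠ ∞) (hQ : Q ≤ c • P) : IsMomentCauchy L Q := by
  have hle : ∀ φ : Ω → ℝ≥0∞, ∫⁻ ω, φ ω ∂Q ≤ c * ∫⁻ ω, φ ω ∂P := fun φ =>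
    (lintegral_mono' hQ le_rfl).trans_eq (lintegral_smul_measure _ _)
  refine ⟨hL.measurable, fun F B hF hB hFB k => ?_, fun F B hF hB hFB k hk => ?_⟩
  · obtain ⟨K, hK, h⟩ := hL.moment F B hF hB hFB k
    exact ⟨c * K, ENNReal.mul_ne_top hc hK, fun ε hε => (hle _).trans (by gcongr; exact h ε hε)⟩
  · have h1 := ENNReal.Tendsto.const_mul (a := c) (hL.cauchy F B hF hB hFB k hk) (Or.inr hc)
    rw [mul_zero] at h1
    exact tendsto_of_tendsto_of_tendsto_of_le_of_le tendsto_const_nhds h1 (fun _ => zero_le)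
      fun _ => hle _

/-- Countably many double sequences that tend to `0` in `L¹` are almost surely summable along
a common subsequence. -/
lemma exists_strictMono_ae_tsum_ne_top {P : Measure Ω} {D : ℕ → ℕ → ℕ → Ω → ℝ≥0∞}
    (hD : ∀ j a b, Measurable (D j a b))
    (h : ∀ j, Tendsto (fun q : ℕ × ℕ => ∫⁻ ω, D j q.1 q.2 ω ∂P) atTop (𝓝 0)) :
    ∃ φ : ℕ → ℕ, StrictMono φ ∧
      ∀ᵐ ω ∂P, ∀ j, ∑' i, D j (φ (i + j)) (φ (i + j + 1)) ω ≠ ∞ := by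
  obtain ⟨φ, hφ, hφD⟩ := extraction_forall_of_eventually
    (P := fun i N => ∀ j ≤ i, ∀ a ≥ N, ∀ b ≥ N, ∫⁻ ω, D j a b ω ∂P ≤ (2 : ℝ≥0∞)⁻¹ ^ i) fun i => by
      refine (eventually_all_finite (Set.finite_Iic i)).2 fun j _ => ?_
      have h2 : (0 : ℝ≥0∞) < 2⁻¹ ^ i := ENNReal.pow_pos (by simp) i
      obtain ⟨⟨a₀, b₀⟩, hab⟩ := eventually_atTop.1 ((h j).eventually_le_const h2)
      filter_upwards [eventually_ge_atTop (max a₀ b₀)] with N hN a ha b hb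
      exact hab (a, b) ⟨(le_max_left _ _).trans (hN.trans ha), (le_max_right _ _).trans (hN.trans hb)⟩
  refine ⟨φ, hφ, ae_all_iff.2 fun j => ?_⟩
  have hm : Measurable fun ω => ∑' i, D j (φ (i + j)) (φ (i + j + 1)) ω :=
    Measurable.tsum fun i => hD j _ _
  refine (ae_lt_top hm ?_).mono fun ω hω => hω.ne
  rw [lintegral_tsum fun i => (hD j _ _).aemeasurable]
  refine ne_top_of_le_ne_top (b := ∑' i : ℕ, (2 : ℝ≥0∞)⁻¹ ^ i) ?_ (ENNReal.tsum_le_tsum fun i => ?_)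
  · rw [ENNReal.tsum_geometric]
    simp
  · refine (hφD (i + j) j (by omega) _ le_rfl _ (hφ.monotone (by omega))).trans ?_
    exact pow_le_pow_right_of_le_one' (by simp) (by omega)

namespace FinMeas

lemma ofMeasure_toMeasure (ν : Measure E) [h : IsFiniteMeasure ν] : (ofMeasure ν).toMeasure = ν := by
  simp [ofMeasure, h]

variable [TopologicalSpace E] [BorelSpace E]

lemma measurable_ofReal (f : C_c(E, ℝ)) : Measurable fun x => ENNReal.ofReal (f x) :=
  f.continuous.measurable.ennreal_ofReal

omit [MeasurableSpace E] [BorelSpace E] in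
lemma exists_ofReal_le (f : C_c(E, ℝ)) : ∃ B : ℝ≥0∞, B ≠ ∞ ∧ ∀ x, ENNReal.ofReal (f x) ≤ B := by
  obtain ⟨b, hb⟩ := f.hasCompactSupport.exists_bound_of_continuous f.continuous
  exact ⟨ENNReal.ofReal b, ENNReal.ofReal_ne_top, fun x =>
    ENNReal.ofReal_le_ofReal ((le_abs_self _).trans (hb x))⟩

lemma pairing_eq_toReal (ν : FinMeas E) {f : C_c(E, ℝ)} (hf : ∀ x, 0 ≤ f x) :
    ν.pairing f = (∫⁻ x, ENNReal.ofReal (f x) ∂ν.toMeasure).toReal :=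
  integral_eq_lintegral_of_nonneg_ae (Eventually.of_forall hf)
    f.continuous.measurable.aestronglyMeasurable

lemma ofReal_pairing (ν : FinMeas E) {f : C_c(E, ℝ)} (hf : ∀ x, 0 ≤ f x) :
    ENNReal.ofReal (ν.pairing f) = ∫⁻ x, ENNReal.ofReal (f x) ∂ν.toMeasure :=
  ofReal_integral_eq_lintegral_ofReal (ν.integrable_pairing f) (Eventually.of_forall hf)

omit [BorelSpace E] in
lemma pairing_ofMeasure_zero (f : C_c(E, ℝ)) : (ofMeasure (0 : Measure E)).pairing f = 0 := by
  simp [pairing, ofMeasure_toMeasure]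

/-- A random measure with measurable integrals is measurable into the space of finite measures. -/
lemma measurable_ofMeasure {f : ℕ → C_c(E, ℝ)} (hf : IsDominatingFamily f) {L : Ω → Measure E}
    (hL : ∀ F : E → ℝ≥0∞, Measurable F → Measurable fun ω => ∫⁻ x, F x ∂(L ω)) :
    Measurable fun ω => ofMeasure (L ω) := by
  rw [hf.measurable_iff]
  intro j
  have hmass : Measurable fun ω => L ω Set.univ := by
    simpa using hL (fun _ => 1) measurable_const
  -- `ofMeasure` is `0` where the mass is infinite
  have heq : (fun ω => (ofMeasure (L ω)).pairing (f j)) =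
      {ω | L ω Set.univ < ∞}.indicator
        fun ω => (∫⁻ x, ENNReal.ofReal (f j x) ∂(L ω)).toReal := by
    funext ω
    by_cases h : L ω Set.univ < ∞
    · have : IsFiniteMeasure (L ω) := ⟨h⟩
      rw [Set.indicator_of_mem (by exact h), pairing_eq_toReal _ (hf.nonneg j), ofMeasure_toMeasure]
    · rw [Set.indicator_of_notMem (by exact h)]
      have h' : ¬ IsFiniteMeasure (L ω) := fun h' => h h'.measure_univ_lt_top
      simp [pairing, ofMeasure, h']
  rw [heq]
  exact (hL _ (measurable_ofReal (f j))).ennreal_toReal.indicator (hmass measurableSet_Iio)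

end FinMeas

end RandomMeasures

/-! ### The limiting random measure -/

namespace IsMomentCauchy

variable {E Ω : Type*} [MeasurableSpace E] [MeasurableSpace Ω] {L : ℝ → Ω → Measure E}
  {P : Measure Ω}

lemma ae_isFiniteMeasure (hL : IsMomentCauchy L P) {ε : ℝ} (hε : 0 < ε) :
    ∀ᵐ ω ∂P, IsFiniteMeasure (L ε ω) := by
  obtain ⟨K, hK, h⟩ := hL.moment (fun _ => 1) 1 measurable_const ENNReal.one_ne_top
    (fun _ => le_rfl) 1
  have h1 := h ε hε
  simp only [pow_one] at h1
  refine (ae_lt_top (hL.measurable ε _ measurable_const) (ne_top_of_le_ne_top hK h1)).mono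
    fun ω hω => ⟨by simpa using hω⟩

variable [TopologicalSpace E] [BorelSpace E]

/-- Along a sequence tending to `0`, a subsequence has almost surely convergent integrals against
each member of a countable family. -/
lemma exists_strictMono_ae_exists_tendsto (hL : IsMomentCauchy L P) {f : ℕ → C_c(E, ℝ)}
    (hf : ∀ j x, 0 ≤ f j x) {e : ℕ → ℝ} (he : Tendsto e atTop (𝓝[>] 0)) (he0 : ∀ i, 0 < e i) :
    ∃ φ : ℕ → ℕ, StrictMono φ ∧ ∀ᵐ ω ∂P, ∀ j, ∃ c : ℝ, Tendsto
      (fun i => (FinMeas.ofMeasure (L (e (φ i)) ω)).pairing (f j)) atTop (𝓝 c) := by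
  obtain ⟨φ, hφ, h⟩ := exists_strictMono_ae_tsum_ne_top (P := P)
    (D := fun j a b ω => absDiff (∫⁻ x, ENNReal.ofReal (f j x) ∂(L (e a) ω))
      (∫⁻ x, ENNReal.ofReal (f j x) ∂(L (e b) ω)))
    (fun j a b => (hL.measurable _ _ (FinMeas.measurable_ofReal _)).absDiff
      (hL.measurable _ _ (FinMeas.measurable_ofReal _)))
    (fun j => by
      obtain ⟨B, hB, hfB⟩ := FinMeas.exists_ofReal_le (f j)
      have h1 := hL.cauchy _ B (FinMeas.measurable_ofReal (f j)) hB hfB 1 le_rfl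
      simp only [pow_one] at h1
      rw [← prod_atTop_atTop_eq]
      exact h1.comp (he.prodMap he))
  refine ⟨φ, hφ, ?_⟩
  filter_upwards [h, ae_all_iff.2 fun i => hL.ae_isFiniteMeasure (he0 i)] with ω hω hfin j
  refine cauchySeq_tendsto_of_complete ?_
  rw [← cauchySeq_shift j]
  refine cauchySeq_of_summable_dist ?_
  convert ENNReal.summable_toReal (hω j) using 2 with i
  have hZ : ∀ a, ∫⁻ x, ENNReal.ofReal (f j x) ∂(L (e a) ω) =
      ENNReal.ofReal ((FinMeas.ofMeasure (L (e a) ω)).pairing (f j)) := fun a => by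
    have := hfin a
    rw [FinMeas.ofReal_pairing _ (hf j), FinMeas.ofMeasure_toMeasure]
  have hn : ∀ a, 0 ≤ (FinMeas.ofMeasure (L (e a) ω)).pairing (f j) := fun a =>
    FinMeas.pairing_nonneg _ (hf j)
  rw [hZ, hZ, absDiff_eq_ofReal_abs ENNReal.ofReal_ne_top ENNReal.ofReal_ne_top,
    ENNReal.toReal_ofReal (hn _), ENNReal.toReal_ofReal (hn _),
    ENNReal.toReal_ofReal (abs_nonneg _), Real.dist_eq, Nat.succ_eq_add_one]
  rw [Nat.add_right_comm i 1 j]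

variable [T2Space E] [LocallyCompactSpace E] [SecondCountableTopology E]

/-- Along a suitable sequence, the random measures converge almost surely in the vague topology: the
integrals against a dominating family converge, and by Fatou's lemma the total masses do not tend
to infinity. -/
theorem exists_ae_tendsto (hL : IsMomentCauchy L P) :
    ∃ (ℓ : Ω → FinMeas E) (e : ℕ → ℝ), Measurable ℓ ∧ Tendsto e atTop (𝓝[>] 0) ∧
      (∀ i, 0 < e i) ∧
      ∀ᵐ ω ∂P, Tendsto (fun i => FinMeas.ofMeasure (L (e i) ω)) atTop (𝓝 (ℓ ω)) := by
  obtain ⟨f, hf⟩ := FinMeas.exists_isDominatingFamily (E := E)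
  have hd0 : ∀ i : ℕ, 0 < 1 / ((i : ℝ) + 1) := fun i => Nat.one_div_pos_of_nat
  have hd : Tendsto (fun i : ℕ => 1 / ((i : ℝ) + 1)) atTop (𝓝[>] 0) :=
    tendsto_nhdsWithin_iff.2 ⟨tendsto_one_div_add_atTop_nhds_zero_nat, Eventually.of_forall hd0⟩
  obtain ⟨φ, hφ, hconv⟩ := hL.exists_strictMono_ae_exists_tendsto hf.nonneg hd hd0
  set e : ℕ → ℝ := fun i => 1 / ((φ i : ℝ) + 1) with he
  have he0 : ∀ i, 0 < e i := fun i => hd0 _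
  have hmass : ∀ᵐ ω ∂P, liminf (fun i => L (e i) ω Set.univ) atTop < ∞ := by
    have hm : ∀ ε, Measurable fun ω => L ε ω Set.univ := fun ε => by
      simpa using hL.measurable ε (fun _ => 1) measurable_const
    obtain ⟨K, hK, hle⟩ := hL.moment (fun _ => 1) 1 measurable_const ENNReal.one_ne_top
      (fun _ => le_rfl) 1
    refine ae_lt_top (Measurable.liminf fun i => hm _) (ne_top_of_le_ne_top hK ?_)
    refine (lintegral_liminf_le fun i => hm _).trans
      (liminf_le_of_frequently_le' (Frequently.of_forall fun i => ?_))
    simpa using hle (e i) (he0 i)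
  have hex : ∀ᵐ ω ∂P, ∃ ν, Tendsto (fun i => FinMeas.ofMeasure (L (e i) ω)) atTop (𝓝 ν) := by
    filter_upwards [hconv, hmass, ae_all_iff.2 fun i => hL.ae_isFiniteMeasure (he0 i)]
      with ω h1 h2 h3
    refine hf.exists_tendsto h1 ?_
    have h4 : ∀ i, (FinMeas.ofMeasure (L (e i) ω)).toMeasure = L (e i) ω := fun i => by
      have := h3 i
      exact FinMeas.ofMeasure_toMeasure _
    simp only [h4]
    exact h2.ne
  -- a measurable null set outside which the limit exists; `ℓ` is set to `0` on it
  set N : Set Ω := toMeasurable P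
    {ω | ¬ ∃ ν, Tendsto (fun i => FinMeas.ofMeasure (L (e i) ω)) atTop (𝓝 ν)} with hN
  have hN0 : P N = 0 := by
    rw [hN, measure_toMeasurable]
    exact hex
  have hNm : MeasurableSet N := measurableSet_toMeasurable _ _
  have hNex : ∀ ω, ω ∉ N →
      ∃ ν, Tendsto (fun i => FinMeas.ofMeasure (L (e i) ω)) atTop (𝓝 ν) := fun ω hω => by
    by_contra hcon
    exact hω (subset_toMeasurable _ _ hcon)
  choose ν hν using hNex
  classical
  let ℓ : Ω → FinMeas E := fun ω => if h : ω ∈ N then FinMeas.ofMeasure 0 else ν ω h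
  have hℓ : ∀ ω, ω ∉ N → Tendsto (fun i => FinMeas.ofMeasure (L (e i) ω)) atTop (𝓝 (ℓ ω)) :=
    fun ω hω => by
      simp only [ℓ, dif_neg hω]
      exact hν ω hω
  refine ⟨ℓ, e, ?_, hd.comp hφ.tendsto_atTop, he0, ?_⟩
  · rw [hf.measurable_iff]
    intro j
    refine measurable_of_tendsto_metrizable (f := fun i => Nᶜ.indicator
      fun ω => (FinMeas.ofMeasure (L (e i) ω)).pairing (f j)) (fun i => ?_)
      (tendsto_pi_nhds.2 fun ω => ?_)
    · exact ((hf.measurable_iff.1 (FinMeas.measurable_ofMeasure hf (hL.measurable (e i)))) j).indicator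
        hNm.compl
    · by_cases hω : ω ∈ N
      · simp only [Set.indicator_of_notMem (fun h : ω ∈ Nᶜ => h hω), ℓ, dif_pos hω,
          FinMeas.pairing_ofMeasure_zero]
        exact tendsto_const_nhds
      · simp only [Set.indicator_of_mem (Set.mem_compl hω)]
        exact FinMeas.tendsto_iff.1 (hℓ ω hω) (f j)
  · filter_upwards [measure_eq_zero_iff_ae_notMem.1 hN0] with ω hω using hℓ ω hω

end IsMomentCauchy

/-! ### Modes of convergence to the limit -/

namespace IsMomentCauchy

section LpConvergence

variable {E Ω : Type*} [TopologicalSpace E] [MeasurableSpace E] [BorelSpace E]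
  [MeasurableSpace Ω] {L : ℝ → Ω → Measure E} {P : Measure Ω}
  {ℓ : Ω → FinMeas E} {e : ℕ → ℝ}

omit [BorelSpace E] in
lemma measurable_pairing (hℓ : Measurable ℓ) (f : C_c(E, ℝ)) :
    Measurable fun ω => (ℓ ω).pairing f :=
  (FinMeas.continuous_pairing f).measurable.comp hℓ

/-- The almost sure limit along one sequence is the limit in every `L^k`, by Fatou's lemma. -/
lemma tendsto_lintegral_absDiff_limit (hL : IsMomentCauchy L P) (he : Tendsto e atTop (𝓝[>] 0))
    (he0 : ∀ i, 0 < e i)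
    (hlim : ∀ᵐ ω ∂P, Tendsto (fun i => FinMeas.ofMeasure (L (e i) ω)) atTop (𝓝 (ℓ ω)))
    {f : C_c(E, ℝ)} (hf : ∀ x, 0 ≤ f x) {k : ℕ} (hk : 1 ≤ k) :
    Tendsto (fun ε => ∫⁻ ω, absDiff (∫⁻ x, ENNReal.ofReal (f x) ∂(L ε ω))
      (ENNReal.ofReal ((ℓ ω).pairing f)) ^ k ∂P) (𝓝[>] 0) (𝓝 0) := by
  have hfm := FinMeas.measurable_ofReal f
  obtain ⟨B, hB, hfB⟩ := FinMeas.exists_ofReal_le f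
  have hle : ∀ ε, ∫⁻ ω, absDiff (∫⁻ x, ENNReal.ofReal (f x) ∂(L ε ω))
      (ENNReal.ofReal ((ℓ ω).pairing f)) ^ k ∂P ≤
      liminf (fun i => ∫⁻ ω, absDiff (∫⁻ x, ENNReal.ofReal (f x) ∂(L ε ω))
        (∫⁻ x, ENNReal.ofReal (f x) ∂(L (e i) ω)) ^ k ∂P) atTop := fun ε => by
    refine le_trans (lintegral_mono_ae ?_) (lintegral_liminf_le fun i =>
      ((hL.measurable _ _ hfm).absDiff (hL.measurable _ _ hfm)).pow_const k)
    filter_upwards [hlim, ae_all_iff.2 fun i => hL.ae_isFiniteMeasure (he0 i)] with ω h1 h2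
    have h3 : Tendsto (fun i => ∫⁻ x, ENNReal.ofReal (f x) ∂(L (e i) ω)) atTop
        (𝓝 (ENNReal.ofReal ((ℓ ω).pairing f))) := by
      refine (ENNReal.tendsto_ofReal (FinMeas.tendsto_iff.1 h1 f)).congr fun i => ?_
      have := h2 i
      rw [FinMeas.ofReal_pairing _ hf, FinMeas.ofMeasure_toMeasure]
    exact (((ENNReal.continuous_pow k).tendsto _).comp
      (tendsto_absDiff_of_tendsto ENNReal.ofReal_ne_top h3)).liminf_eq.ge
  rw [ENNReal.tendsto_nhds_zero]
  intro δ hδ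
  have h1 := (hL.cauchy _ B hfm hB hfB k hk).eventually_le_const hδ
  filter_upwards [h1.curry] with ε hε
  exact (hle ε).trans (liminf_le_of_frequently_le' (he.eventually hε).frequently)

variable {f : C_c(E, ℝ)} {k : ℕ}

lemma eLpNorm_natCast {P : Measure Ω} (hk : 1 ≤ k) (g : Ω → ℝ) :
    eLpNorm g k P = (∫⁻ ω, ‖g ω‖ₑ ^ k ∂P) ^ (1 / (k : ℝ)) := by
  have hk0 : k ≠ 0 := by omega
  rw [eLpNorm_eq_lintegral_rpow_enorm_toReal (by exact_mod_cast hk0) (ENNReal.natCast_ne_top k)]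
  simp

theorem tendsto_eLpNorm (hL : IsMomentCauchy L P) (he : Tendsto e atTop (𝓝[>] 0))
    (he0 : ∀ i, 0 < e i)
    (hlim : ∀ᵐ ω ∂P, Tendsto (fun i => FinMeas.ofMeasure (L (e i) ω)) atTop (𝓝 (ℓ ω)))
    (hf : ∀ x, 0 ≤ f x) (hk : 1 ≤ k) :
    Tendsto (fun ε => eLpNorm
      (fun ω => (FinMeas.ofMeasure (L ε ω)).pairing f - (ℓ ω).pairing f) k P) (𝓝[>] 0) (𝓝 0) := by
  have hk0 : 0 < (k : ℝ) := by exact_mod_cast hk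
  have h1 := ((ENNReal.continuous_rpow_const (y := 1 / (k : ℝ))).tendsto 0).comp
    (hL.tendsto_lintegral_absDiff_limit he he0 hlim hf hk)
  rw [ENNReal.zero_rpow_of_pos (by positivity)] at h1
  refine h1.congr' ?_
  filter_upwards [self_mem_nhdsWithin] with ε hε
  rw [eLpNorm_natCast hk, Function.comp]
  congr 1
  refine lintegral_congr_ae ?_
  filter_upwards [hL.ae_isFiniteMeasure (Set.mem_Ioi.1 hε)] with ω hω
  rw [← FinMeas.ofMeasure_toMeasure (L ε ω), ← FinMeas.ofReal_pairing _ hf,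
    FinMeas.ofMeasure_toMeasure, absDiff_eq_ofReal_abs ENNReal.ofReal_ne_top ENNReal.ofReal_ne_top,
    ENNReal.toReal_ofReal (FinMeas.pairing_nonneg _ hf),
    ENNReal.toReal_ofReal (FinMeas.pairing_nonneg _ hf), Real.enorm_eq_ofReal_abs]

variable [T2Space E] [LocallyCompactSpace E] [SecondCountableTopology E]

lemma measurable_ofMeasure (hL : IsMomentCauchy L P) (ε : ℝ) :
    Measurable fun ω => FinMeas.ofMeasure (L ε ω) := by
  obtain ⟨g, hg⟩ := FinMeas.exists_isDominatingFamily (E := E)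
  exact FinMeas.measurable_ofMeasure hg (hL.measurable ε)

lemma memLp_pairing (hL : IsMomentCauchy L P) (hf : ∀ x, 0 ≤ f x) (hk : 1 ≤ k) {ε : ℝ}
    (hε : 0 < ε) : MemLp (fun ω => (FinMeas.ofMeasure (L ε ω)).pairing f) k P := by
  refine ⟨(measurable_pairing (hL.measurable_ofMeasure ε) f).aestronglyMeasurable, ?_⟩
  obtain ⟨B, hB, hfB⟩ := FinMeas.exists_ofReal_le f
  obtain ⟨K, hK, hle⟩ := hL.moment _ B (FinMeas.measurable_ofReal f) hB hfB k
  rw [eLpNorm_natCast hk]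
  refine ENNReal.rpow_lt_top_of_nonneg (by positivity) (ne_top_of_le_ne_top hK ?_)
  refine le_trans (lintegral_mono_ae ?_) (hle ε hε)
  filter_upwards [hL.ae_isFiniteMeasure hε] with ω hω
  rw [Real.enorm_eq_ofReal (FinMeas.pairing_nonneg _ hf), FinMeas.ofReal_pairing _ hf,
    FinMeas.ofMeasure_toMeasure]

lemma memLp_pairing_limit (hL : IsMomentCauchy L P) (hℓ : Measurable ℓ)
    (he : Tendsto e atTop (𝓝[>] 0)) (he0 : ∀ i, 0 < e i)
    (hlim : ∀ᵐ ω ∂P, Tendsto (fun i => FinMeas.ofMeasure (L (e i) ω)) atTop (𝓝 (ℓ ω)))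
    (hf : ∀ x, 0 ≤ f x) (hk : 1 ≤ k) : MemLp (fun ω => (ℓ ω).pairing f) k P := by
  obtain ⟨ε, hε, hε0⟩ := (((hL.tendsto_eLpNorm he he0 hlim hf hk).eventually_lt_const
    zero_lt_one).and self_mem_nhdsWithin).exists
  have h1 := hL.memLp_pairing hf hk (Set.mem_Ioi.1 hε0)
  have h2 : MemLp (fun ω => (FinMeas.ofMeasure (L ε ω)).pairing f - (ℓ ω).pairing f) k P :=
    ⟨((measurable_pairing (hL.measurable_ofMeasure ε) f).sub
      (measurable_pairing hℓ f)).aestronglyMeasurable, hε.trans ENNReal.one_lt_top⟩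
  exact (h1.sub h2).ae_eq (Eventually.of_forall fun ω => sub_sub_cancel _ _)

/-- Convergence in distribution: every sequence tending to `0` has a subsequence along which the
random measures converge vaguely almost surely. -/
theorem tendstoInDistribution [IsProbabilityMeasure P] (hL : IsMomentCauchy L P) (hℓ : Measurable ℓ)
    (he : Tendsto e atTop (𝓝[>] 0)) (he0 : ∀ i, 0 < e i)
    (hlim : ∀ᵐ ω ∂P, Tendsto (fun i => FinMeas.ofMeasure (L (e i) ω)) atTop (𝓝 (ℓ ω))) :
    TendstoInDistribution (fun (ε : ℝ) ω => FinMeas.ofMeasure (L ε ω)) (𝓝[>] 0) ℓ (fun _ => P)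
      P := by
  have hm := hL.measurable_ofMeasure
  refine ⟨fun ε => (hm ε).aemeasurable, hℓ.aemeasurable, ?_⟩
  refine ProbabilityMeasure.tendsto_iff_forall_integral_tendsto.2 fun φ => ?_
  have hφm : Measurable φ := φ.continuous.measurable
  change Tendsto (fun ε => ∫ x, φ x ∂(P.map fun ω => FinMeas.ofMeasure (L ε ω))) _
    (𝓝 (∫ x, φ x ∂(P.map ℓ)))
  rw [integral_map hℓ.aemeasurable hφm.aestronglyMeasurable]
  simp only [fun ε => integral_map (hm ε).aemeasurable hφm.aestronglyMeasurable (μ := P)]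
  refine tendsto_of_subseq_tendsto fun d hd => ?_
  obtain ⟨f, hf⟩ := FinMeas.exists_isDominatingFamily (E := E)
  obtain ⟨ψ, hψ, hsum⟩ := exists_strictMono_ae_tsum_ne_top (P := P)
    (D := fun j a _ ω => absDiff (∫⁻ x, ENNReal.ofReal (f j x) ∂(L (d a) ω))
      (ENNReal.ofReal ((ℓ ω).pairing (f j))))
    (fun j a _ => (hL.measurable _ _ (FinMeas.measurable_ofReal _)).absDiff
      (measurable_pairing hℓ (f j)).ennreal_ofReal)
    (fun j => by
      have h1 := hL.tendsto_lintegral_absDiff_limit he he0 hlim (hf.nonneg j) le_rfl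
      simp only [pow_one] at h1
      rw [← prod_atTop_atTop_eq]
      exact (h1.comp hd).comp tendsto_fst)
  refine ⟨ψ, tendsto_integral_of_dominated_convergence (fun _ => ‖φ‖)
    (fun i => (hφm.comp (hm _)).aestronglyMeasurable) (integrable_const _)
    (fun i => Eventually.of_forall fun ω => φ.norm_coe_le_norm _) ?_⟩
  have hfin : ∀ᵐ ω ∂P, ∀ i, 0 < d i → IsFiniteMeasure (L (d i) ω) :=
    ae_all_iff.2 fun i => by
      by_cases hi : 0 < d i
      · exact (hL.ae_isFiniteMeasure hi).mono fun _ h _ => h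
      · exact Eventually.of_forall fun _ h => absurd h hi
  filter_upwards [hsum, hfin] with ω h1 h2
  refine (φ.continuous.tendsto _).comp (hf.tendsto_of_forall fun j => ?_)
  have h3 : Tendsto (fun i => ∫⁻ x, ENNReal.ofReal (f j x) ∂(L (d (ψ i)) ω)) atTop
      (𝓝 (ENNReal.ofReal ((ℓ ω).pairing (f j)))) :=
    tendsto_of_absDiff_tendsto_zero ENNReal.ofReal_ne_top
      ((tendsto_add_atTop_iff_nat j).1 (ENNReal.tendsto_atTop_zero_of_tsum_ne_top (h1 j)))
  have h4 := (ENNReal.tendsto_toReal ENNReal.ofReal_ne_top).comp h3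
  rw [ENNReal.toReal_ofReal (FinMeas.pairing_nonneg _ (hf.nonneg j))] at h4
  refine h4.congr' ?_
  filter_upwards [(hd.comp hψ.tendsto_atTop).eventually self_mem_nhdsWithin] with i hi
  have := h2 (ψ i) hi
  rw [FinMeas.pairing_eq_toReal _ (hf.nonneg j), FinMeas.ofMeasure_toMeasure, Function.comp]

end LpConvergence

end IsMomentCauchy

/-! ### Conditioning on survival -/

section Survival

variable {E : Type*} [TopologicalSpace E] [T2Space E] [LocallyCompactSpace E]
  [SecondCountableTopology E] [MeasurableSpace E] [BorelSpace E] {m : Measure E} [m.Regular]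
  {n : ℕ} {Ω' : Fin n → Type*} [∀ i, MeasurableSpace (Ω' i)] {H : ∀ i, HuntProcess E (Ω' i)}
  {p : Fin n → ℝ → E → E → ℝ≥0∞} {x₀ : Fin n → E} {Ω : Type*} [MeasurableSpace Ω]
  {μ : Measure Ω} {Y : ∀ i, Ω → Ω' i}

/-- By independence and positivity of the survival probabilities of the single processes. -/
lemma measure_aliveEvent_ne_zero [SigmaFinite m] [IsProbabilityMeasure μ]
    (hsymm : ∀ i, (H i).IsSymmetric m)
    (hp : ∀ i, (H i).IsTransitionDensity m (p i))
    (hY : ∀ i, MeasurePreserving (Y i) μ ((H i).P (x₀ i : OnePoint E)))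
    (hindep : iIndepFun Y μ) {t : ℝ} (ht : 0 < t) : μ (aliveEvent H Y t) ≠ 0 := by
  have h1 : aliveEvent H Y t =
      ⋂ i ∈ Finset.univ, Y i ⁻¹' {ω | ENNReal.ofReal t < (H i).lifetime ω} := by
    ext ω
    simp [aliveEvent]
  rw [h1, hindep.measure_inter_preimage_eq_mul Finset.univ
    fun i _ => HuntProcess.measurableSet_alive t, Finset.prod_ne_zero_iff]
  intro i _
  rw [(hY i).measure_preimage (HuntProcess.measurableSet_alive t).nullMeasurableSet]
  exact (HuntProcess.P_alive_pos (hp i) (hsymm i) (x₀ i) ht).ne'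

omit [T2Space E] [LocallyCompactSpace E] [SecondCountableTopology E] [MeasurableSpace E]
  [BorelSpace E] in
lemma aliveLaw_le_smul (t : ℝ) : aliveLaw H Y μ t ≤ (μ (aliveEvent H Y t))⁻¹ • μ := by
  rw [aliveLaw, ProbabilityTheory.cond]
  gcongr
  exact Measure.restrict_le_self

end Survival

theorem mainTheorem4
    -- the metric measure space
    {E : Type*} [MetricSpace E] [LocallyCompactSpace E] [TopologicalSpace.SeparableSpace E]
    [MeasurableSpace E] [BorelSpace E]
    (m : Measure E) [IsLocallyFiniteMeasure m] [m.IsOpenPosMeasure]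
    -- the symmetric Hunt processes and their transition densities
    (n : ℕ) (hn : 2 ≤ n)
    {Ω' : Fin n → Type*} [∀ i, MeasurableSpace (Ω' i)]
    (H : ∀ i, HuntProcess E (Ω' i)) (hsymm : ∀ i, (H i).IsSymmetric m)
    (p : Fin n → ℝ → E → E → ℝ≥0∞) (hp : ∀ i, (H i).IsTransitionDensity m (p i))
    -- independent realisations of them, started at given points, on one probability space
    (x₀ : Fin n → E)
    {Ω : Type*} [MeasurableSpace Ω] (μ : Measure Ω) [IsProbabilityMeasure μ]
    (Y : ∀ i, Ω → Ω' i) (hY : ∀ i, MeasurePreserving (Y i) μ ((H i).P (x₀ i : OnePoint E)))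
    (hindep : iIndepFun Y μ)
    -- integrability of the Green functions
    (hgreen : ∀ i, (⨆ x : E, ∫⁻ y, green (p i) x y ^ n ∂m) < ∞)
    (t : ℝ) (ht : 0 < t) :
    ∃ _ : IsProbabilityMeasure (aliveLaw H Y μ t),
      (∀ ε : ℝ, 0 < ε → ∀ᵐ ω ∂(aliveLaw H Y μ t),
        IsFiniteMeasure (approxIntersection H Y m p ε t ω)) ∧
      ∃ ℓ : Ω → FinMeas E, Measurable ℓ ∧
        TendstoInDistribution
          (fun (ε : ℝ) ω => FinMeas.ofMeasure (approxIntersection H Y m p ε t ω))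
          (𝓝[>] 0) ℓ
          (fun _ => aliveLaw H Y μ t)
          (aliveLaw H Y μ t) ∧
        ∀ f : C_c(E, ℝ), (∀ x, 0 ≤ f x) → ∀ k : ℕ, 1 ≤ k →
          (∀ ε : ℝ, 0 < ε →
            MemLp (fun ω => (FinMeas.ofMeasure (approxIntersection H Y m p ε t ω)).pairing f) k
              (aliveLaw H Y μ t)) ∧
          MemLp (fun ω => (ℓ ω).pairing f) k
            (aliveLaw H Y μ t) ∧
          Tendsto (fun ε : ℝ => eLpNorm
              (fun ω => (FinMeas.ofMeasure (approxIntersection H Y m p ε t ω)).pairing f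
                - (ℓ ω).pairing f) k
              (aliveLaw H Y μ t))
            (𝓝[>] 0) (𝓝 0) := by
  have : SecondCountableTopology E := UniformSpace.secondCountable_of_separable E
  have : Nonempty E := ⟨x₀ ⟨0, by omega⟩⟩
  have hpos := measure_aliveEvent_ne_zero hsymm hp hY hindep ht
  have hprob : IsProbabilityMeasure (aliveLaw H Y μ t) := cond_isProbabilityMeasure hpos
  have hμ : IsMomentCauchy (approxIntersection H Y m p · t) μ :=
    ⟨fun ε F hF => measurable_lintegral_approxIntersection hp (fun i => (hY i).measurable) t ε hF,
      fun F B hF hB hFB k => exists_moment_bound hn hsymm hp hY hindep hgreen t hF hB hFB k,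
      fun F B hF hB hFB k hk =>
        tendsto_lintegral_absDiff_approxIntersection hn hsymm hp hY hindep hgreen t hF hB hFB hk⟩
  have hL := hμ.of_le_smul (ENNReal.inv_ne_top.2 hpos) (aliveLaw_le_smul t)
  obtain ⟨ℓ, e, hℓ, he, he0, hlim⟩ := hL.exists_ae_tendsto
  exact ⟨hprob, fun ε hε => hL.ae_isFiniteMeasure hε, ℓ, hℓ,
    hL.tendstoInDistribution hℓ he he0 hlim, fun f hf k hk =>
      ⟨fun ε hε => hL.memLp_pairing hf hk hε, hL.memLp_pairing_limit hℓ he he0 hlim hf hk,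
        hL.tendsto_eLpNorm he he0 hlim hf hk⟩⟩
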